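/- **Theorem 3.1 (Finite-$n$ spectral equivalence).** Let $n\ge 0$, let $t\in(0,1)$ and $\sigma^2=t(1-t)$. Let $a_1<\dots<a_p$ be real numbers with multiplicities $m_1,\dots,m_p\ge 1$, and $b_1<\dots<b_q$ real numbers with multiplicities $n_1,\dots,n_q\ge1$, where $\sum_i m_i=\sum_k n_k=n$. Put $$A=\mathrm{diag}(\underbrace{a_1,\dots,a_1}_{m_1},\dots,\underbrace{a_p,\dots,a_p}_{m_p}),\qquad B=\mathrm{diag}(\underbrace{b_1,\dots,b_1}_{n_1},\dots,\underbrace{b_q,\dots,b_q}_{n_q}).$$ On the space $\mathbb H(n)$ of complex Hermitian $n\times n$ matrices let $\mathrm dM=\prod_i \mathrm dM_{ii}\prod_{i<j}\mathrm d(\mathrm{Re}\,M_{ij})\,\mathrm d(\mathrm{Im}\,M_{ij})$, let $\mathrm dU,\mathrm dV$ be the normalized Haar measure on $\mathrm U(n)$, and let $$\mathrm d\mu_{A,B,t}(M)=\frac1{Z_{A,B,t}}\,e^{-\frac1{2\sigma^2}\mathrm{Tr}\,M^2}\Big(\int_{\mathrm U(n)}e^{\frac1t\mathrm{Tr}(AUMU^\dagger)}\,\mathrm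 dU\Big)\Big(\int_{\mathrm U(n)}e^{\frac1{1-t}\mathrm{Tr}(BVMV^\dagger)}\,\mathrm dV\Big)\,\mathrm dM ,$$ where $Z_{A,B,t}$ is the integral over $\mathbb H(n)$ of the unnormalized density. For $s>0$ and $\lambda\in\mathbb R^n$ let $D_A(\lambda;s)$ be the determinant of the $n\times n$ matrix with rows indexed by the pairs $(i,r)$, $1\le i\le p$, $0\le r<m_i$, in lexicographic order, columns indexed by $1\le j\le n$, and entries $$\partial_\alpha^{\,r}e^{\alpha\lambda_j/s}\big|_{\alpha=a_i}=(\lambda_j/s)^r e^{a_i\lambda_j/s};$$ define $D_B(\lambda;s)$ in the same way from the $b_k$ and $n_k$. (If all multiplicities are one, then $D_A(\lambda;t)=\det[e^{a_i\lambda_j/t}]_{i,j}$ and $D_B(\lambda;1-t)=\det[e^{b_k\lambda_j/(1-t)}]_{k,j}$.) Put $$w(\lambda)=D_A(\lambda;t)\,D_B(\lambda;1-t)\,e^{-\frac{1}{2t(1-t)}\sum_{j}\lambda_j^2}.$$ Then: 1. the unnormalized density of $\mu_{A,B,t}$ is integrable, $0<Z_{A,B,t}<\infty$, and $\mu_{A,B,t}$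 is a probability measure; 2. $w\ge 0$ on $\mathbb R^n$, $w$ is integrable on $\mathbb R^n$, and its integral over $\{\lambda_1<\dots<\lambda_n\}$ is positive; 3. under $\mu_{A,B,t}$, the vector of eigenvalues of $M$ in increasing order has the Karlin–McGregor density $w/\int_{\{\lambda_1<\dots<\lambda_n\}}w$ on $\{\lambda_1<\dots<\lambda_n\}$; equivalently, the eigenvalues labelled uniformly at random have the symmetric joint density $w/\int_{\mathbb R^n}w$ on $\mathbb R^n$. -/

import Mathlib

open MeasureTheory
open scoped Matrix BigOperators ENNReal

noncomputable section

namespace TwoHCIZ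

/-! ### The unitary group and its normalized Haar measure -/

/-- The unitary group `U(n)`, with the subspace topology of the space of matrices. -/
abbrev U (n : ℕ) : Type := Matrix.unitaryGroup (Fin n) ℂ

theorem compactSpace_U (n : ℕ) : CompactSpace (U n) := by
  refine isCompact_iff_compactSpace.mp ?_
  have hK : IsCompact
      (Set.pi Set.univ (fun _ : Fin n => Set.pi Set.univ
        (fun _ : Fin n => Metric.closedBall (0 : ℂ) 1))) :=
    isCompact_univ_pi fun _ => isCompact_univ_pi fun _ => isCompact_closedBall 0 1
  refine IsCompact.of_isClosed_subset (X := Matrix (Fin n) (Fin n) ℂ) hK ?_ ?_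
  · have h : ((Matrix.unitaryGroup (Fin n) ℂ : Set (Matrix (Fin n) (Fin n) ℂ)))
        = {M | M * star M = 1} := by
      ext M
      exact Matrix.mem_unitaryGroup_iff
    change IsClosed ((Matrix.unitaryGroup (Fin n) ℂ : Set (Matrix (Fin n) (Fin n) ℂ)))
    rw [h]
    exact isClosed_eq (by fun_prop) continuous_const
  · intro M hM i _ j _
    rw [mem_closedBall_zero_iff]
    exact entry_norm_bound_of_unitary hM i j

instance (n : ℕ) : CompactSpace (U n) := compactSpace_U n

instance (n : ℕ) : MeasurableSpace (U n) := borel (U n)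

instance (n : ℕ) : BorelSpace (U n) := ⟨rfl⟩

/-- The Haar measure on `U(n)`, normalized to have total mass one. -/
def haarU (n : ℕ) : Measure (U n) := Measure.haarMeasure ⊤

/-! ### Hermitian matrices, flat Lebesgue measure, eigenvalues -/

/-- The space `ℍ(n)` of `n × n` complex Hermitian matrices. -/
abbrev Herm (n : ℕ) : Type := {M : Matrix (Fin n) (Fin n) ℂ // M.IsHermitian}

instance (n : ℕ) : MeasurableSpace (Herm n) := borel (Herm n)

instance (n : ℕ) : BorelSpace (Herm n) := ⟨rfl⟩

/-- The independent entries of a Hermitian matrix: the real diagonal entries and the complex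
entries strictly above the diagonal. -/
abbrev Entries (n : ℕ) : Type :=
  (Fin n → ℝ) × ({p : Fin n × Fin n // p.1 < p.2} → ℂ)

/-- The Hermitian matrix with the given independent entries. -/
def ofEntries {n : ℕ} (x : Entries n) : Herm n :=
  ⟨Matrix.of fun i j =>
      if h : i < j then x.2 ⟨(i, j), h⟩
      else if h : j < i then star (x.2 ⟨(j, i), h⟩)
      else (x.1 i : ℂ), by
    ext i j
    rcases lt_trichotomy i j with h | h | h
    · simp [Matrix.conjTranspose_apply, h, h.not_gt]
    · subst h
      simp [Matrix.conjTranspose_apply]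
    · simp [Matrix.conjTranspose_apply, h, h.not_gt]⟩

theorem continuous_ofEntries {n : ℕ} : Continuous (ofEntries (n := n)) := by
  refine Continuous.subtype_mk ?_ _
  refine continuous_matrix fun i j => ?_
  simp only [Matrix.of_apply]
  split_ifs <;> fun_prop

/-- The flat Lebesgue measure `dM = ∏ᵢ dMᵢᵢ ∏_{i<j} d(Re Mᵢⱼ) d(Im Mᵢⱼ)` on `ℍ(n)`. -/
def lebesgueHerm (n : ℕ) : Measure (Herm n) :=
  Measure.map ofEntries (volume : Measure (Entries n))

/-- The eigenvalues of `M`, with multiplicity, in increasing order. -/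
def eig {n : ℕ} (M : Herm n) : Fin n → ℝ :=
  M.2.eigenvalues ∘ Tuple.sort M.2.eigenvalues

/-! ### Boundary data

`p` locations `x i` with multiplicities `m i` summing up to `n` are turned into a list of length `n`:
first `m 0` copies of `x 0`, then `m 1` copies of `x 1`, and so on. -/

/-- The position `k` of the list, read as a pair `(i, r)` with `r < m i` (lexicographic order). -/
def slot {n p : ℕ} (m : Fin p → ℕ) (hm : ∑ i, m i = n) (k : Fin n) : (i : Fin p) × Fin (m i) :=
  finSigmaFinEquiv.symm (Fin.cast hm.symm k)

/-- The diagonal matrix `diag(x₁, …, x₁, …, x_p, …, x_p)`, with `x i` repeated `m i` times. -/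
def boundaryMatrix {n p : ℕ} (x : Fin p → ℝ) (m : Fin p → ℕ) (hm : ∑ i, m i = n) :
    Matrix (Fin n) (Fin n) ℂ :=
  Matrix.diagonal fun k => (x (slot m hm k).1 : ℂ)

/-! ### The two-HCIZ dressed Gaussian ensemble -/

/-- The HCIZ integral `∫_{U(n)} exp (c Tr (A U M U†)) dU`. For Hermitian `A` and `M` the trace is
real, so that taking the real part changes nothing. -/
def hciz {n : ℕ} (c : ℝ) (A : Matrix (Fin n) (Fin n) ℂ) (M : Herm n) : ℝ :=
  ∫ V : U n, Real.exp (c * (Matrix.trace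
    (A * (V : Matrix (Fin n) (Fin n) ℂ) * M.1 * (V : Matrix (Fin n) (Fin n) ℂ)ᴴ)).re) ∂(haarU n)

/-- The unnormalized density of the ensemble with respect to `dM`. -/
def weight {n : ℕ} (A B : Matrix (Fin n) (Fin n) ℂ) (t : ℝ) (M : Herm n) : ℝ :=
  Real.exp (-(1 / (2 * (t * (1 - t)))) * (Matrix.trace (M.1 ^ 2)).re)
    * hciz (1 / t) A M * hciz (1 / (1 - t)) B M

/-- The partition function `Z_{A,B,t}`. -/
def partitionFunction {n : ℕ} (A B : Matrix (Fin n) (Fin n) ℂ) (t : ℝ) : ℝ :=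
  ∫ M, weight A B t M ∂(lebesgueHerm n)

/-- The two-HCIZ dressed Gaussian measure `μ_{A,B,t}`. -/
def ensemble {n : ℕ} (A B : Matrix (Fin n) (Fin n) ℂ) (t : ℝ) : Measure (Herm n) :=
  (lebesgueHerm n).withDensity fun M =>
    ENNReal.ofReal (weight A B t M / partitionFunction A B t)

/-- The law of the increasingly ordered eigenvalue vector of `M` under `μ`. -/
def orderedEigenvalueLaw {n : ℕ} (μ : Measure (Herm n)) : Measure (Fin n → ℝ) :=
  Measure.map eig μ

/-- The law of the eigenvalue vector of `M` under `μ` when the eigenvalues are labelled uniformly at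
random (the average over all `n!` labellings); its density is the symmetric joint density. -/
def symmetricEigenvalueLaw {n : ℕ} (μ : Measure (Herm n)) : Measure (Fin n → ℝ) :=
  (n.factorial : ℝ≥0∞)⁻¹ • ∑ s : Equiv.Perm (Fin n), Measure.map (fun M => eig M ∘ s) μ

/-! ### The Karlin–McGregor law -/

/-- The confluent version of the determinant `det [exp (xᵢ λⱼ / s)]`: a location `x i` of
multiplicity `m i` contributes the `m i` rows `∂_α ^ r exp (α λⱼ / s)` at `α = x i`, `0 ≤ r < m i`.
When all multiplicities are one these are just the rows `exp (xᵢ λⱼ / s)`. -/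
def confluentDet {n p : ℕ} (x : Fin p → ℝ) (m : Fin p → ℕ) (hm : ∑ i, m i = n)
    (s : ℝ) (l : Fin n → ℝ) : ℝ :=
  Matrix.det (Matrix.of fun k j : Fin n =>
    iteratedDeriv ((slot m hm k).2 : ℕ) (fun α : ℝ => Real.exp (α * l j / s)) (x (slot m hm k).1))

/-- The unnormalized Karlin–McGregor density at time `t`, for start locations `a` with
multiplicities `ma` and end locations `b` with multiplicities `mb`. -/
def kmWeight {n p q : ℕ} (a : Fin p → ℝ) (ma : Fin p → ℕ) (hma : ∑ i, ma i = n)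
    (b : Fin q → ℝ) (mb : Fin q → ℕ) (hmb : ∑ k, mb k = n) (t : ℝ) (l : Fin n → ℝ) : ℝ :=
  confluentDet a ma hma t l * confluentDet b mb hmb (1 - t) l
    * Real.exp (-(∑ j, l j ^ 2) / (2 * (t * (1 - t))))

/-- The probability measure on `S ⊆ ℝⁿ` whose density is proportional to `w`. -/
def lawOn {n : ℕ} (S : Set (Fin n → ℝ)) (w : (Fin n → ℝ) → ℝ) : Measure (Fin n → ℝ) :=
  (volume.restrict S).withDensity fun l => ENNReal.ofReal (w l / ∫ l' in S, w l')

/-- The open Weyl chamber `λ₁ < ⋯ < λₙ`. -/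
def chamber (n : ℕ) : Set (Fin n → ℝ) := {l | StrictMono l}

end TwoHCIZ

end

noncomputable section

namespace TwoHCIZ

open ProbabilityTheory

/-! ### Invariance of the Haar measure on the unitary group -/

/-! Write Δ for the Vandermonde determinant. Three formulas carry the theorem. Under `dM` the
ordered spectrum has density c Δ(λ)² (Weyl). The first HCIZ integral is a constant times D_A(λ;
t)/Δ(λ), the second a constant times D_B(λ; 1 - t)/Δ(λ) (Harish-Chandra–Itzykson–Zuber). The
Vandermonde factors cancel and `kmWeight` remains (`mul_spectralWeight`). Weyl's formula and the
HCIZ formula are both derived here, together, by a Fourier argument.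

The analytic input concerns the orbital integral φ_X(λ) = ∫ exp(i Tr(X V diag(λ) V†)) dV. Invariance
of Haar measure under infinitesimal rotations (`integral_commutator_eq_zero`) shows that Δ φ_X is an
eigenfunction of the Euclidean Laplacian on ℝⁿ with eigenvalue -Tr X². So the average of Δ φ_X over
a standard Gaussian centred at a is e^{-Tr X²/2} Δ(a) φ_X(a) (`integral_vandermonde_orbital`). Since
Δ is antisymmetric and φ_X symmetric, folding this average onto the Weyl chamber turns exp(∑ aᵢ λᵢ)
into det[e^{aᵢ λⱼ}].

The matrix measure HCIZ(a, M) e^{-Tr M²/2} dM has Fourier transform const · e^{-Tr X²/2} φ_X(a).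
Comparing the two, and using that the Fourier transform determines a finite measure, its spectrum
has the a priori signed density const · Δ(λ) det[e^{aᵢ λⱼ}] e^{-|λ|²/2} / Δ(a)
(`map_eig_tilted_add`). The same law is also the still unknown flat spectral law times HCIZ(a, λ)
e^{-|λ|²/2}. For a = ρ = (0, …, n-1) the determinant is a Vandermonde in the e^{λⱼ}, hence positive,
and division gives the flat law in terms of HCIZ(ρ, λ). A general a then gives the ratio HCIZ(a,
λ)/HCIZ(ρ, λ), and the symmetry of HCIZ in its two spectra fixes the remaining factor
(`hcizDiag_mul_vdm_mul_vdm`, `map_eig_lebesgueHerm`).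

Multiplicities are reached by pulling equal locations apart by multiples of ε and letting ε → 0⁺:
row operations inside each block make the determinant and the Vandermonde vanish to the same power
of ε (`hcizDiag_block`). Positivity of the confluent determinants is then inherited from positivity
of the HCIZ integral. -/

instance (n : ℕ) : IsTopologicalGroup (U n) := inferInstance

instance (n : ℕ) : (haarU n).IsHaarMeasure := by unfold haarU; infer_instance

instance (n : ℕ) : IsProbabilityMeasure (haarU n) :=
  ⟨Measure.haarMeasure_self⟩

/-- A right translate of Haar measure is again a Haar probability measure, so uniqueness applies. -/
instance (n : ℕ) : (haarU n).IsMulRightInvariant := by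
  refine ⟨fun g => ?_⟩
  have : IsProbabilityMeasure (Measure.map (fun x => x * g) (haarU n)) :=
    Measure.isProbabilityMeasure_map (by fun_prop)
  exact Measure.isHaarMeasure_eq_of_isProbabilityMeasure _ _

/-- Right invariance makes the inverted measure left invariant, so it is a multiple of Haar measure;
total mass one makes the factor one. This is the source of the symmetry of the HCIZ integral in its
two spectra. -/
instance (n : ℕ) : (haarU n).IsInvInvariant := by
  refine ⟨?_⟩
  have : IsProbabilityMeasure (haarU n).inv :=
    Measure.isProbabilityMeasure_map (by fun_prop)
  have h := Measure.isMulInvariant_eq_smul_of_compactSpace (haarU n).inv (haarU n)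
  have h1 : (haarU n).inv Set.univ = 1 := measure_univ
  rw [h] at h1 ⊢
  simp only [Measure.smul_apply, measure_univ] at h1
  rw [ENNReal.smul_def, smul_eq_mul, mul_one] at h1
  rw [show Measure.haarScalarFactor (haarU n).inv (haarU n) = 1 by exact_mod_cast h1, one_smul]

/-- A continuous function on the unitary group is integrable. -/
theorem integrable_haarU {n : ℕ} {E : Type*} [NormedAddCommGroup E] {f : U n → E}
    (hf : Continuous f) : Integrable f (haarU n) :=
  hf.integrable_of_hasCompactSupport (HasCompactSupport.of_compactSpace f)

theorem integral_intervalIntegral_swap_haarU {n : ℕ} {f : U n × ℝ → ℂ} (hf : Continuous f) :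
    ∫ V : U n, (∫ x in (0:ℝ)..1, f (V, x)) ∂haarU n
      = ∫ x in (0:ℝ)..1, (∫ V : U n, f (V, x) ∂haarU n) := by
  simp only [intervalIntegral.integral_of_le (zero_le_one' ℝ)]
  rw [← integral_Icc_eq_integral_Ioc]
  simp only [← integral_Icc_eq_integral_Ioc]
  refine integral_integral_swap (f := fun V x => f (V, x)) ?_
  have := hf.continuousOn.integrableOn_compact (K := Set.univ ×ˢ Set.Icc (0:ℝ) 1)
    (μ := (haarU n).prod volume) (isCompact_univ.prod isCompact_Icc)
  rw [IntegrableOn, ← Measure.prod_restrict, Measure.restrict_univ] at this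
  exact this

/-! ### Infinitesimal rotations -/

section Rotation

open scoped Matrix.Norms.L2Operator

/-- A skew-Hermitian matrix generates a one-parameter group of unitary matrices. -/
theorem exists_unitary_flow {n : ℕ} (Z : Matrix (Fin n) (Fin n) ℂ) (hZ : star Z = -Z) :
    ∃ R : ℝ → U n, Continuous R ∧ R 0 = 1 ∧
      ∀ (Y : Matrix (Fin n) (Fin n) ℂ) (i j : Fin n) (x : ℝ),
        HasDerivAt (fun e : ℝ => (star (R e : Matrix (Fin n) (Fin n) ℂ) * Y * R e) i j)
          (((star (R x : Matrix (Fin n) (Fin n) ℂ) * Y * R x) * Z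
            - Z * (star (R x : Matrix (Fin n) (Fin n) ℂ) * Y * R x)) i j) x := by
  let _ : NormedAlgebra ℚ (Matrix (Fin n) (Fin n) ℂ) := .restrictScalars ℚ ℝ _
  have hmem : ∀ e : ℝ, NormedSpace.exp (e • Z) ∈ unitary (Matrix (Fin n) (Fin n) ℂ) := fun e =>
    NormedSpace.exp_mem_unitary_of_mem_skewAdjoint (by
      rw [skewAdjoint.mem_iff, star_smul, hZ, smul_neg, star_trivial])
  have hstar : ∀ e : ℝ, star (NormedSpace.exp (e • Z)) = NormedSpace.exp (e • (-Z)) := fun e => by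
    rw [NormedSpace.star_exp, star_smul, hZ, star_trivial]
  refine ⟨fun e => ⟨NormedSpace.exp (e • Z), hmem e⟩, ?_, ?_, ?_⟩
  · refine Continuous.subtype_mk ?_ _
    exact continuous_iff_continuousAt.2 fun x => (hasDerivAt_exp_smul_const Z x).continuousAt
  · ext1
    simp
  · intro Y i j x
    simp only [hstar]
    have h1 := hasDerivAt_exp_smul_const Z x
    have h2 := hasDerivAt_exp_smul_const' (-Z) x
    have h3 := (h2.mul_const Y).mul h1
    have h4 := (Matrix.entryLinearMap ℝ ℂ i j).toContinuousLinearMap.hasFDerivAt.comp_hasDerivAt x h3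
    refine h4.congr_deriv ?_
    simp only [LinearMap.coe_toContinuousLinearMap', Matrix.entryLinearMap_apply]
    refine congrFun (congrFun ?_ i) j
    simp only [neg_mul, Matrix.mul_assoc]
    abel

end Rotation

/-! ### Angular identities for averages over a unitary orbit -/

/-- `V† X V`. -/
def conjBy {n : ℕ} (X : Matrix (Fin n) (Fin n) ℂ) (V : U n) : Matrix (Fin n) (Fin n) ℂ :=
  star (V : Matrix (Fin n) (Fin n) ℂ) * X * V

theorem conjBy_mul {n : ℕ} (X : Matrix (Fin n) (Fin n) ℂ) (V W : U n) :
    conjBy X (V * W) = star (W : Matrix (Fin n) (Fin n) ℂ) * conjBy X V * W := by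
  simp only [conjBy, Submonoid.coe_mul, star_mul, Matrix.mul_assoc]

theorem continuous_conjBy {n : ℕ} (X : Matrix (Fin n) (Fin n) ℂ) :
    Continuous (conjBy (n := n) X) := by
  unfold conjBy
  fun_prop

theorem continuous_conjBy_apply {n : ℕ} (X : Matrix (Fin n) (Fin n) ℂ) (i j : Fin n) :
    Continuous fun V : U n => conjBy X V i j :=
  (continuous_conjBy X).matrix_elem i j

/-- The Haar average of an infinitesimal rotation vanishes. -/
theorem integral_commutator_eq_zero {n : ℕ} (X Z : Matrix (Fin n) (Fin n) ℂ) (hZ : star Z = -Z)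
    (F G : Matrix (Fin n) (Fin n) ℂ → ℂ) (hF : Continuous F) (hG : Continuous G)
    (hFG : ∀ (Y : ℝ → Matrix (Fin n) (Fin n) ℂ) (x : ℝ),
      (∀ i j, HasDerivAt (fun e => Y e i j) ((Y x * Z - Z * Y x) i j) x) →
        HasDerivAt (fun e => F (Y e)) (G (Y x)) x) :
    ∫ V : U n, G (conjBy X V) ∂haarU n = 0 := by
  obtain ⟨R, hRc, hR0, hR⟩ := exists_unitary_flow Z hZ
  have hd : ∀ (V : U n) (x : ℝ),
      HasDerivAt (fun e => F (conjBy X (V * R e))) (G (conjBy X (V * R x))) x := by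
    intro V x
    simp only [conjBy_mul]
    exact hFG _ x fun i j => hR _ i j x
  have hGc : Continuous fun p : U n × ℝ => G (conjBy X (p.1 * R p.2)) :=
    hG.comp ((continuous_conjBy X).comp (by fun_prop))
  have hftc : ∀ V : U n, ∫ x in (0:ℝ)..1, G (conjBy X (V * R x))
      = F (conjBy X (V * R 1)) - F (conjBy X V) := by
    intro V
    have h := intervalIntegral.integral_eq_sub_of_hasDerivAt (fun x _ => hd V x)
      ((hGc.comp (by fun_prop : Continuous fun x : ℝ => (V, x))).intervalIntegrable 0 1)
    simpa [hR0] using h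
  have hFi : Integrable (fun V : U n => F (conjBy X V)) (haarU n) :=
    integrable_haarU (hF.comp (continuous_conjBy X))
  -- Right invariance is used twice: the endpoints F(V R(1)) and F(V) have equal Haar means, and the
  -- mean of G along the flow does not depend on the time x. Working with the integrated identity
  -- avoids differentiating under the Haar integral.
  have h0 : ∫ V : U n, (∫ x in (0:ℝ)..1, G (conjBy X (V * R x))) ∂haarU n = 0 := by
    simp only [hftc]
    rw [integral_sub (hFi.comp_mul_right (R 1)) hFi,
      integral_mul_right_eq_self (fun V => F (conjBy X V)), sub_self]
  have hswap : ∫ V : U n, (∫ x in (0:ℝ)..1, G (conjBy X (V * R x))) ∂haarU n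
      = ∫ x in (0:ℝ)..1, (∫ V : U n, G (conjBy X (V * R x)) ∂haarU n) :=
    integral_intervalIntegral_swap_haarU hGc
  have hconst : ∀ x : ℝ, ∫ V : U n, G (conjBy X (V * R x)) ∂haarU n
      = ∫ V : U n, G (conjBy X V) ∂haarU n := fun x =>
    integral_mul_right_eq_self (fun V => G (conjBy X V)) (R x)
  rw [h0] at hswap
  simpa [hconst] using hswap.symm

/-- `exp (i ∑ⱼ lⱼ Yⱼⱼ)`. -/
def phase {n : ℕ} (l : Fin n → ℝ) (Y : Matrix (Fin n) (Fin n) ℂ) : ℂ :=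
  Complex.exp (Complex.I * ∑ j, (l j : ℂ) * Y j j)

theorem continuous_phase {n : ℕ} (l : Fin n → ℝ) : Continuous (phase l) := by
  unfold phase
  fun_prop

/-- The rotation in the (k, m) plane, applied to Y ↦ Y_km · phase. The commutator changes Y_km at
rate Y_kk - Y_mm, while the exponent of the phase sees only the diagonal entries k and m, which
change by opposite amounts. -/
theorem integral_rotation_identity {n : ℕ} (X : Matrix (Fin n) (Fin n) ℂ) (l : Fin n → ℝ)
    {k m : Fin n} (hkm : k ≠ m) :
    ∫ V : U n, ((conjBy X V k k - conjBy X V m m)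
      + Complex.I * (l m - l k) * (conjBy X V k m + conjBy X V m k) * conjBy X V k m)
        * phase l (conjBy X V) ∂haarU n = 0 := by
  refine integral_commutator_eq_zero X (Matrix.single k m 1 - Matrix.single m k 1) ?_
    (fun Y => Y k m * phase l Y)
    (fun Y => ((Y k k - Y m m) + Complex.I * (l m - l k) * (Y k m + Y m k) * Y k m) * phase l Y)
    ?_ ?_ ?_
  · rw [star_sub, Matrix.star_eq_conjTranspose, Matrix.star_eq_conjTranspose,
      Matrix.conjTranspose_single, Matrix.conjTranspose_single, star_one, neg_sub]
  · have := continuous_phase l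
    fun_prop
  · have := continuous_phase l
    fun_prop
  · intro Y x hY
    have hdiag : HasDerivAt (fun e => ∑ j, (l j : ℂ) * Y e j j)
        ((l m - l k) * (Y x k m + Y x m k)) x := by
      have h := HasDerivAt.fun_sum (u := Finset.univ)
        fun (j : Fin n) _ => (hY j j).const_mul (l j : ℂ)
      refine h.congr_deriv ?_
      have : ∀ j, ((Y x * (Matrix.single k m 1 - Matrix.single m k 1)
          - (Matrix.single k m 1 - Matrix.single m k 1) * Y x : Matrix (Fin n) (Fin n) ℂ)) j j
          = (if j = m then Y x k m + Y x m k else 0) - (if j = k then Y x k m + Y x m k else 0) := by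
        intro j
        by_cases h1 : j = m
        · subst h1
          simp [Matrix.mul_sub, Matrix.sub_mul, hkm.symm, add_comm]
        · by_cases h2 : j = k
          · subst h2
            simp [Matrix.mul_sub, Matrix.sub_mul, hkm]
            ring
          · simp [Matrix.mul_sub, Matrix.sub_mul, h1, h2]
      refine (Finset.sum_congr rfl fun j _ => by rw [this j]).trans ?_
      simp only [mul_sub, mul_ite, mul_zero, Finset.sum_sub_distrib, Finset.sum_ite_eq',
        Finset.mem_univ, if_true]
      ring
    have hph : HasDerivAt (fun e => phase l (Y e))
        (phase l (Y x) * (Complex.I * ((l m - l k) * (Y x k m + Y x m k)))) x :=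
      (hdiag.const_mul Complex.I).cexp
    refine ((hY k m).mul hph).congr_deriv ?_
    have : (Y x * (Matrix.single k m 1 - Matrix.single m k 1)
          - (Matrix.single k m 1 - Matrix.single m k 1) * Y x : Matrix (Fin n) (Fin n) ℂ) k m = Y x k k - Y x m m := by
      simp [Matrix.mul_sub, Matrix.sub_mul, hkm, hkm.symm]
    rw [this]
    ring

/-- The diagonal unitary matrix with entry `i` at position `k` and `1` elsewhere. -/
def quarterTurn {n : ℕ} (k : Fin n) : U n :=
  ⟨Matrix.diagonal (Function.update 1 k Complex.I), by
    rw [Matrix.mem_unitaryGroup_iff, Matrix.star_eq_conjTranspose, Matrix.diagonal_conjTranspose,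
      Matrix.diagonal_mul_diagonal, ← Matrix.diagonal_one]
    congr 1
    ext j
    by_cases h : j = k
    · subst h
      simp
    · simp [h]⟩

/-- Right translation by `quarterTurn k` multiplies Y_km by -i and fixes the diagonal, so the
integrand changes sign while its mean does not. -/
theorem integral_offDiag_sq_eq_zero {n : ℕ} (X : Matrix (Fin n) (Fin n) ℂ) (l : Fin n → ℝ)
    {k m : Fin n} (hkm : k ≠ m) :
    ∫ V : U n, conjBy X V k m * conjBy X V k m * phase l (conjBy X V) ∂haarU n = 0 := by
  have hentry : ∀ (V : U n) (i j : Fin n), conjBy X (V * quarterTurn k) i j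
      = star (Function.update (1 : Fin n → ℂ) k Complex.I i) * conjBy X V i j
        * Function.update (1 : Fin n → ℂ) k Complex.I j := by
    intro V i j
    rw [conjBy_mul]
    simp only [quarterTurn, Matrix.star_eq_conjTranspose, Matrix.diagonal_conjTranspose]
    rw [Matrix.mul_diagonal, Matrix.diagonal_mul, Pi.star_apply]
  have hph : ∀ V : U n, phase l (conjBy X (V * quarterTurn k)) = phase l (conjBy X V) := by
    intro V
    unfold phase
    congr 2
    refine Finset.sum_congr rfl fun j _ => ?_
    rw [hentry]
    by_cases h : j = k
    · subst h
      simp only [Function.update_self, Complex.star_def, Complex.conj_I]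
      linear_combination (-(l j : ℂ) * conjBy X V j j) * Complex.I_sq
    · simp [h]
  have h := integral_mul_right_eq_self (μ := haarU n)
    (fun V => conjBy X V k m * conjBy X V k m * phase l (conjBy X V)) (quarterTurn k)
  have h2 : ∀ V : U n, conjBy X (V * quarterTurn k) k m * conjBy X (V * quarterTurn k) k m
      * phase l (conjBy X (V * quarterTurn k))
      = -(conjBy X V k m * conjBy X V k m * phase l (conjBy X V)) := by
    intro V
    rw [hph, hentry]
    simp only [Function.update_self, Complex.star_def, Complex.conj_I, ne_eq, hkm.symm,
      not_false_eq_true, Function.update_of_ne, Pi.one_apply, mul_one]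
    linear_combination (conjBy X V k m * conjBy X V k m * phase l (conjBy X V)) * Complex.I_sq
  simp only [h2, integral_neg] at h
  exact self_eq_neg.1 h.symm

/-- After division by l k - l m, the first-order terms of the radial Laplacian are traded for the
products Y_km Y_mk that appear in Tr Y². -/
theorem integral_diag_sub {n : ℕ} (X : Matrix (Fin n) (Fin n) ℂ) (l : Fin n → ℝ)
    {k m : Fin n} (hkm : k ≠ m) :
    ∫ V : U n, (conjBy X V k k - conjBy X V m m) * phase l (conjBy X V) ∂haarU n
      = Complex.I * (l k - l m)
        * ∫ V : U n, conjBy X V k m * conjBy X V m k * phase l (conjBy X V) ∂haarU n := by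
  have hc := fun i j => continuous_conjBy_apply X i j
  have hp : Continuous fun V : U n => phase l (conjBy X V) :=
    (continuous_phase l).comp (continuous_conjBy X)
  have h1 := integral_rotation_identity X l hkm
  have h2 := integral_offDiag_sq_eq_zero X l hkm
  have h3 : ∀ V : U n, ((conjBy X V k k - conjBy X V m m)
      + Complex.I * (l m - l k) * (conjBy X V k m + conjBy X V m k) * conjBy X V k m)
        * phase l (conjBy X V)
      = (conjBy X V k k - conjBy X V m m) * phase l (conjBy X V)
        + (Complex.I * (l m - l k) * (conjBy X V k m * conjBy X V k m * phase l (conjBy X V))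
        + Complex.I * (l m - l k) * (conjBy X V k m * conjBy X V m k * phase l (conjBy X V))) := by
    intro V
    ring
  simp only [h3] at h1
  rw [integral_add (integrable_haarU (by fun_prop)) (integrable_haarU (by fun_prop)),
    integral_add (integrable_haarU (by fun_prop)) (integrable_haarU (by fun_prop)),
    integral_const_mul, integral_const_mul, h2] at h1
  linear_combination h1

/-! ### The radial equation for the orbital integral -/

/-- The strictly increasing pairs of indices. -/
def pairs (n : ℕ) : Finset (Fin n × Fin n) := Finset.univ.filter fun p => p.1 < p.2

theorem sum_eq_sum_diag_add_pairs {n : ℕ} {M : Type*} [AddCommMonoid M] (f : Fin n → Fin n → M) :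
    ∑ i, ∑ j, f i j = ∑ i, f i i + ∑ p ∈ pairs n, (f p.1 p.2 + f p.2 p.1) := by
  rw [← Fintype.sum_prod_type' f, Finset.sum_add_distrib]
  have h1 : ∑ p ∈ pairs n, f p.2 p.1
      = ∑ p ∈ Finset.univ.filter (fun p : Fin n × Fin n => p.2 < p.1), f p.1 p.2 :=
    Finset.sum_bij' (fun p _ => p.swap) (fun p _ => p.swap)
      (by simp [pairs]) (by simp [pairs]) (by simp) (by simp) (by simp)
  have h2 : ∑ i, f i i
      = ∑ p ∈ Finset.univ.filter (fun p : Fin n × Fin n => p.1 = p.2), f p.1 p.2 :=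
    Finset.sum_bij' (fun i _ => (i, i)) (fun p _ => p.1)
      (by simp) (by simp) (by simp) (by
        rintro ⟨i, j⟩ h
        simp at h
        simp [h]) (by simp)
  rw [h1, h2, pairs, Finset.sum_filter, Finset.sum_filter, Finset.sum_filter,
    ← Finset.sum_add_distrib, ← Finset.sum_add_distrib]
  refine Finset.sum_congr rfl fun p _ => ?_
  rcases lt_trichotomy p.1 p.2 with h | h | h
  · simp [h, h.ne, h.not_gt]
  · simp [h]
  · simp [h, h.ne', h.not_gt]

theorem trace_sq_eq {n : ℕ} (Y : Matrix (Fin n) (Fin n) ℂ) :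
    Matrix.trace (Y * Y) = ∑ k, Y k k * Y k k + 2 * ∑ p ∈ pairs n, Y p.1 p.2 * Y p.2 p.1 := by
  simp only [Matrix.trace, Matrix.diag_apply, Matrix.mul_apply]
  rw [sum_eq_sum_diag_add_pairs, Finset.mul_sum]
  congr 1
  exact Finset.sum_congr rfl fun p _ => by ring

theorem trace_conjBy_sq {n : ℕ} (X : Matrix (Fin n) (Fin n) ℂ) (V : U n) :
    Matrix.trace (conjBy X V * conjBy X V) = Matrix.trace (X * X) := by
  have hV : (V : Matrix (Fin n) (Fin n) ℂ) * star (V : Matrix (Fin n) (Fin n) ℂ) = 1 :=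
    Matrix.mem_unitaryGroup_iff.1 V.2
  have : conjBy X V * conjBy X V
      = star (V : Matrix (Fin n) (Fin n) ℂ) * (X * X * (V : Matrix (Fin n) (Fin n) ℂ)) := by
    simp only [conjBy]
    calc _ = star (V : Matrix (Fin n) (Fin n) ℂ) * X
          * ((V : Matrix (Fin n) (Fin n) ℂ) * star (V : Matrix (Fin n) (Fin n) ℂ)) * X * V := by
          simp only [Matrix.mul_assoc]
      _ = _ := by rw [hV]; simp only [Matrix.mul_assoc, Matrix.one_mul]
  rw [this, Matrix.trace_mul_comm, Matrix.mul_assoc, hV, Matrix.mul_one]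

/-- The radial part of the eigenvalue equation for the orbital integral. -/
theorem integral_radial_eq_zero {n : ℕ} (X : Matrix (Fin n) (Fin n) ℂ) (l : Fin n → ℝ)
    (hl : Function.Injective l) :
    ∫ V : U n, ((Matrix.trace (X * X) - ∑ k, conjBy X V k k * conjBy X V k k) / 2
        + Complex.I * ∑ p ∈ pairs n, (conjBy X V p.1 p.1 - conjBy X V p.2 p.2) / (l p.1 - l p.2))
        * phase l (conjBy X V) ∂haarU n = 0 := by
  have hc := fun i j => continuous_conjBy_apply X i j
  have hp : Continuous fun V : U n => phase l (conjBy X V) :=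
    (continuous_phase l).comp (continuous_conjBy X)
  have h1 : ∀ V : U n, ((Matrix.trace (X * X) - ∑ k, conjBy X V k k * conjBy X V k k) / 2
        + Complex.I * ∑ p ∈ pairs n, (conjBy X V p.1 p.1 - conjBy X V p.2 p.2) / (l p.1 - l p.2))
        * phase l (conjBy X V)
      = ∑ p ∈ pairs n, (conjBy X V p.1 p.2 * conjBy X V p.2 p.1 * phase l (conjBy X V)
        + Complex.I / (l p.1 - l p.2)
          * ((conjBy X V p.1 p.1 - conjBy X V p.2 p.2) * phase l (conjBy X V))) := by
    intro V
    -- Conjugation does not change Tr X², so it may be computed from Y = V† X V; removing the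
    -- squared diagonal leaves twice the off-diagonal products, one for each pair.
    rw [← trace_conjBy_sq X V, trace_sq_eq, add_sub_cancel_left,
      mul_div_cancel_left₀ _ two_ne_zero, Finset.mul_sum, ← Finset.sum_add_distrib,
      Finset.sum_mul]
    exact Finset.sum_congr rfl fun p _ => by ring
  simp only [h1]
  rw [integral_finsetSum _ fun p _ => integrable_haarU (by fun_prop)]
  refine Finset.sum_eq_zero fun p hp' => ?_
  have hne : p.1 ≠ p.2 := (Finset.mem_filter.1 hp').2.ne
  have hl' : (l p.1 : ℂ) - l p.2 ≠ 0 :=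
    sub_ne_zero.2 fun h => hne (hl (by exact_mod_cast h))
  rw [integral_add (integrable_haarU (by fun_prop)) (integrable_haarU (by fun_prop)),
    integral_const_mul, integral_diag_sub X l hne]
  field_simp
  linear_combination (∫ V : U n, conjBy X V p.1 p.2 * conjBy X V p.2 p.1
    * phase l (conjBy X V) ∂haarU n) * Complex.I_sq

section Polynomials

open Polynomial

/-! ### Determinants: derivatives and integrals -/

theorem hasDerivAt_det {n : ℕ} {M : ℝ → Matrix (Fin n) (Fin n) ℂ} {M' : Matrix (Fin n) (Fin n) ℂ}
    {x : ℝ} (h : ∀ i j, HasDerivAt (fun e => M e i j) (M' i j) x) :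
    HasDerivAt (fun e => (M e).det) (∑ k, ((M x).updateRow k (M' k)).det) x := by
  simp only [Matrix.det_apply']
  rw [Finset.sum_comm]
  refine HasDerivAt.fun_sum fun σ _ => ?_
  rw [← Finset.mul_sum]
  refine HasDerivAt.const_mul _ ?_
  have h1 := HasDerivAt.fun_finsetProd (u := Finset.univ) fun (i : Fin n) _ => h (σ i) i
  refine h1.congr_deriv ?_
  rw [← Equiv.sum_comp σ fun k => ∏ i, (M x).updateRow k (M' k) (σ i) i]
  refine Finset.sum_congr rfl fun k _ => ?_
  rw [← Finset.prod_erase_mul Finset.univ _ (Finset.mem_univ k), smul_eq_mul]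
  congr 1
  · refine Finset.prod_congr rfl fun j hj => ?_
    rw [Matrix.updateRow_ne]
    exact fun hh => (Finset.ne_of_mem_erase hj) (σ.injective hh)
  · rw [Matrix.updateRow_self]

theorem integrable_det_pi {n : ℕ} (μ : Fin n → Measure ℝ) [∀ i, SigmaFinite (μ i)]
    (F : Fin n → Fin n → ℝ → ℂ) (hF : ∀ i j, Integrable (F i j) (μ i)) :
    Integrable (fun x : Fin n → ℝ => (Matrix.of fun i j => F i j (x i)).det) (Measure.pi μ) := by
  simp only [← Matrix.det_transpose (Matrix.of _), Matrix.det_apply', Matrix.transpose_apply,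
    Matrix.of_apply]
  exact integrable_finsetSum _ fun σ _ =>
    (Integrable.fintype_prod_dep fun i => hF i (σ i)).const_mul _

/-- Row i involves only x i, so each product in the Leibniz expansion factors over the product
measure. -/
theorem integral_det_pi {n : ℕ} (μ : Fin n → Measure ℝ) [∀ i, SigmaFinite (μ i)]
    (F : Fin n → Fin n → ℝ → ℂ) (hF : ∀ i j, Integrable (F i j) (μ i)) :
    ∫ x : Fin n → ℝ, (Matrix.of fun i j => F i j (x i)).det ∂Measure.pi μ
      = (Matrix.of fun i j => ∫ x, F i j x ∂μ i).det := by
  simp only [← Matrix.det_transpose (Matrix.of _), Matrix.det_apply', Matrix.transpose_apply,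
    Matrix.of_apply]
  rw [integral_finsetSum _ fun σ _ =>
    (Integrable.fintype_prod_dep fun i => hF i (σ i)).const_mul _]
  refine Finset.sum_congr rfl fun σ _ => ?_
  rw [integral_const_mul, integral_fintype_prod_eq_prod (f := fun i x => F i (σ i) x)]

/-! ### Gaussian moments -/

/-- The Hermite-type polynomials `x ↦ E (x + √s g) ^ m`, for a standard Gaussian `g`. -/
def gaussPoly (s : ℂ) : ℕ → ℂ[X]
  | 0 => 1
  | m + 1 => X * gaussPoly s m + C s * derivative (gaussPoly s m)

/-- The Appell property: differentiation commutes with Gaussian averaging, so the differentiated row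
of a Vandermonde matrix averages to the differentiated polynomials. -/
theorem derivative_gaussPoly_succ (s : ℂ) (m : ℕ) :
    derivative (gaussPoly s (m + 1)) = C ((m : ℂ) + 1) * gaussPoly s m := by
  induction m with
  | zero => simp [gaussPoly]
  | succ m ih =>
    rw [gaussPoly, derivative_add, derivative_mul, derivative_C_mul, ih, derivative_C_mul,
      gaussPoly]
    simp only [derivative_X, map_add, map_natCast, map_one]
    push_cast
    ring

theorem gaussPoly_monic_natDegree (s : ℂ) (m : ℕ) :
    (gaussPoly s m).Monic ∧ (gaussPoly s m).natDegree = m := by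
  induction m with
  | zero => simp [gaussPoly]
  | succ m ih =>
    have h1 : (X * gaussPoly s m).Monic := monic_X.mul ih.1
    have h2 : (X * gaussPoly s m).natDegree = m + 1 := by
      rw [monic_X.natDegree_mul ih.1, natDegree_X, ih.2, add_comm]
    have h3 : (C s * derivative (gaussPoly s m)).degree < (X * gaussPoly s m).degree := by
      rw [degree_eq_natDegree h1.ne_zero, h2]
      refine lt_of_le_of_lt ((degree_mul_le _ _).trans (add_le_add_left degree_C_le _)) ?_
      rw [zero_add]
      refine lt_of_le_of_lt (degree_derivative_le) ?_
      rw [degree_eq_natDegree ih.1.ne_zero, ih.2]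
      exact_mod_cast Nat.lt_succ_self m
    refine ⟨h1.add_of_left h3, ?_⟩
    rw [gaussPoly, natDegree_add_eq_left_of_degree_lt h3, h2]

theorem integrable_pow_mul_cexp_gaussianReal (a : ℝ) (v : NNReal) (z : ℂ) (m : ℕ) :
    Integrable (fun x : ℝ => (x : ℂ) ^ m * Complex.exp (z * x)) (gaussianReal a v) :=
  integrable_pow_mul_cexp_of_re_mem_interior_integrableExpSet (X := fun x : ℝ => x)
    (by rw [integrableExpSet_fun_id_gaussianReal, interior_univ]; trivial) m

/-- The moments are the derivatives in z of exp(z a + v z²/2). Each derivative multiplies by a + v z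
and differentiates the polynomial, with a chain-rule factor v: exactly the recursion defining
`gaussPoly`. -/
theorem integral_pow_mul_cexp_gaussianReal (a : ℝ) (v : NNReal) (z : ℂ) (m : ℕ) :
    ∫ x : ℝ, (x : ℂ) ^ m * Complex.exp (z * x) ∂gaussianReal a v
      = (gaussPoly (v : ℂ) m).eval (a + v * z) * Complex.exp (z * a + v * z ^ 2 / 2) := by
  have hmem : ∀ z : ℂ, z.re ∈ interior (integrableExpSet (fun x : ℝ => x) (gaussianReal a v)) :=
    fun z => by rw [integrableExpSet_fun_id_gaussianReal, interior_univ]; trivial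
  rw [← iteratedDeriv_complexMGF (hmem z) m]
  have h0 : complexMGF (fun x : ℝ => x) (gaussianReal a v)
      = fun z => Complex.exp (z * a + v * z ^ 2 / 2) := funext fun z => complexMGF_id_gaussianReal z
  rw [h0]
  clear hmem h0
  induction m generalizing z with
  | zero => simp [gaussPoly]
  | succ m ih =>
    rw [iteratedDeriv_succ, funext ih]
    have h1 : HasDerivAt (fun z : ℂ => (a : ℂ) + v * z) v z := by
      simpa using ((hasDerivAt_id z).const_mul (v : ℂ)).const_add (a : ℂ)
    have h2 : HasDerivAt (fun z : ℂ => z * a + v * z ^ 2 / 2) (a + v * z) z := by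
      refine (((hasDerivAt_id z).mul_const (a : ℂ)).add
        ((((hasDerivAt_id z).pow 2).const_mul (v : ℂ)).div_const 2)).congr_deriv ?_
      simp
      ring
    have h3 := (((gaussPoly (v : ℂ) m).hasDerivAt (a + v * z)).comp z h1).mul h2.cexp
    refine h3.deriv.trans ?_
    simp only [gaussPoly, eval_add, eval_mul, eval_X, eval_C, Function.comp]
    ring

/-! ### Gaussian averages of the Vandermonde determinant -/

/-- The derivative of the Vandermonde determinant at `z` in the direction `y`. -/
def vandermondeDeriv {n : ℕ} (z y : Fin n → ℂ) : ℂ :=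
  ∑ k, ((Matrix.vandermonde z).updateRow k fun j => (j : ℂ) * z k ^ ((j : ℕ) - 1) * y k).det

theorem hasDerivAt_vandermonde {n : ℕ} {z : ℝ → Fin n → ℂ} {y : Fin n → ℂ} {x : ℝ}
    (h : ∀ i, HasDerivAt (fun e => z e i) (y i) x) :
    HasDerivAt (fun e => (Matrix.vandermonde (z e)).det) (vandermondeDeriv (z x) y) x :=
  hasDerivAt_det (M := fun e => Matrix.vandermonde (z e))
    (M' := fun i j => (j : ℂ) * z x i ^ ((j : ℕ) - 1) * y i) fun i j => (h i).fun_pow j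

/-- The Gaussian measure on `ℝⁿ` with mean `a` and covariance `v` times the identity. -/
def gaussPi {n : ℕ} (a : Fin n → ℝ) (v : NNReal) : Measure (Fin n → ℝ) :=
  Measure.pi fun i => gaussianReal (a i) v

instance {n : ℕ} (a : Fin n → ℝ) (v : NNReal) : IsProbabilityMeasure (gaussPi a v) := by
  unfold gaussPi
  infer_instance

theorem det_mul_rows {n : ℕ} (M : Fin n → Fin n → ℂ) (w : Fin n → ℂ) :
    (Matrix.of fun i j => M i j * w i).det = (Matrix.of M).det * ∏ i, w i := by
  rw [mul_comm, ← Matrix.det_mul_column w (Matrix.of M)]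
  simp only [Matrix.of_apply, mul_comm]

/-- Averaging replaces the monomials by monic polynomials of the same degrees, which leaves the
Vandermonde determinant unchanged. This is how harmonicity of Δ enters. -/
theorem gauss_vandermonde {n : ℕ} (a : Fin n → ℝ) (v : NNReal) (z : Fin n → ℂ) :
    Integrable (fun l : Fin n → ℝ => (Matrix.vandermonde fun i => (l i : ℂ)).det
        * ∏ i, Complex.exp (z i * l i)) (gaussPi a v) ∧
    ∫ l : Fin n → ℝ, (Matrix.vandermonde fun i => (l i : ℂ)).det
        * ∏ i, Complex.exp (z i * l i) ∂gaussPi a v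
      = (Matrix.vandermonde fun i => (a i + v * z i : ℂ)).det
        * ∏ i, Complex.exp (z i * a i + v * z i ^ 2 / 2) := by
  have h1 : ∀ l : Fin n → ℝ, (Matrix.vandermonde fun i => (l i : ℂ)).det
        * ∏ i, Complex.exp (z i * l i)
      = (Matrix.of fun i (j : Fin n) => (l i : ℂ) ^ (j : ℕ) * Complex.exp (z i * l i)).det :=
    fun l => (det_mul_rows _ _).symm
  have hi := fun i (j : Fin n) => integrable_pow_mul_cexp_gaussianReal (a i) v (z i) j
  simp only [h1]
  refine ⟨integrable_det_pi _ (fun i (j : Fin n) x => (x : ℂ) ^ (j : ℕ) * Complex.exp (z i * x)) hi, ?_⟩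
  rw [gaussPi, integral_det_pi _ (fun i (j : Fin n) x => (x : ℂ) ^ (j : ℕ) * Complex.exp (z i * x)) hi]
  simp only [integral_pow_mul_cexp_gaussianReal]
  rw [det_mul_rows, Matrix.det_eval_matrixOfPolynomials_eq_det_vandermonde _
    (fun j => gaussPoly (v : ℂ) j) (fun j => (gaussPoly_monic_natDegree _ _).2)
    (fun j => (gaussPoly_monic_natDegree _ _).1)]

/-- Monomials and monic Gaussian polynomials give the same determinant as a function of z, so their
derivatives along z + e y at e = 0 agree. -/
theorem vandermondeDeriv_eq_gaussPoly {n : ℕ} (s : ℂ) (z y : Fin n → ℂ) :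
    vandermondeDeriv z y = ∑ k, ((Matrix.of fun i (j : Fin n) => (gaussPoly s j).eval (z i)).updateRow k
      fun j => (derivative (gaussPoly s j)).eval (z k) * y k).det := by
  have hz : ∀ i, HasDerivAt (fun e : ℝ => z i + e * y i) (y i) 0 := fun i => by
    simpa using ((hasDerivAt_id (0 : ℝ)).ofReal_comp.mul_const (y i)).const_add (z i)
  have h1 := hasDerivAt_vandermonde hz
  have h2 := hasDerivAt_det (x := 0) (M := fun e : ℝ => Matrix.of fun i (j : Fin n) =>
      (gaussPoly s j).eval (z i + e * y i))
    (M' := fun i j => (derivative (gaussPoly s j)).eval (z i + (0 : ℝ) * y i) * y i)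
    fun i j => by
      have := ((gaussPoly s j).hasDerivAt (z i + (0 : ℝ) * y i)).comp (0 : ℝ) (hz i)
      simpa [Function.comp_def] using this
  have h3 : (fun e : ℝ => (Matrix.vandermonde fun i => z i + e * y i).det)
      = fun e : ℝ => (Matrix.of fun i (j : Fin n) => (gaussPoly s j).eval (z i + e * y i)).det :=
    funext fun e => Matrix.det_eval_matrixOfPolynomials_eq_det_vandermonde _
      (fun j => gaussPoly s j) (fun j => (gaussPoly_monic_natDegree _ _).2)
      (fun j => (gaussPoly_monic_natDegree _ _).1)
  rw [h3] at h1
  simpa using h1.unique h2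

theorem gauss_vandermondeDeriv {n : ℕ} (a : Fin n → ℝ) (v : NNReal) (z : Fin n → ℂ) :
    Integrable (fun l : Fin n → ℝ => vandermondeDeriv (fun i => (l i : ℂ)) z
        * ∏ i, Complex.exp (z i * l i)) (gaussPi a v) ∧
    ∫ l : Fin n → ℝ, vandermondeDeriv (fun i => (l i : ℂ)) z
        * ∏ i, Complex.exp (z i * l i) ∂gaussPi a v
      = vandermondeDeriv (fun i => (a i + v * z i : ℂ)) z
        * ∏ i, Complex.exp (z i * a i + v * z i ^ 2 / 2) := by
  -- `F k` is the matrix of the k-th summand, in which row k is differentiated, with the exponential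
  -- factors distributed over the rows.
  let F : Fin n → Fin n → Fin n → ℝ → ℂ := fun k i j x =>
    (if i = k then (j : ℂ) * (x : ℂ) ^ ((j : ℕ) - 1) * z k else (x : ℂ) ^ (j : ℕ))
      * Complex.exp (z i * x)
  have hup : ∀ (k : Fin n) (M : Matrix (Fin n) (Fin n) ℂ) (r : Fin n → ℂ),
      M.updateRow k r = Matrix.of fun i j => if i = k then r j else M i j := fun k M r => by
    ext i j
    rw [Matrix.updateRow_apply, Matrix.of_apply]
  have h1 : ∀ l : Fin n → ℝ, vandermondeDeriv (fun i => (l i : ℂ)) z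
        * ∏ i, Complex.exp (z i * l i)
      = ∑ k, (Matrix.of fun i j => F k i j (l i)).det := by
    intro l
    rw [vandermondeDeriv, Finset.sum_mul]
    refine Finset.sum_congr rfl fun k _ => ?_
    rw [hup, ← det_mul_rows]
    congr 2
    ext i j
    by_cases h : i = k
    · subst h
      simp [F]
    · simp [F, h, Matrix.vandermonde_apply]
  have hFi : ∀ k i j, Integrable (F k i j) (gaussianReal (a i) v) := by
    intro k i j
    by_cases h : i = k
    · simp only [F, h, if_true]
      refine ((integrable_pow_mul_cexp_gaussianReal (a k) v (z k) (j - 1)).const_mul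
        ((j : ℂ) * z k)).congr (.of_forall fun x => ?_)
      ring
    · simp only [F, h, if_false]
      exact integrable_pow_mul_cexp_gaussianReal (a i) v (z i) j
  have hFint : ∀ k i j, ∫ x, F k i j x ∂gaussianReal (a i) v
      = (if i = k then (derivative (gaussPoly (v : ℂ) j)).eval (a k + v * z k : ℂ) * z k
        else (gaussPoly (v : ℂ) j).eval (a i + v * z i : ℂ))
        * Complex.exp (z i * a i + v * z i ^ 2 / 2) := by
    intro k i j
    by_cases h : i = k
    · simp only [F, h, if_true]
      have : ∀ x : ℝ, (j : ℂ) * (x : ℂ) ^ ((j : ℕ) - 1) * z k * Complex.exp (z k * x)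
          = ((j : ℂ) * z k) * ((x : ℂ) ^ ((j : ℕ) - 1) * Complex.exp (z k * x)) := fun x => by ring
      simp only [this]
      rw [integral_const_mul, integral_pow_mul_cexp_gaussianReal]
      -- The exponent j - 1 is truncated at j = 0, where the coefficient j makes both sides vanish.
      rcases Nat.eq_zero_or_eq_succ_pred (j : ℕ) with h0 | h0
      · simp [h0, gaussPoly]
      · rw [h0, derivative_gaussPoly_succ]
        simp
        ring
    · simp only [F, h, if_false]
      exact integral_pow_mul_cexp_gaussianReal (a i) v (z i) j
  simp only [h1]
  unfold gaussPi
  refine ⟨integrable_finsetSum _ fun k _ => integrable_det_pi _ _ (hFi k), ?_⟩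
  rw [integral_finsetSum _ fun k _ => integrable_det_pi _ _ (hFi k),
    vandermondeDeriv_eq_gaussPoly (v : ℂ), Finset.sum_mul]
  refine Finset.sum_congr rfl fun k _ => ?_
  rw [integral_det_pi _ _ (hFi k), hup, ← det_mul_rows]
  simp only [hFint, Matrix.of_apply]

end Polynomials

/-! ### Gaussian measures on `ℝⁿ` -/

theorem gaussPi_eq_withDensity {n : ℕ} (a : Fin n → ℝ) {v : NNReal} (hv : v ≠ 0) :
    gaussPi a v = (volume : Measure (Fin n → ℝ)).withDensity
      fun l => ENNReal.ofReal (∏ i, gaussianPDFReal (a i) v (l i)) := by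
  refine Measure.pi_eq fun s hs => ?_
  have hi : ∀ i, Integrable (gaussianPDFReal (a i) v) (volume.restrict (s i)) := fun i =>
    (integrable_gaussianPDFReal (a i) v).restrict
  have hr : (volume : Measure (Fin n → ℝ)).restrict (Set.univ.pi s)
      = Measure.pi fun i => volume.restrict (s i) := by
    rw [volume_pi, Measure.restrict_pi_pi]
  rw [withDensity_apply _ (MeasurableSet.univ_pi hs), hr,
    ← ofReal_integral_eq_lintegral_ofReal (Integrable.fintype_prod_dep hi)
      (.of_forall fun l => Finset.prod_nonneg fun i _ => gaussianPDFReal_nonneg _ _ _),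
    integral_fintype_prod_eq_prod (f := fun i x => gaussianPDFReal (a i) v x),
    ENNReal.ofReal_prod_of_nonneg fun i _ =>
      integral_nonneg fun x => gaussianPDFReal_nonneg _ _ _]
  exact Finset.prod_congr rfl fun i _ => (gaussianReal_apply_eq_integral _ hv _).symm

theorem measurable_gaussDensity {n : ℕ} (a : Fin n → ℝ) (v : NNReal) :
    Measurable fun l : Fin n → ℝ => ∏ i, gaussianPDFReal (a i) v (l i) :=
  Finset.measurable_prod _ fun i _ => (measurable_gaussianPDFReal _ _).comp (measurable_pi_apply i)

theorem integral_gaussPi {n : ℕ} (a : Fin n → ℝ) {v : NNReal} (hv : v ≠ 0)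
    (f : (Fin n → ℝ) → ℂ) :
    ∫ l, f l ∂gaussPi a v = ∫ l, ((∏ i, gaussianPDFReal (a i) v (l i) : ℝ) : ℂ) * f l := by
  rw [gaussPi_eq_withDensity a hv, integral_withDensity_eq_integral_toReal_smul
    (measurable_gaussDensity a v).ennreal_ofReal (.of_forall fun _ => ENNReal.ofReal_lt_top)]
  refine integral_congr_ae (.of_forall fun l => ?_)
  simp only
  rw [ENNReal.toReal_ofReal (Finset.prod_nonneg fun i _ => gaussianPDFReal_nonneg _ _ _),
    Complex.real_smul]

theorem integrable_gaussPi_iff {n : ℕ} (a : Fin n → ℝ) {v : NNReal} (hv : v ≠ 0)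
    (f : (Fin n → ℝ) → ℂ) :
    Integrable f (gaussPi a v)
      ↔ Integrable (fun l => ((∏ i, gaussianPDFReal (a i) v (l i) : ℝ) : ℂ) * f l) := by
  rw [gaussPi_eq_withDensity a hv, integrable_withDensity_iff_integrable_smul'
    (measurable_gaussDensity a v).ennreal_ofReal (.of_forall fun _ => ENNReal.ofReal_lt_top)]
  refine integrable_congr (.of_forall fun l => ?_)
  simp only
  rw [ENNReal.toReal_ofReal (Finset.prod_nonneg fun i _ => gaussianPDFReal_nonneg _ _ _),
    Complex.real_smul]

/-- Almost every vector has pairwise distinct coordinates. -/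
theorem ae_injective (n : ℕ) : ∀ᵐ l : Fin n → ℝ, Function.Injective l := by
  have h : ∀ p : Fin n × Fin n, p.1 ≠ p.2 → ∀ᵐ l : Fin n → ℝ, l p.1 ≠ l p.2 := by
    intro p hp
    let S : Submodule ℝ (Fin n → ℝ) :=
      LinearMap.ker (LinearMap.proj (R := ℝ) (φ := fun _ : Fin n => ℝ) p.1 - LinearMap.proj p.2)
    have hS : S ≠ ⊤ := by
      intro h
      have h1 : (Pi.single p.1 1 : Fin n → ℝ) ∈ S := h ▸ Submodule.mem_top
      simp [S, hp.symm] at h1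
    have h0 := Measure.addHaar_submodule (volume : Measure (Fin n → ℝ)) S hS
    rw [ae_iff]
    refine measure_mono_null (fun l hl => ?_) h0
    simpa [S, sub_eq_zero] using hl
  have h2 : ∀ᵐ l : Fin n → ℝ, ∀ p : Fin n × Fin n, p.1 ≠ p.2 → l p.1 ≠ l p.2 :=
    ae_all_iff.2 fun p => by
      by_cases hp : p.1 = p.2
      · exact .of_forall fun l h => absurd hp h
      · exact (h p hp).mono fun l hl _ => hl
  exact h2.mono fun l hl i j hij => by_contra fun hne => hl (i, j) hne hij

theorem ae_injective_gaussPi {n : ℕ} (a : Fin n → ℝ) {v : NNReal} (hv : v ≠ 0) :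
    ∀ᵐ l ∂gaussPi a v, Function.Injective l := by
  rw [gaussPi_eq_withDensity a hv]
  exact (withDensity_absolutelyContinuous _ _).ae_le (ae_injective n)

/-! ### The orbital integral and the Gaussian average against the Vandermonde determinant -/

theorem det_vandermonde_eq_prod_pairs {R : Type*} [CommRing R] {n : ℕ} (z : Fin n → R) :
    (Matrix.vandermonde z).det = ∏ p ∈ pairs n, (z p.2 - z p.1) := by
  rw [Matrix.det_vandermonde, pairs, Finset.prod_filter, ← Finset.univ_product_univ,
    Finset.prod_product]
  refine Finset.prod_congr rfl fun i _ => ?_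
  rw [← Finset.prod_filter]
  refine Finset.prod_congr ?_ fun _ _ => rfl
  ext j
  simp

/-- Logarithmic differentiation of the product of differences, available when no factor vanishes. -/
theorem vandermondeDeriv_eq_of_injective {n : ℕ} {z : Fin n → ℂ} (hz : Function.Injective z)
    (y : Fin n → ℂ) :
    vandermondeDeriv z y = (Matrix.vandermonde z).det
      * ∑ p ∈ pairs n, (y p.1 - y p.2) / (z p.1 - z p.2) := by
  have h1 : ∀ i, HasDerivAt (fun e : ℝ => z i + e * y i) (y i) 0 := fun i => by
    simpa using ((hasDerivAt_id (0 : ℝ)).ofReal_comp.mul_const (y i)).const_add (z i)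
  have h2 := hasDerivAt_vandermonde h1
  have h3 := HasDerivAt.fun_finsetProd (u := pairs n)
    fun (p : Fin n × Fin n) _ => (h1 p.2).sub (h1 p.1)
  have h4 : (fun e : ℝ => (Matrix.vandermonde fun i => z i + e * y i).det)
      = fun e : ℝ => ∏ p ∈ pairs n, ((z p.2 + e * y p.2) - (z p.1 + e * y p.1)) :=
    funext fun e => det_vandermonde_eq_prod_pairs _
  rw [h4] at h2
  have h5 := h2.unique h3
  simp only [Complex.ofReal_zero, zero_mul, add_zero] at h5
  rw [h5, det_vandermonde_eq_prod_pairs, Finset.mul_sum]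
  refine Finset.sum_congr rfl fun p hp => ?_
  have hne : z p.1 - z p.2 ≠ 0 := sub_ne_zero.2 fun h => (Finset.mem_filter.1 hp).2.ne (hz h)
  rw [← Finset.prod_erase_mul _ _ hp, smul_eq_mul]
  simp only [Pi.sub_apply, Complex.ofReal_zero, zero_mul, add_zero]
  field_simp
  ring

theorem integrable_vandermonde_row {n : ℕ} (a : Fin n → ℝ) (v : NNReal) (k : Fin n) :
    Integrable (fun l : Fin n → ℝ => ((Matrix.vandermonde fun i => (l i : ℂ)).updateRow k
      fun j => (j : ℂ) * (l k : ℂ) ^ ((j : ℕ) - 1)).det) (gaussPi a v) := by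
  have hpow : ∀ (i : Fin n) (m : ℕ), Integrable (fun x : ℝ => (x : ℂ) ^ m) (gaussianReal (a i) v) :=
    fun i m => by simpa using integrable_pow_mul_cexp_gaussianReal (a i) v 0 m
  have h := integrable_det_pi (fun i => gaussianReal (a i) v) (fun i (j : Fin n) x =>
    if i = k then (j : ℂ) * (x : ℂ) ^ ((j : ℕ) - 1) else (x : ℂ) ^ (j : ℕ)) fun i j => by
      by_cases h : i = k
      · simpa [h] using (hpow k (j - 1)).const_mul (j : ℂ)
      · simpa [h] using hpow i j
  refine h.congr (.of_forall fun l => ?_)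
  refine congrArg Matrix.det ?_
  ext i j
  rw [Matrix.updateRow_apply, Matrix.of_apply]
  by_cases h : i = k
  · simp [h]
  · simp [h, Matrix.vandermonde_apply]

/-- Linearity in the direction separates the dependence on z from that on y. Joint integrability
over λ and V then follows term by term: an integrable function of λ times a bounded one. -/
theorem vandermondeDeriv_eq_sum {n : ℕ} (z y : Fin n → ℂ) :
    vandermondeDeriv z y = ∑ k, y k * ((Matrix.vandermonde z).updateRow k
      fun j => (j : ℂ) * z k ^ ((j : ℕ) - 1)).det := by
  refine Finset.sum_congr rfl fun k _ => ?_
  rw [← Matrix.det_updateRow_smul]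
  congr 2
  ext j
  simp [mul_comm]

theorem integrable_mul_bounded_prod {n : ℕ} {γ : Measure (Fin n → ℝ)} [IsFiniteMeasure γ]
    {f : (Fin n → ℝ) → ℂ} (hf : Integrable f γ) {g : (Fin n → ℝ) × U n → ℂ} (hg : Continuous g)
    {C : ℝ} (hC : ∀ p, ‖g p‖ ≤ C) :
    Integrable (fun p : (Fin n → ℝ) × U n => f p.1 * g p) (γ.prod (haarU n)) :=
  (hf.comp_fst (haarU n)).mul_bdd hg.aestronglyMeasurable (.of_forall hC)

theorem conjBy_diag_im {n : ℕ} {X : Matrix (Fin n) (Fin n) ℂ} (hX : X.IsHermitian) (V : U n)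
    (k : Fin n) : (conjBy X V k k).im = 0 := by
  have : (conjBy X V).IsHermitian := Matrix.isHermitian_conjTranspose_mul_mul _ hX
  exact Complex.conj_eq_iff_im.1 (this.apply k k)

theorem phase_eq_prod {n : ℕ} (l : Fin n → ℝ) (Y : Matrix (Fin n) (Fin n) ℂ) :
    phase l Y = ∏ k, Complex.exp (Complex.I * Y k k * l k) := by
  rw [phase, ← Complex.exp_sum, Finset.mul_sum]
  congr 1
  exact Finset.sum_congr rfl fun k _ => by ring

theorem norm_phase {n : ℕ} {X : Matrix (Fin n) (Fin n) ℂ} (hX : X.IsHermitian) (l : Fin n → ℝ)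
    (V : U n) : ‖phase l (conjBy X V)‖ = 1 := by
  rw [phase, Complex.norm_exp, Complex.I_mul_re, Complex.im_sum]
  simp [conjBy_diag_im hX]

theorem continuous_phase_conjBy {n : ℕ} (X : Matrix (Fin n) (Fin n) ℂ) :
    Continuous fun p : (Fin n → ℝ) × U n => phase p.1 (conjBy X p.2) := by
  have := continuous_conjBy X
  unfold phase
  fun_prop

/-- The orbital integral `∫ exp (i Tr (X V diag(l) V†)) dV`. -/
def orbital {n : ℕ} (X : Matrix (Fin n) (Fin n) ℂ) (l : Fin n → ℝ) : ℂ :=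
  ∫ V : U n, phase l (conjBy X V) ∂haarU n

theorem integrable_vandermonde_gaussPi {n : ℕ} (a : Fin n → ℝ) (v : NNReal) :
    Integrable (fun l : Fin n → ℝ => (Matrix.vandermonde fun i => (l i : ℂ)).det) (gaussPi a v) := by
  simpa using (gauss_vandermonde a v 0).1

/-- The diagonal of `V† X V`, times `i`. -/
def iDiag {n : ℕ} (X : Matrix (Fin n) (Fin n) ℂ) (V : U n) : Fin n → ℂ :=
  fun k => Complex.I * conjBy X V k k

theorem continuous_iDiag {n : ℕ} (X : Matrix (Fin n) (Fin n) ℂ) (k : Fin n) :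
    Continuous fun V : U n => iDiag X V k :=
  continuous_const.mul (continuous_conjBy_apply X k k)

theorem prod_exp_iDiag {n : ℕ} (X : Matrix (Fin n) (Fin n) ℂ) (V : U n) (l : Fin n → ℝ) :
    ∏ k, Complex.exp (iDiag X V k * l k) = phase l (conjBy X V) :=
  (phase_eq_prod _ _).symm

/-- The generator of the heat flow vanishes on the orbital integral, for almost all points. -/
theorem integral_generator_eq_zero {n : ℕ} (X : Matrix (Fin n) (Fin n) ℂ) {l : Fin n → ℝ}
    (hl : Function.Injective l) :
    ∫ V : U n, (vandermondeDeriv (fun i => (l i : ℂ)) (iDiag X V)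
      + (Matrix.vandermonde fun i => (l i : ℂ)).det
        * ((∑ k, iDiag X V k ^ 2) / 2 + Matrix.trace (X * X) / 2))
          * phase l (conjBy X V) ∂haarU n = 0 := by
  have hl' : Function.Injective fun i => (l i : ℂ) := Complex.ofReal_injective.comp hl
  have h := integral_radial_eq_zero X l hl
  have h2 : ∀ V : U n, (vandermondeDeriv (fun i => (l i : ℂ)) (iDiag X V)
      + (Matrix.vandermonde fun i => (l i : ℂ)).det
        * ((∑ k, iDiag X V k ^ 2) / 2 + Matrix.trace (X * X) / 2)) * phase l (conjBy X V)
      = (Matrix.vandermonde fun i => (l i : ℂ)).det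
        * (((Matrix.trace (X * X) - ∑ k, conjBy X V k k * conjBy X V k k) / 2
        + Complex.I * ∑ p ∈ pairs n, (conjBy X V p.1 p.1 - conjBy X V p.2 p.2) / (l p.1 - l p.2))
        * phase l (conjBy X V)) := by
    intro V
    rw [vandermondeDeriv_eq_of_injective hl']
    have e1 : ∑ k, iDiag X V k ^ 2 = -∑ k, conjBy X V k k * conjBy X V k k := by
      rw [← Finset.sum_neg_distrib]
      refine Finset.sum_congr rfl fun k _ => ?_
      simp only [iDiag]
      linear_combination (conjBy X V k k ^ 2) * Complex.I_sq
    have e2 : ∑ p ∈ pairs n, (iDiag X V p.1 - iDiag X V p.2) / ((l p.1 : ℂ) - l p.2)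
        = Complex.I * ∑ p ∈ pairs n,
          (conjBy X V p.1 p.1 - conjBy X V p.2 p.2) / ((l p.1 : ℂ) - l p.2) := by
      rw [Finset.mul_sum]
      refine Finset.sum_congr rfl fun p _ => ?_
      simp only [iDiag]
      ring
    rw [e1, e2]
    ring
  simp only [h2]
  rw [integral_const_mul, h, mul_zero]

theorem exists_bound_haarU {n : ℕ} {f : U n → ℂ} (hf : Continuous f) : ∃ C, ∀ V, ‖f V‖ ≤ C := by
  obtain ⟨C, hC⟩ := isCompact_univ.exists_bound_of_continuousOn hf.continuousOn
  exact ⟨C, fun V => hC V trivial⟩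

/-- For fixed V the integrand is the Gaussian average over λ of (½∇² + ½ Tr X²) applied to Δ(λ) ·
phase. After exchanging the integrals, the Haar average vanishes at every λ with distinct
coordinates; nonzero variance makes these almost all λ. -/
theorem integral_heat_generator_eq_zero {n : ℕ} {X : Matrix (Fin n) (Fin n) ℂ}
    (hX : X.IsHermitian) (a : Fin n → ℝ) {v : NNReal} (hv : v ≠ 0) :
    ∫ V : U n, (vandermondeDeriv (fun i => (a i + v * iDiag X V i : ℂ)) (iDiag X V)
      + (Matrix.vandermonde fun i => (a i + v * iDiag X V i : ℂ)).det
        * ((∑ k, iDiag X V k ^ 2) / 2 + Matrix.trace (X * X) / 2))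
        * ∏ i, Complex.exp (iDiag X V i * a i + v * iDiag X V i ^ 2 / 2) ∂haarU n = 0 := by
  have hid := fun k => continuous_iDiag X k
  have hph := continuous_phase_conjBy X
  have hnorm : ∀ p : (Fin n → ℝ) × U n, ‖phase p.1 (conjBy X p.2)‖ = 1 := fun p =>
    norm_phase hX p.1 p.2
  let f : U n → (Fin n → ℝ) → ℂ := fun V l =>
    (vandermondeDeriv (fun i => (l i : ℂ)) (iDiag X V)
      + (Matrix.vandermonde fun i => (l i : ℂ)).det
        * ((∑ k, iDiag X V k ^ 2) / 2 + Matrix.trace (X * X) / 2))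
          * phase l (conjBy X V)
  have h1 : ∀ V : U n,
      (vandermondeDeriv (fun i => (a i + v * iDiag X V i : ℂ)) (iDiag X V)
      + (Matrix.vandermonde fun i => (a i + v * iDiag X V i : ℂ)).det
        * ((∑ k, iDiag X V k ^ 2) / 2 + Matrix.trace (X * X) / 2))
        * ∏ i, Complex.exp (iDiag X V i * a i + v * iDiag X V i ^ 2 / 2)
      = ∫ l, f V l ∂gaussPi a v := by
    intro V
    obtain ⟨i1, e1⟩ := gauss_vandermonde a v (iDiag X V)
    obtain ⟨i2, e2⟩ := gauss_vandermondeDeriv a v (iDiag X V)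
    have : ∀ l : Fin n → ℝ, f V l
        = vandermondeDeriv (fun i => (l i : ℂ)) (iDiag X V) * ∏ i, Complex.exp (iDiag X V i * l i)
          + ((∑ k, iDiag X V k ^ 2) / 2 + Matrix.trace (X * X) / 2)
          * ((Matrix.vandermonde fun i => (l i : ℂ)).det * ∏ i, Complex.exp (iDiag X V i * l i)) := by
      intro l
      simp only [f, prod_exp_iDiag]
      ring
    simp only [this]
    rw [integral_add i2 (i1.const_mul _), integral_const_mul, e1, e2]
    ring
  have hint : Integrable (Function.uncurry fun l V => f V l) ((gaussPi a v).prod (haarU n)) := by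
    have hterm : ∀ {c : (Fin n → ℝ) → ℂ}, Integrable c (gaussPi a v) → ∀ {w : U n → ℂ},
        Continuous w → Integrable (fun p : (Fin n → ℝ) × U n =>
          c p.1 * (w p.2 * phase p.1 (conjBy X p.2))) ((gaussPi a v).prod (haarU n)) := by
      intro c hc w hw
      obtain ⟨C, hC⟩ := exists_bound_haarU hw
      refine integrable_mul_bounded_prod hc ((hw.comp continuous_snd).mul hph) (C := C) fun p => ?_
      rw [norm_mul, hnorm, mul_one]
      exact hC p.2
    have hsum := (integrable_finsetSum Finset.univ fun (k : Fin n) _ =>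
      hterm (integrable_vandermonde_row a v k) (hid k)).add
      (hterm (integrable_vandermonde_gaussPi a v)
        (w := fun V => (∑ k, iDiag X V k ^ 2) / 2 + Matrix.trace (X * X) / 2) (by fun_prop))
    refine hsum.congr (.of_forall fun p => ?_)
    simp only [Function.uncurry, f, vandermondeDeriv_eq_sum, Pi.add_apply]
    refine Eq.trans ?_ (add_mul _ _ _).symm
    rw [Finset.sum_mul, mul_assoc]
    congr 1
    exact Finset.sum_congr rfl fun k _ => by ring
  simp only [h1]
  rw [integral_integral_swap hint.swap]
  refine integral_eq_zero_of_ae ?_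
  filter_upwards [ae_injective_gaussPi a hv] with l hl
  exact integral_generator_eq_zero X hl

/-- The Gaussian average of the product of the Vandermonde determinant and the orbital integral. -/
theorem integral_vandermonde_orbital {n : ℕ} {X : Matrix (Fin n) (Fin n) ℂ}
    (hX : X.IsHermitian) (a : Fin n → ℝ) :
    ∫ l, (Matrix.vandermonde fun i => (l i : ℂ)).det * orbital X l ∂gaussPi a 1
      = Complex.exp (-(Matrix.trace (X * X) / 2))
        * ((Matrix.vandermonde fun i => (a i : ℂ)).det * orbital X a) := by
  have hid := fun k => continuous_iDiag X k
  let T := Matrix.trace (X * X)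
  -- `B V s` is e^{s Tr X²/2} times the average of Δ · phase over a Gaussian of variance s centred
  -- at a. Its Haar average is constant in s; s = 0 and s = 1 give the two sides of the claim.
  let B : U n → ℝ → ℂ := fun V s => Complex.exp (s * (T / 2))
    * ((Matrix.vandermonde fun i => (a i + s * iDiag X V i : ℂ)).det
        * Complex.exp (∑ i, (iDiag X V i * a i + s * iDiag X V i ^ 2 / 2)))
  let B' : U n × ℝ → ℂ := fun p => Complex.exp (p.2 * (T / 2))
    * ((vandermondeDeriv (fun i => (a i + p.2 * iDiag X p.1 i : ℂ)) (iDiag X p.1)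
      + (Matrix.vandermonde fun i => (a i + p.2 * iDiag X p.1 i : ℂ)).det
        * ((∑ k, iDiag X p.1 k ^ 2) / 2 + T / 2))
        * ∏ i, Complex.exp (iDiag X p.1 i * a i + p.2 * iDiag X p.1 i ^ 2 / 2))
  have hvc : ∀ {α : Type} [TopologicalSpace α] {z : α → Fin n → ℂ}, (∀ i, Continuous fun x => z x i) →
      Continuous fun x => Matrix.vandermonde (z x) := fun hz =>
    continuous_matrix fun i j => (hz i).pow _
  have hB' : Continuous B' := by
    have c1 : Continuous fun p : U n × ℝ => (Matrix.vandermonde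
        fun i => (a i + p.2 * iDiag X p.1 i : ℂ)).det := (hvc fun i => by fun_prop).matrix_det
    have c2 : Continuous fun p : U n × ℝ =>
        vandermondeDeriv (fun i => (a i + p.2 * iDiag X p.1 i : ℂ)) (iDiag X p.1) := by
      unfold vandermondeDeriv
      refine continuous_finsetSum _ fun k _ => Continuous.matrix_det ?_
      exact (hvc fun i => by fun_prop).matrix_updateRow k (continuous_pi fun j => by fun_prop)
    simp only [B']
    fun_prop
  have hBd : ∀ V s, HasDerivAt (B V) (B' (V, s)) s := by
    intro V s
    have h1 : HasDerivAt (fun s : ℝ => Complex.exp (s * (T / 2)))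
        (Complex.exp (s * (T / 2)) * (T / 2)) s := by
      simpa using ((hasDerivAt_id s).ofReal_comp.mul_const (T / 2)).cexp
    have h2 := hasDerivAt_vandermonde (z := fun (s : ℝ) i => (a i + s * iDiag X V i : ℂ))
      (y := iDiag X V) (x := s) fun i => by
        simpa using ((hasDerivAt_id s).ofReal_comp.mul_const (iDiag X V i)).const_add (a i : ℂ)
    have h3 : HasDerivAt (fun s : ℝ => ∑ i, (iDiag X V i * a i + s * iDiag X V i ^ 2 / 2))
        (∑ i, iDiag X V i ^ 2 / 2) s := HasDerivAt.fun_sum fun i _ => by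
      simpa using (((hasDerivAt_id s).ofReal_comp.mul_const
        (iDiag X V i ^ 2)).div_const 2).const_add (iDiag X V i * a i)
    refine (h1.mul (h2.mul h3.cexp)).congr_deriv ?_
    simp only [B', ← Complex.exp_sum, Finset.sum_div, Pi.mul_apply]
    ring
  have hftc : ∀ V, ∫ s in (0:ℝ)..1, B' (V, s) = B V 1 - B V 0 := fun V =>
    intervalIntegral.integral_eq_sub_of_hasDerivAt (fun s _ => hBd V s)
      ((hB'.comp (by fun_prop : Continuous fun x : ℝ => (V, x))).intervalIntegrable 0 1)
  have hswap := integral_intervalIntegral_swap_haarU hB'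
  have hzero : ∫ s in (0:ℝ)..1, (∫ V : U n, B' (V, s) ∂haarU n) = 0 := by
    rw [intervalIntegral.integral_of_le zero_le_one]
    -- On the half-open interval (0, 1] the variance s is nonzero, as the vanishing of the generator
    -- requires.
    refine setIntegral_eq_zero_of_forall_eq_zero fun s hs => ?_
    simp only [B']
    rw [integral_const_mul]
    have := integral_heat_generator_eq_zero hX a (v := ⟨s, hs.1.le⟩)
      (fun h => hs.1.ne' (congrArg NNReal.toReal h))
    exact mul_eq_zero_of_right _ this
  have hBc : ∀ s, Continuous fun V => B V s := by
    intro s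
    have c1 : Continuous fun V : U n => (Matrix.vandermonde
        fun i => (a i + s * iDiag X V i : ℂ)).det := (hvc fun i => by fun_prop).matrix_det
    simp only [B]
    fun_prop
  simp only [hftc] at hswap
  rw [hzero, integral_sub (integrable_haarU (hBc 1)) (integrable_haarU (hBc 0)), sub_eq_zero] at hswap
  have hB0 : ∫ V : U n, B V 0 ∂haarU n
      = (Matrix.vandermonde fun i => (a i : ℂ)).det * orbital X a := by
    simp only [B, Complex.ofReal_zero, zero_mul, add_zero, zero_div, Complex.exp_zero, one_mul,
      Complex.exp_sum, prod_exp_iDiag]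
    rw [integral_const_mul, orbital]
  have hnorm : ∀ p : (Fin n → ℝ) × U n, ‖phase p.1 (conjBy X p.2)‖ ≤ 1 := fun p =>
    (norm_phase hX p.1 p.2).le
  have hB1 : ∫ V : U n, B V 1 ∂haarU n
      = Complex.exp (T / 2)
        * ∫ l, (Matrix.vandermonde fun i => (l i : ℂ)).det * orbital X l ∂gaussPi a 1 := by
    have e1 : ∀ V : U n, B V 1 = Complex.exp (T / 2) * ∫ l, (Matrix.vandermonde
        fun i => (l i : ℂ)).det * phase l (conjBy X V) ∂gaussPi a 1 := by
      intro V
      have := (gauss_vandermonde a 1 (iDiag X V)).2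
      simp only [prod_exp_iDiag] at this
      rw [this]
      simp [B, Complex.exp_sum]
    simp only [e1]
    rw [integral_const_mul, integral_integral_swap]
    · simp only [integral_const_mul, orbital]
    · exact (integrable_mul_bounded_prod (integrable_vandermonde_gaussPi a 1)
        (continuous_phase_conjBy X) hnorm).swap
  rw [hB0, hB1] at hswap
  rw [← hswap, ← mul_assoc, ← Complex.exp_add]
  simp [T]

/-! ### The Weyl chamber -/

theorem isOpen_chamber (n : ℕ) : IsOpen (chamber n) := by
  have : chamber n = ⋂ i : Fin n, ⋂ j : Fin n, ⋂ _ : i < j, {l | l i < l j} := by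
    ext l
    simp [chamber, StrictMono]
  rw [this]
  refine isOpen_iInter_of_finite fun i => isOpen_iInter_of_finite fun j =>
    isOpen_iInter_of_finite fun _ => isOpen_lt (continuous_apply i) (continuous_apply j)

theorem measurableSet_chamber (n : ℕ) : MeasurableSet (chamber n) :=
  (isOpen_chamber n).measurableSet

theorem measurable_comp_perm {n : ℕ} (σ : Equiv.Perm (Fin n)) :
    Measurable fun l : Fin n → ℝ => l ∘ σ :=
  measurable_pi_lambda _ fun i => measurable_pi_apply (σ i)

theorem measurePreserving_comp_perm {n : ℕ} (σ : Equiv.Perm (Fin n)) :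
    MeasurePreserving (fun l : Fin n → ℝ => l ∘ σ) := by
  have h := volume_preserving_arrowCongr' σ.symm (MeasurableEquiv.refl ℝ) (MeasurePreserving.id _)
  exact h

theorem eq_of_strictMono_comp_perm {n : ℕ} {l : Fin n → ℝ} {σ τ : Equiv.Perm (Fin n)}
    (hσ : StrictMono (l ∘ σ)) (hτ : StrictMono (l ∘ τ)) : σ = τ := by
  have h := Tuple.unique_monotone hσ.monotone hτ.monotone
  have hl : Function.Injective l := by
    have h1 := hσ.injective.comp σ.symm.injective
    rwa [Function.comp_assoc, Equiv.self_comp_symm] at h1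
  ext i
  exact congrArg _ (hl (congrFun h i))

/-- Lebesgue measure is the sum of the images of its restriction to the Weyl chamber under the
coordinate permutations. -/
theorem sum_map_restrict_chamber (n : ℕ) :
    ∑ σ : Equiv.Perm (Fin n),
      (volume.restrict (chamber n)).map (fun l : Fin n → ℝ => l ∘ σ) = volume := by
  have h1 : ∀ σ : Equiv.Perm (Fin n),
      (volume.restrict (chamber n)).map (fun l : Fin n → ℝ => l ∘ σ)
        = volume.restrict ((fun l : Fin n → ℝ => l ∘ σ.symm) ⁻¹' chamber n) := by
    intro σ
    have hs : MeasurableSet ((fun l : Fin n → ℝ => l ∘ σ.symm) ⁻¹' chamber n) :=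
      measurable_comp_perm _ (measurableSet_chamber n)
    have h := ((measurePreserving_comp_perm σ).restrict_preimage hs).map_eq
    have h2 : (fun l : Fin n → ℝ => l ∘ σ) ⁻¹' ((fun l : Fin n → ℝ => l ∘ σ.symm) ⁻¹' chamber n)
        = chamber n := by
      ext l
      simp [Function.comp_assoc]
    rwa [h2] at h
  simp only [h1]
  rw [← Measure.sum_fintype, ← Measure.restrict_iUnion]
  · have : (⋃ σ : Equiv.Perm (Fin n), (fun l : Fin n → ℝ => l ∘ σ.symm) ⁻¹' chamber n)
        =ᵐ[volume] Set.univ := by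
      refine Filter.eventuallyEq_univ.2 ?_
      filter_upwards [ae_injective n] with l hl
      refine Set.mem_iUnion.2 ⟨(Tuple.sort l).symm, ?_⟩
      exact (Tuple.monotone_sort l).strictMono_of_injective (hl.comp (Tuple.sort l).injective)
    rw [Measure.restrict_congr_set this, Measure.restrict_univ]
  · intro σ τ hst
    refine Set.disjoint_left.2 fun l h1 h2 => hst ?_
    have := eq_of_strictMono_comp_perm (l := l) (σ := σ.symm) (τ := τ.symm) h1 h2
    exact Equiv.symm_bijective.injective this
  · exact fun σ => measurable_comp_perm _ (measurableSet_chamber n)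

/-! ### Eigenvalues -/

/-- The infinitely many natural points already determine the polynomial, hence its sorted roots.
Using countably many points keeps the target in `measurable_eig` a countable product. -/
theorem eq_of_prod_sub_eq {n : ℕ} {f g : Fin n → ℝ} (hf : Monotone f) (hg : Monotone g)
    (h : ∀ z : ℕ, ∏ j, ((z : ℝ) - f j) = ∏ j, ((z : ℝ) - g j)) : f = g := by
  open Polynomial in
  have hp : (∏ j, (X - C (f j)) : ℝ[X]) = ∏ j, (X - C (g j)) := by
    refine Polynomial.eq_of_infinite_eval_eq _ _ ?_
    refine (Set.infinite_range_of_injective (Nat.cast_injective (R := ℝ))).mono ?_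
    rintro _ ⟨z, rfl⟩
    simpa [Polynomial.eval_prod] using h z
  have hroots : ∀ u : Fin n → ℝ, (∏ j, (Polynomial.X - Polynomial.C (u j))).roots
      = (List.ofFn u : Multiset ℝ) := by
    intro u
    rw [Polynomial.roots_prod _ _ (by
      simp [Finset.prod_ne_zero_iff, Polynomial.X_sub_C_ne_zero])]
    simp
  have h1 : List.ofFn f = List.ofFn g :=
    List.Perm.eq_of_sortedLE hf.sortedLE_ofFn hg.sortedLE_ofFn
      (Multiset.coe_eq_coe.1 (by rw [← hroots, ← hroots, hp]))
  exact List.ofFn_injective h1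

/-- The diagonal matrix with real entries `l`. -/
def diagC {n : ℕ} (l : Fin n → ℝ) : Matrix (Fin n) (Fin n) ℂ :=
  Matrix.diagonal fun k => (l k : ℂ)

theorem isHermitian_diagC {n : ℕ} (l : Fin n → ℝ) : (diagC l).IsHermitian := by
  rw [Matrix.IsHermitian, diagC, Matrix.diagonal_conjTranspose]
  congr 1
  ext k
  simp

theorem eig_monotone {n : ℕ} (M : Herm n) : Monotone (eig M) :=
  Tuple.monotone_sort _

theorem exists_conj_diag_eig {n : ℕ} (M : Herm n) :
    ∃ W : U n, M.1 = (W : Matrix (Fin n) (Fin n) ℂ) * diagC (eig M)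
      * star (W : Matrix (Fin n) (Fin n) ℂ) := by
  let V := M.2.eigenvectorUnitary
  let σ := Tuple.sort M.2.eigenvalues
  have hV : (V : Matrix (Fin n) (Fin n) ℂ) * star (V : Matrix (Fin n) (Fin n) ℂ) = 1 :=
    Matrix.mem_unitaryGroup_iff.1 V.2
  have hs : star ((V : Matrix (Fin n) (Fin n) ℂ).submatrix id σ)
      = (star (V : Matrix (Fin n) (Fin n) ℂ)).submatrix σ id :=
    Matrix.conjTranspose_submatrix _ _ _
  refine ⟨⟨(V : Matrix (Fin n) (Fin n) ℂ).submatrix id σ, ?_⟩, ?_⟩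
  · rw [Matrix.mem_unitaryGroup_iff, hs, Matrix.submatrix_mul_equiv, hV, Matrix.submatrix_id_id]
  · have hd : diagC (eig M) = (diagC M.2.eigenvalues).submatrix σ σ := by
      rw [diagC, diagC, Matrix.submatrix_diagonal_equiv]
      rfl
    simp only [hs]
    rw [hd, Matrix.submatrix_mul_equiv, Matrix.submatrix_mul_equiv, Matrix.submatrix_id_id]
    conv_lhs => rw [M.2.spectral_theorem]
    rfl

theorem det_sub_conj_diag {n : ℕ} (W : U n) (l : Fin n → ℝ) (z : ℝ) :
    (Matrix.det ((z : ℂ) • (1 : Matrix (Fin n) (Fin n) ℂ)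
      - (W : Matrix (Fin n) (Fin n) ℂ) * diagC l * star (W : Matrix (Fin n) (Fin n) ℂ))).re
      = ∏ j, (z - l j) := by
  have hW : (W : Matrix (Fin n) (Fin n) ℂ) * star (W : Matrix (Fin n) (Fin n) ℂ) = 1 :=
    Matrix.mem_unitaryGroup_iff.1 W.2
  have hdet : Matrix.det (W : Matrix (Fin n) (Fin n) ℂ)
      * Matrix.det (star (W : Matrix (Fin n) (Fin n) ℂ)) = 1 := by
    rw [← Matrix.det_mul, hW, Matrix.det_one]
  have h1 : (z : ℂ) • (1 : Matrix (Fin n) (Fin n) ℂ)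
      - (W : Matrix (Fin n) (Fin n) ℂ) * diagC l * star (W : Matrix (Fin n) (Fin n) ℂ)
      = (W : Matrix (Fin n) (Fin n) ℂ) * Matrix.diagonal (fun j => (z - l j : ℂ))
        * star (W : Matrix (Fin n) (Fin n) ℂ) := by
    have h2 : Matrix.diagonal (fun j => (z - l j : ℂ))
        = (z : ℂ) • (1 : Matrix (Fin n) (Fin n) ℂ) - diagC l := by
      rw [diagC, Matrix.smul_one_eq_diagonal, Matrix.diagonal_sub]
    rw [h2, Matrix.mul_sub, Matrix.sub_mul, Matrix.mul_smul, Matrix.mul_one, Matrix.smul_mul, hW]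
  rw [h1, Matrix.det_mul, Matrix.det_mul, Matrix.det_diagonal, mul_right_comm, hdet, one_mul]
  have : ∏ j, ((z : ℂ) - l j) = ((∏ j, (z - l j) : ℝ) : ℂ) := by push_cast; rfl
  rw [this, Complex.ofReal_re]

theorem eig_eq_of_conj_diag {n : ℕ} {M : Herm n} {W : U n} {l : Fin n → ℝ} (hl : Monotone l)
    (h : M.1 = (W : Matrix (Fin n) (Fin n) ℂ) * diagC l * star (W : Matrix (Fin n) (Fin n) ℂ)) :
    eig M = l := by
  obtain ⟨W', h'⟩ := exists_conj_diag_eig M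
  refine eq_of_prod_sub_eq (eig_monotone M) hl fun z => ?_
  rw [← det_sub_conj_diag W' (eig M) z, ← det_sub_conj_diag W l z, ← h', ← h]

/-- The values of the characteristic polynomial at natural numbers are continuous in M. On the
closed, hence Polish, set of monotone vectors these values depend continuously and injectively on
the spectrum, so the map is a measurable embedding (Lusin–Souslin) and measurability lifts back
through it. -/
theorem measurable_eig (n : ℕ) : Measurable (eig (n := n)) := by
  let S : Set (Fin n → ℝ) := {l | Monotone l}
  have hS : IsClosed S := isClosed_monotone
  have : PolishSpace S := hS.polishSpace
  let e : S → ℕ → ℝ := fun l z => ∏ j, ((z : ℝ) - l.1 j)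
  have he : MeasurableEmbedding e := by
    refine Continuous.measurableEmbedding (continuous_pi fun z =>
      continuous_finsetProd _ fun j _ => continuous_const.sub
        ((continuous_apply j).comp continuous_subtype_val)) fun l l' h => ?_
    exact Subtype.ext (eq_of_prod_sub_eq l.2 l'.2 fun z => congrFun h z)
  let E : Herm n → S := fun M => ⟨eig M, eig_monotone M⟩
  have hE : Measurable E := by
    rw [← he.measurable_comp_iff]
    refine measurable_pi_lambda _ fun z => ?_
    have : ∀ M : Herm n, (e ∘ E) M z
        = (Matrix.det (((z : ℝ) : ℂ) • (1 : Matrix (Fin n) (Fin n) ℂ) - M.1)).re := by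
      intro M
      obtain ⟨W, h⟩ := exists_conj_diag_eig M
      have h2 := det_sub_conj_diag W (eig M) z
      rw [← h] at h2
      exact h2.symm
    simp only [this]
    refine Continuous.measurable ?_
    fun_prop
  exact measurable_subtype_coe.comp hE

/-! ### Coordinates on Hermitian matrices -/

/-- The independent entries of a Hermitian matrix. -/
def toEntries {n : ℕ} (M : Herm n) : Entries n :=
  (fun i => (M.1 i i).re, fun p => M.1 p.1.1 p.1.2)

theorem continuous_toEntries {n : ℕ} : Continuous (toEntries (n := n)) := by
  have h : ∀ i j : Fin n, Continuous fun M : Herm n => M.1 i j := fun i j =>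
    (continuous_subtype_val).matrix_elem i j
  exact (continuous_pi fun i => Complex.continuous_re.comp (h i i)).prodMk
    (continuous_pi fun p => h _ _)

theorem ofEntries_toEntries {n : ℕ} (M : Herm n) : ofEntries (toEntries M) = M := by
  ext i j
  rcases lt_trichotomy i j with h | h | h
  · simp [ofEntries, toEntries, h]
  · subst h
    simpa [ofEntries, toEntries] using Complex.conj_eq_iff_re.1 (M.2.apply i i)
  · simpa [ofEntries, toEntries, h, h.not_gt] using M.2.apply i j

theorem toEntries_ofEntries {n : ℕ} (x : Entries n) : toEntries (ofEntries x) = x := by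
  refine Prod.ext (funext fun i => ?_) (funext fun p => ?_)
  · simp [ofEntries, toEntries]
  · simp [ofEntries, toEntries, p.2]

/-- The coordinates as a homeomorphism. -/
def entriesHomeo (n : ℕ) : Entries n ≃ₜ Herm n where
  toFun := ofEntries
  invFun := toEntries
  left_inv := toEntries_ofEntries
  right_inv := ofEntries_toEntries
  continuous_toFun := continuous_ofEntries
  continuous_invFun := continuous_toEntries

theorem integral_lebesgueHerm {n : ℕ} (f : Herm n → ℂ) :
    ∫ M, f M ∂lebesgueHerm n = ∫ x, f (ofEntries x) :=
  (entriesHomeo n).measurableEmbedding.integral_map f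

theorem integrable_lebesgueHerm_iff {n : ℕ} (f : Herm n → ℂ) :
    Integrable f (lebesgueHerm n) ↔ Integrable fun x => f (ofEntries x) :=
  (entriesHomeo n).measurableEmbedding.integrable_map_iff

/-- The trace pairing in coordinates. -/
def entriesPairing {n : ℕ} (x y : Entries n) : ℝ :=
  ∑ i, x.1 i * y.1 i + ∑ p, 2 * inner ℝ (x.2 p) (y.2 p)

theorem sum_pairs_eq {n : ℕ} {M : Type*} [AddCommMonoid M] (f : Fin n × Fin n → M) :
    ∑ p ∈ pairs n, f p = ∑ p : {p : Fin n × Fin n // p.1 < p.2}, f p :=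
  Finset.sum_subtype _ (by simp [pairs]) _

theorem trace_ofEntries_mul {n : ℕ} (x y : Entries n) :
    Matrix.trace ((ofEntries x).1 * (ofEntries y).1) = (entriesPairing x y : ℂ) := by
  simp only [Matrix.trace, Matrix.diag_apply, Matrix.mul_apply]
  rw [sum_eq_sum_diag_add_pairs, entriesPairing, sum_pairs_eq]
  push_cast
  congr 1
  · exact Finset.sum_congr rfl fun i _ => by simp [ofEntries]
  · refine Finset.sum_congr rfl fun p _ => ?_
    have h := p.2
    simp only [ofEntries, Matrix.of_apply, h, h.not_gt, dif_pos, dif_neg, not_false_eq_true]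
    apply Complex.ext <;> simp <;> ring

theorem exists_entriesPairing_eq {n : ℕ} (L : Entries n →L[ℝ] ℝ) :
    ∃ x : Entries n, ∀ y, L y = entriesPairing x y := by
  -- The halves undo the weight 2 that the trace pairing puts on each entry above the diagonal.
  refine ⟨(fun i => L (Pi.single i 1, 0),
    fun p => ⟨L (0, Pi.single p 1) / 2, L (0, Pi.single p Complex.I) / 2⟩), fun y => ?_⟩
  have h1 : y.1 = ∑ i, y.1 i • (Pi.single i 1 : Fin n → ℝ) := by
    ext j
    simp [Finset.sum_apply, Pi.single_apply]
  have h2 : y.2 = ∑ p, ((y.2 p).re • (Pi.single p 1 : {p : Fin n × Fin n // p.1 < p.2} → ℂ)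
      + (y.2 p).im • (Pi.single p Complex.I : {p : Fin n × Fin n // p.1 < p.2} → ℂ)) := by
    ext q
    simp [Finset.sum_apply, Pi.single_apply, Finset.sum_add_distrib]
  have h3 : L y = (L.comp (ContinuousLinearMap.inl ℝ _ _)) y.1
      + (L.comp (ContinuousLinearMap.inr ℝ _ _)) y.2 := by
    simp only [ContinuousLinearMap.comp_apply, ContinuousLinearMap.inl_apply,
      ContinuousLinearMap.inr_apply, ← map_add]
    simp
  rw [h3]
  conv_lhs => rw [h1, h2]
  simp only [map_sum, map_add, map_smul, smul_eq_mul, ContinuousLinearMap.comp_apply,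
    ContinuousLinearMap.inl_apply, ContinuousLinearMap.inr_apply, entriesPairing]
  congr 1
  · exact Finset.sum_congr rfl fun i _ => mul_comm _ _
  · refine Finset.sum_congr rfl fun p _ => ?_
    simp only [Complex.inner, Complex.mul_re, Complex.conj_re, Complex.conj_im]
    ring

/-- Finite measures on Hermitian matrices are determined by their Fourier transforms. -/
theorem ext_of_integral_cexp_trace {n : ℕ} {μ ν : Measure (Herm n)} [IsFiniteMeasure μ]
    [IsFiniteMeasure ν]
    (h : ∀ X : Herm n, ∫ M, Complex.exp (Complex.I * Matrix.trace (X.1 * M.1)) ∂μ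
      = ∫ M, Complex.exp (Complex.I * Matrix.trace (X.1 * M.1)) ∂ν) : μ = ν := by
  let e := (entriesHomeo n).toMeasurableEquiv
  have hkey : μ.map e.symm = ν.map e.symm := by
    refine Measure.ext_of_charFunDual (funext fun L => ?_)
    obtain ⟨x, hx⟩ := exists_entriesPairing_eq L
    have hc : ∀ m : Measure (Herm n), charFunDual (m.map e.symm) L
        = ∫ M, Complex.exp (Complex.I * Matrix.trace ((ofEntries x).1 * M.1)) ∂m := by
      intro m
      rw [charFunDual_apply, e.symm.measurableEmbedding.integral_map]
      refine integral_congr_ae (.of_forall fun M => ?_)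
      simp only
      rw [hx, ← trace_ofEntries_mul]
      have : ofEntries (e.symm M) = M := ofEntries_toEntries M
      rw [this, mul_comm]
    rw [hc, hc, h]
  have h2 := congrArg (Measure.map e) hkey
  rwa [Measure.map_map e.measurable e.symm.measurable, Measure.map_map e.measurable
    e.symm.measurable, e.self_comp_symm, Measure.map_id, Measure.map_id] at h2

/-! ### The Gaussian integral over Hermitian matrices -/

/-- The total mass of the Gaussian density on Hermitian matrices. -/
def gaussConst (n : ℕ) : ℝ :=
  (∏ _i : Fin n, √(2 * Real.pi)) * ∏ _p : {p : Fin n × Fin n // p.1 < p.2}, Real.pi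

theorem gaussConst_pos (n : ℕ) : 0 < gaussConst n := by
  have := Real.pi_pos
  unfold gaussConst
  positivity

theorem gaussian_diag_entries {n : ℕ} (x : Fin n → ℝ) :
    Integrable (fun u : Fin n → ℝ =>
      ∏ i, Complex.exp (-(1 / 2 : ℂ) * ‖u i‖ ^ 2 + Complex.I * inner ℝ (x i) (u i))) ∧
    ∫ u : Fin n → ℝ,
      ∏ i, Complex.exp (-(1 / 2 : ℂ) * ‖u i‖ ^ 2 + Complex.I * inner ℝ (x i) (u i))
      = ((∏ _i : Fin n, √(2 * Real.pi) : ℝ) : ℂ) * Complex.exp (-((∑ i, x i * x i : ℝ) / 2)) := by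
  have hb : 0 < (1 / 2 : ℂ).re := by norm_num
  let f : Fin n → ℝ → ℂ := fun i u =>
    Complex.exp (-(1 / 2 : ℂ) * ‖u‖ ^ 2 + Complex.I * inner ℝ (x i) u)
  have hf : ∀ i, Integrable (f i) := fun i =>
    GaussianFourier.integrable_cexp_neg_mul_sq_norm_add hb Complex.I (x i)
  have hp : ((Real.pi : ℂ) / (1 / 2)) ^ (((1 : ℕ) : ℂ) / 2) = (√(2 * Real.pi) : ℝ) := by
    rw [Real.sqrt_eq_rpow, Complex.ofReal_cpow (by positivity)]
    push_cast
    ring_nf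
  have hval : ∀ i, ∫ u, f i u = (√(2 * Real.pi) : ℝ) * Complex.exp (-((x i * x i : ℝ) / 2)) := by
    intro i
    have h := GaussianFourier.integral_cexp_neg_mul_sq_norm_add hb Complex.I (x i)
    rw [Module.finrank_self, hp] at h
    refine h.trans ?_
    have : (‖x i‖ : ℂ) ^ 2 = x i * x i := by
      rw [← Complex.ofReal_pow, Real.norm_eq_abs, sq_abs]
      push_cast
      ring
    rw [this, Complex.I_sq]
    push_cast
    congr 2
    ring
  refine ⟨Integrable.fintype_prod (f := f) hf, ?_⟩
  refine (integral_fintype_prod_volume_eq_prod f).trans ?_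
  simp only [hval]
  rw [Finset.prod_mul_distrib, ← Complex.exp_sum, Finset.sum_neg_distrib, ← Finset.sum_div]
  push_cast
  rfl

/-- Each entry above the diagonal occurs twice in Tr M², so Tr M²/2 has coefficient 1 here, against
1/2 on the diagonal, and the Fourier term is doubled. -/
theorem gaussian_offDiag_entries {ι : Type} [Fintype ι] (x : ι → ℂ) :
    Integrable (fun u : ι → ℂ =>
      ∏ i, Complex.exp (-(1 : ℂ) * ‖u i‖ ^ 2 + (2 * Complex.I) * inner ℝ (x i) (u i))) ∧
    ∫ u : ι → ℂ,
      ∏ i, Complex.exp (-(1 : ℂ) * ‖u i‖ ^ 2 + (2 * Complex.I) * inner ℝ (x i) (u i))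
      = ((∏ _i : ι, Real.pi : ℝ) : ℂ) * Complex.exp (-(∑ i, inner ℝ (x i) (x i) : ℝ)) := by
  have hb : 0 < (1 : ℂ).re := by norm_num
  let f : ι → ℂ → ℂ := fun i u =>
    Complex.exp (-(1 : ℂ) * ‖u‖ ^ 2 + (2 * Complex.I) * inner ℝ (x i) u)
  have hf : ∀ i, Integrable (f i) := fun i =>
    GaussianFourier.integrable_cexp_neg_mul_sq_norm_add hb (2 * Complex.I) (x i)
  have hp : ((Real.pi : ℂ) / 1) ^ (((2 : ℕ) : ℂ) / 2) = Real.pi := by simp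
  have hval : ∀ i, ∫ u, f i u = Real.pi * Complex.exp (-(inner ℝ (x i) (x i) : ℝ)) := by
    intro i
    have h := GaussianFourier.integral_cexp_neg_mul_sq_norm_add hb (2 * Complex.I) (x i)
    rw [Complex.finrank_real_complex, hp] at h
    refine h.trans ?_
    rw [mul_pow, Complex.I_sq, real_inner_self_eq_norm_sq]
    push_cast
    congr 2
    ring
  refine ⟨Integrable.fintype_prod (f := f) hf, ?_⟩
  refine (integral_fintype_prod_volume_eq_prod f).trans ?_
  simp only [hval]
  rw [Finset.prod_mul_distrib, ← Complex.exp_sum, Finset.sum_neg_distrib]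
  push_cast
  rfl

theorem cexp_entriesPairing {n : ℕ} (x y : Entries n) :
    Complex.exp (Complex.I * entriesPairing x y - entriesPairing y y / 2)
      = (∏ i, Complex.exp (-(1 / 2 : ℂ) * ‖y.1 i‖ ^ 2 + Complex.I * inner ℝ (x.1 i) (y.1 i)))
        * ∏ p, Complex.exp (-(1 : ℂ) * ‖y.2 p‖ ^ 2
          + (2 * Complex.I) * inner ℝ (x.2 p) (y.2 p)) := by
  rw [← Complex.exp_sum, ← Complex.exp_sum, ← Complex.exp_add]
  congr 1
  simp only [entriesPairing, real_inner_self_eq_norm_sq]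
  push_cast
  rw [mul_add, add_div, Finset.mul_sum, Finset.mul_sum, Finset.sum_div, Finset.sum_div,
    add_sub_add_comm, ← Finset.sum_sub_distrib, ← Finset.sum_sub_distrib]
  congr 1
  · refine Finset.sum_congr rfl fun i _ => ?_
    have h1 : (‖y.1 i‖ : ℂ) ^ 2 = y.1 i * y.1 i := by
      rw [← Complex.ofReal_pow, Real.norm_eq_abs, sq_abs]
      push_cast
      ring
    have h2 : inner ℝ (x.1 i) (y.1 i) = x.1 i * y.1 i := by
      rw [RCLike.inner_apply, conj_trivial, mul_comm]
    rw [h1, h2]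
    push_cast
    ring
  · exact Finset.sum_congr rfl fun p _ => by ring

theorem gaussian_entries {n : ℕ} (x : Entries n) :
    Integrable (fun y : Entries n =>
      Complex.exp (Complex.I * entriesPairing x y - entriesPairing y y / 2)) ∧
    ∫ y : Entries n, Complex.exp (Complex.I * entriesPairing x y - entriesPairing y y / 2)
      = gaussConst n * Complex.exp (-(entriesPairing x x / 2)) := by
  obtain ⟨i1, e1⟩ := gaussian_diag_entries x.1
  obtain ⟨i2, e2⟩ := gaussian_offDiag_entries x.2
  let f : (Fin n → ℝ) → ℂ := fun u =>
    ∏ i, Complex.exp (-(1 / 2 : ℂ) * ‖u i‖ ^ 2 + Complex.I * inner ℝ (x.1 i) (u i))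
  let g : ({p : Fin n × Fin n // p.1 < p.2} → ℂ) → ℂ := fun w =>
    ∏ p, Complex.exp (-(1 : ℂ) * ‖w p‖ ^ 2 + (2 * Complex.I) * inner ℝ (x.2 p) (w p))
  have hfun : (fun y : Entries n =>
      Complex.exp (Complex.I * entriesPairing x y - entriesPairing y y / 2))
      = fun y => f y.1 * g y.2 := funext fun y => cexp_entriesPairing x y
  rw [hfun, Measure.volume_eq_prod]
  refine ⟨Integrable.mul_prod (f := f) (g := g) i1 i2, ?_⟩
  refine (integral_prod_mul f g).trans ?_
  rw [show ∫ u, f u = _ from e1, show ∫ w, g w = _ from e2, mul_mul_mul_comm, ← Complex.exp_add, gaussConst]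
  push_cast
  congr 2
  simp only [entriesPairing, ← Finset.mul_sum]
  push_cast
  ring

theorem entriesPairing_add_left {n : ℕ} (x y z : Entries n) :
    entriesPairing (x + y) z = entriesPairing x z + entriesPairing y z := by
  simp only [entriesPairing, Prod.fst_add, Prod.snd_add, Pi.add_apply, inner_add_left, add_mul,
    mul_add, Finset.sum_add_distrib]
  ring

theorem entriesPairing_comm {n : ℕ} (x y : Entries n) :
    entriesPairing x y = entriesPairing y x := by
  simp only [entriesPairing]
  congr 1
  · exact Finset.sum_congr rfl fun i _ => mul_comm _ _
  · exact Finset.sum_congr rfl fun i _ => by rw [real_inner_comm]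

theorem gaussian_herm {n : ℕ} (X B : Herm n) :
    Integrable (fun M : Herm n => Complex.exp (Complex.I * Matrix.trace (X.1 * M.1)
      + Matrix.trace (B.1 * M.1) - Matrix.trace (M.1 * M.1) / 2)) (lebesgueHerm n) ∧
    ∫ M : Herm n, Complex.exp (Complex.I * Matrix.trace (X.1 * M.1)
      + Matrix.trace (B.1 * M.1) - Matrix.trace (M.1 * M.1) / 2) ∂lebesgueHerm n
      = gaussConst n * Complex.exp (-(Matrix.trace (X.1 * X.1) / 2)
        + Complex.I * Matrix.trace (X.1 * B.1) + Matrix.trace (B.1 * B.1) / 2) := by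
  obtain ⟨x, rfl⟩ : ∃ x, ofEntries x = X := ⟨_, ofEntries_toEntries X⟩
  obtain ⟨b, rfl⟩ : ∃ x, ofEntries x = B := ⟨_, ofEntries_toEntries B⟩
  rw [integrable_lebesgueHerm_iff, integral_lebesgueHerm]
  simp only [trace_ofEntries_mul]
  obtain ⟨h1, h2⟩ := gaussian_entries x
  have : (volume : Measure (Entries n)).IsAddLeftInvariant := by
    rw [Measure.volume_eq_prod]
    exact Measure.prod.instIsAddLeftInvariant
  -- Translating by b completes the square for the real source term and leaves the pure Gaussian
  -- Fourier integral.
  have hshift : ∀ y : Entries n, Complex.exp (Complex.I * entriesPairing x (b + y)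
      + entriesPairing b (b + y) - entriesPairing (b + y) (b + y) / 2)
      = Complex.exp (Complex.I * entriesPairing x b + entriesPairing b b / 2)
        * Complex.exp (Complex.I * entriesPairing x y - entriesPairing y y / 2) := by
    intro y
    rw [← Complex.exp_add]
    congr 1
    simp only [entriesPairing_comm _ (b + y), entriesPairing_add_left]
    rw [entriesPairing_comm y x, entriesPairing_comm b x, entriesPairing_comm y b]
    push_cast
    ring
  refine ⟨?_, ?_⟩
  · have := (h1.const_mul
      (Complex.exp (Complex.I * entriesPairing x b + entriesPairing b b / 2)))
    simp only [← hshift] at this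
    simpa using this.comp_add_left (-b)
  · rw [← integral_add_left_eq_self _ b]
    simp only [hshift]
    rw [integral_const_mul, h2, mul_left_comm, ← Complex.exp_add]
    congr 2
    ring

/-! ### Eigenvalue laws and Fourier transforms -/

/-- The Hermitian matrix `V diag(l) V†`. -/
def orbitMap {n : ℕ} (q : (Fin n → ℝ) × U n) : Herm n :=
  ⟨(q.2 : Matrix (Fin n) (Fin n) ℂ) * diagC q.1 * star (q.2 : Matrix (Fin n) (Fin n) ℂ),
    Matrix.isHermitian_mul_mul_conjTranspose _ (isHermitian_diagC q.1)⟩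

theorem continuous_diagC {n : ℕ} : Continuous (diagC (n := n)) := by
  unfold diagC
  fun_prop

theorem continuous_orbitMap {n : ℕ} : Continuous (orbitMap (n := n)) := by
  have := continuous_diagC (n := n)
  refine Continuous.subtype_mk ?_ _
  fun_prop

theorem trace_mul_conj {n : ℕ} (X D : Matrix (Fin n) (Fin n) ℂ) (V : U n) :
    Matrix.trace (X * ((V : Matrix (Fin n) (Fin n) ℂ) * D * star (V : Matrix (Fin n) (Fin n) ℂ)))
      = Matrix.trace (conjBy X V * D) := by
  rw [← Matrix.mul_assoc, Matrix.trace_mul_comm, conjBy]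
  simp only [Matrix.mul_assoc]

theorem cexp_trace_mul_diagC {n : ℕ} (Y : Matrix (Fin n) (Fin n) ℂ) (l : Fin n → ℝ) :
    Complex.exp (Complex.I * Matrix.trace (Y * diagC l)) = phase l Y := by
  rw [phase, Matrix.trace]
  congr 2
  refine Finset.sum_congr rfl fun k _ => ?_
  rw [Matrix.diag_apply, diagC, Matrix.mul_diagonal, mul_comm]

theorem cexp_trace_orbitMap {n : ℕ} (X : Matrix (Fin n) (Fin n) ℂ) (q : (Fin n → ℝ) × U n) :
    Complex.exp (Complex.I * Matrix.trace (X * (orbitMap q).1)) = phase q.1 (conjBy X q.2) := by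
  rw [orbitMap, trace_mul_conj, cexp_trace_mul_diagC]

theorem continuous_cexp_trace {n : ℕ} (X : Matrix (Fin n) (Fin n) ℂ) :
    Continuous fun M : Herm n => Complex.exp (Complex.I * Matrix.trace (X * M.1)) := by
  fun_prop

theorem integrable_phase_prod {n : ℕ} {X : Matrix (Fin n) (Fin n) ℂ} (hX : X.IsHermitian)
    (η : Measure (Fin n → ℝ)) [IsFiniteMeasure η] :
    Integrable (fun q : (Fin n → ℝ) × U n => phase q.1 (conjBy X q.2)) (η.prod (haarU n)) :=
  Integrable.of_bound (continuous_phase_conjBy X).aestronglyMeasurable 1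
    (.of_forall fun q => (norm_phase hX q.1 q.2).le)

theorem integral_cexp_trace_orbit {n : ℕ} (X : Herm n) (η : Measure (Fin n → ℝ))
    [IsFiniteMeasure η] :
    ∫ M, Complex.exp (Complex.I * Matrix.trace (X.1 * M.1)) ∂(η.prod (haarU n)).map orbitMap
      = ∫ l, orbital X.1 l ∂η := by
  rw [integral_map continuous_orbitMap.measurable.aemeasurable
    (continuous_cexp_trace X.1).aestronglyMeasurable]
  simp only [cexp_trace_orbitMap]
  rw [integral_prod _ (integrable_phase_prod X.2 η)]
  rfl

theorem map_eig_orbit {n : ℕ} (η : Measure (Fin n → ℝ)) [IsFiniteMeasure η]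
    (hη : ∀ᵐ l ∂η, l ∈ chamber n) :
    ((η.prod (haarU n)).map orbitMap).map eig = η := by
  rw [Measure.map_map (measurable_eig n) continuous_orbitMap.measurable]
  have : eig ∘ orbitMap =ᵐ[η.prod (haarU n)] Prod.fst := by
    have h := (Measure.quasiMeasurePreserving_fst (μ := η) (ν := haarU n)).ae hη
    filter_upwards [h] with q hq
    exact eig_eq_of_conj_diag (W := q.2) hq.monotone rfl
  rw [Measure.map_congr this, Measure.map_fst_prod, measure_univ, one_smul]

theorem norm_orbital_le {n : ℕ} {X : Matrix (Fin n) (Fin n) ℂ} (hX : X.IsHermitian)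
    (l : Fin n → ℝ) : ‖orbital X l‖ ≤ 1 := by
  refine (norm_integral_le_of_norm_le_const (C := 1)
    (.of_forall fun V => (norm_phase hX l V).le)).trans ?_
  simp

theorem continuous_orbital {n : ℕ} {X : Matrix (Fin n) (Fin n) ℂ} (hX : X.IsHermitian) :
    Continuous (orbital X) := by
  refine continuous_of_dominated (bound := fun _ => 1) ?_ ?_ ?_ ?_
  · intro l
    exact ((continuous_phase l).comp (continuous_conjBy X)).aestronglyMeasurable
  · exact fun l => .of_forall fun V => (norm_phase hX l V).le
  · exact integrable_const _
  · refine .of_forall fun V => ?_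
    exact (continuous_phase_conjBy X).comp (by fun_prop : Continuous fun l : Fin n → ℝ => (l, V))

theorem integral_orbital_withDensity {n : ℕ} {X : Matrix (Fin n) (Fin n) ℂ}
    {m : Measure (Fin n → ℝ)} {k : (Fin n → ℝ) → ℝ} (hk : Measurable k) :
    ∫ l, orbital X l ∂m.withDensity (fun l => ENNReal.ofReal (k l))
      = ∫ l, ((max (k l) 0 : ℝ) : ℂ) * orbital X l ∂m := by
  rw [integral_withDensity_eq_integral_toReal_smul hk.ennreal_ofReal
    (.of_forall fun _ => ENNReal.ofReal_lt_top)]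
  refine integral_congr_ae (.of_forall fun l => ?_)
  simp only
  rw [ENNReal.toReal_ofReal', Complex.real_smul]

/-- The eigenvalue law of a finite measure whose Fourier transform is a superposition of orbital
integrals with a signed density on the Weyl chamber. -/
theorem map_eig_add_eq {n : ℕ} (μ : Measure (Herm n)) [IsFiniteMeasure μ]
    {k : (Fin n → ℝ) → ℝ} (hk : Measurable k) (hki : IntegrableOn k (chamber n))
    (h : ∀ X : Herm n, ∫ M, Complex.exp (Complex.I * Matrix.trace (X.1 * M.1)) ∂μ
      = ∫ l in chamber n, (k l : ℂ) * orbital X.1 l) :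
    μ.map eig + (volume.restrict (chamber n)).withDensity (fun l => ENNReal.ofReal (-k l))
      = (volume.restrict (chamber n)).withDensity (fun l => ENNReal.ofReal (k l)) := by
  have : IsFiniteMeasure
      ((volume.restrict (chamber n)).withDensity (fun l => ENNReal.ofReal (-k l))) :=
    isFiniteMeasure_withDensity_ofReal hki.neg.2
  have : IsFiniteMeasure
      ((volume.restrict (chamber n)).withDensity (fun l => ENNReal.ofReal (k l))) :=
    isFiniteMeasure_withDensity_ofReal hki.2
  have hae : ∀ d : (Fin n → ℝ) → ℝ≥0∞,
      ∀ᵐ l ∂(volume.restrict (chamber n)).withDensity d, l ∈ chamber n := fun d =>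
    (withDensity_absolutelyContinuous _ _).ae_le (ae_restrict_mem (measurableSet_chamber n))
  have hbd : ∀ X : Herm n, ∀ M : Herm n,
      ‖Complex.exp (Complex.I * Matrix.trace (X.1 * M.1))‖ ≤ 1 := by
    intro X M
    obtain ⟨W, hW⟩ := exists_conj_diag_eig M
    have h1 := cexp_trace_orbitMap X.1 (eig M, W)
    rw [orbitMap] at h1
    simp only [← hW] at h1
    rw [h1, norm_phase X.2]
  have hint : ∀ (X : Herm n) (ρ : Measure (Herm n)) [IsFiniteMeasure ρ],
      Integrable (fun M : Herm n => Complex.exp (Complex.I * Matrix.trace (X.1 * M.1))) ρ :=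
    fun X ρ _ => Integrable.of_bound (continuous_cexp_trace X.1).aestronglyMeasurable 1
      (.of_forall (hbd X))
  let ηn := (volume.restrict (chamber n)).withDensity (fun l => ENNReal.ofReal (-k l))
  let ηp := (volume.restrict (chamber n)).withDensity (fun l => ENNReal.ofReal (k l))
  -- Moving the negative part of k to the left makes both sides finite positive measures. A spectral
  -- law spread over orbits by Haar measure has the corresponding average of `orbital` as Fourier
  -- transform, so equality holds already on matrices, without assuming that μ is unitarily
  -- invariant.
  have hmeas : μ + (ηn.prod (haarU n)).map orbitMap = (ηp.prod (haarU n)).map orbitMap := by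
    refine ext_of_integral_cexp_trace fun X => ?_
    rw [integral_add_measure (hint X _) (hint X _), integral_cexp_trace_orbit,
      integral_cexp_trace_orbit, h X, integral_orbital_withDensity hk,
      integral_orbital_withDensity (k := fun l => -k l) hk.neg]
    have hi : ∀ {f : (Fin n → ℝ) → ℝ}, IntegrableOn f (chamber n) →
        Integrable (fun l => (f l : ℂ) * orbital X.1 l) (volume.restrict (chamber n)) :=
      fun hf => hf.ofReal.mul_bdd (continuous_orbital X.2).aestronglyMeasurable
        (.of_forall (norm_orbital_le X.2))
    rw [← integral_add (hi hki) (hi (f := fun l => max (-k l) 0) hki.neg.pos_part)]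
    refine integral_congr_ae (.of_forall fun l => ?_)
    simp only
    rw [← add_mul, ← Complex.ofReal_add]
    congr 2
    rcases le_total (k l) 0 with h0 | h0
    · rw [max_eq_left (by linarith), max_eq_right h0]
      ring
    · rw [max_eq_right (by linarith), max_eq_left h0]
      ring
  have h2 := congrArg (Measure.map eig) hmeas
  rwa [Measure.map_add _ _ (measurable_eig n), map_eig_orbit ηn (hae _),
    map_eig_orbit ηp (hae _)] at h2

/-! ### The HCIZ integral of diagonal matrices -/

/-- The HCIZ integral `∫ exp (Tr (diag(a) V diag(l) V†)) dV`. -/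
def hcizDiag {n : ℕ} (a l : Fin n → ℝ) : ℝ :=
  ∫ V : U n, Real.exp (Matrix.trace (conjBy (diagC a) V * diagC l)).re ∂haarU n

theorem trace_herm_mul_im {n : ℕ} (X M : Herm n) : (Matrix.trace (X.1 * M.1)).im = 0 := by
  rw [← ofEntries_toEntries X, ← ofEntries_toEntries M, trace_ofEntries_mul]
  exact Complex.ofReal_im _

/-- The conjugate `V† diag(a) V` as a Hermitian matrix. -/
def conjHerm {n : ℕ} (a : Fin n → ℝ) (V : U n) : Herm n :=
  ⟨conjBy (diagC a) V, Matrix.isHermitian_conjTranspose_mul_mul _ (isHermitian_diagC a)⟩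

theorem ofReal_exp_trace {n : ℕ} (a : Fin n → ℝ) (V : U n) (M : Herm n) :
    ((Real.exp (Matrix.trace (conjBy (diagC a) V * M.1)).re : ℝ) : ℂ)
      = Complex.exp (Matrix.trace (conjBy (diagC a) V * M.1)) := by
  rw [Complex.ofReal_exp]
  congr 1
  exact Complex.ext rfl (trace_herm_mul_im (conjHerm a V) M).symm

theorem hciz_diagC {n : ℕ} (c : ℝ) (a : Fin n → ℝ) (M : Herm n) :
    hciz c (diagC a) M
      = ∫ V : U n, Real.exp (Matrix.trace (conjBy (diagC (c • a)) V * M.1)).re ∂haarU n := by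
  have hsmul : diagC (c • a) = (c : ℂ) • diagC a := by
    simp only [diagC, ← Matrix.diagonal_smul]
    congr 1
    ext k
    simp
  refine integral_congr_ae (.of_forall fun V => ?_)
  simp only
  rw [hsmul]
  have h1 : conjBy ((c : ℂ) • diagC a) V = (c : ℂ) • conjBy (diagC a) V := by
    simp [conjBy]
  have h2 : Matrix.trace (diagC a * (V : Matrix (Fin n) (Fin n) ℂ) * M.1
      * (V : Matrix (Fin n) (Fin n) ℂ)ᴴ) = Matrix.trace (conjBy (diagC a) V * M.1) := by
    rw [Matrix.trace_mul_comm, conjBy]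
    simp only [Matrix.mul_assoc, Matrix.star_eq_conjTranspose]
  rw [h1, h2, Matrix.smul_mul, Matrix.trace_smul, smul_eq_mul, Complex.re_ofReal_mul]

instance {n : ℕ} : SecondCountableTopology (Herm n) :=
  (entriesHomeo n).symm.secondCountableTopology

theorem continuous_exp_trace_apply {n : ℕ} (a : Fin n → ℝ) (M : Herm n) :
    Continuous fun V : U n => Real.exp (Matrix.trace (conjBy (diagC a) V * M.1)).re := by
  have := continuous_conjBy (diagC a)
  fun_prop

theorem conjBy_inv {n : ℕ} (X : Matrix (Fin n) (Fin n) ℂ) (V : U n) :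
    conjBy X V⁻¹ = (V : Matrix (Fin n) (Fin n) ℂ) * X * star (V : Matrix (Fin n) (Fin n) ℂ) := by
  have h : ((V⁻¹ : U n) : Matrix (Fin n) (Fin n) ℂ) = star (V : Matrix (Fin n) (Fin n) ℂ) := rfl
  rw [conjBy, h, star_star]

/-- Haar invariance absorbs the eigenvector matrix of M, so only the spectrum matters. -/
theorem hciz_eq_hcizDiag_eig {n : ℕ} (c : ℝ) (a : Fin n → ℝ) (M : Herm n) :
    hciz c (diagC a) M = hcizDiag (c • a) (eig M) := by
  obtain ⟨W, hW⟩ := exists_conj_diag_eig M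
  rw [hciz_diagC, hcizDiag, ← integral_mul_right_eq_self
    (fun V : U n => Real.exp (Matrix.trace (conjBy (diagC (c • a)) V * diagC (eig M))).re) W]
  refine integral_congr_ae (.of_forall fun V => ?_)
  simp only
  rw [hW, trace_mul_conj, conjBy_mul]
  rfl

/-- The substitution V ↦ V† and cyclicity of the trace exchange the two spectra. -/
theorem hcizDiag_comm {n : ℕ} (a l : Fin n → ℝ) : hcizDiag a l = hcizDiag l a := by
  rw [hcizDiag, hcizDiag, ← integral_inv_eq_self _ (haarU n)]
  refine integral_congr_ae (.of_forall fun V => ?_)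
  simp only
  rw [conjBy_inv, Matrix.trace_mul_comm, trace_mul_conj]

theorem hcizDiag_pos {n : ℕ} (a l : Fin n → ℝ) : 0 < hcizDiag a l := by
  refine integral_exp_pos ?_
  exact integrable_haarU (continuous_exp_trace_apply a ⟨diagC l, isHermitian_diagC l⟩)

theorem continuous_hcizDiag {n : ℕ} :
    Continuous fun q : (Fin n → ℝ) × (Fin n → ℝ) => hcizDiag q.1 q.2 := by
  have hc : Continuous (Function.uncurry fun (q : (Fin n → ℝ) × (Fin n → ℝ)) (V : U n) =>
      Real.exp (Matrix.trace (conjBy (diagC q.1) V * diagC q.2)).re) := by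
    have := continuous_diagC (n := n)
    unfold conjBy Function.uncurry
    fun_prop
  have h := continuous_parametric_integral_of_continuous (μ := haarU n) hc isCompact_univ
  simpa [hcizDiag] using h

/-! ### The Gaussian measure tilted by an HCIZ integral -/

/-- The density `hciz · exp (-Tr M² / 2)`. -/
def tiltDensity {n : ℕ} (a : Fin n → ℝ) (M : Herm n) : ℝ :=
  hciz 1 (diagC a) M * Real.exp (-(Matrix.trace (M.1 * M.1)).re / 2)

theorem ofReal_tiltDensity {n : ℕ} (a : Fin n → ℝ) (M : Herm n) :
    (tiltDensity a M : ℂ) = ∫ V : U n, Complex.exp (Matrix.trace (conjBy (diagC a) V * M.1)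
      - Matrix.trace (M.1 * M.1) / 2) ∂haarU n := by
  have h1 : ((-(Matrix.trace (M.1 * M.1)).re / 2 : ℝ) : ℂ) = -(Matrix.trace (M.1 * M.1) / 2) := by
    have : Matrix.trace (M.1 * M.1) = ((Matrix.trace (M.1 * M.1)).re : ℂ) :=
      Complex.ext rfl (trace_herm_mul_im M M)
    conv_rhs => rw [this]
    push_cast
    ring
  rw [tiltDensity, hciz_diagC, one_smul, Complex.ofReal_mul, ← integral_complex_ofReal,
    Complex.ofReal_exp, h1, ← integral_mul_const]
  refine integral_congr_ae (.of_forall fun V => ?_)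
  simp only
  rw [ofReal_exp_trace, ← Complex.exp_add, sub_eq_add_neg]

/-- Taking the norm removes the Fourier phase. The remaining Gaussian integral over M depends on V
only through the trace of the squared conjugate of diag(a), so it is constant on the compact group.
-/
theorem integrable_tilt_prod {n : ℕ} (a : Fin n → ℝ) (X : Herm n) :
    Integrable (fun q : Herm n × U n => Complex.exp (Complex.I * Matrix.trace (X.1 * q.1.1)
      + Matrix.trace (conjBy (diagC a) q.2 * q.1.1) - Matrix.trace (q.1.1 * q.1.1) / 2))
      ((lebesgueHerm n).prod (haarU n)) := by
  have hsf : SFinite (lebesgueHerm n) := by unfold lebesgueHerm; infer_instance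
  have hc : Continuous fun q : Herm n × U n => Complex.exp (Complex.I * Matrix.trace (X.1 * q.1.1)
      + Matrix.trace (conjBy (diagC a) q.2 * q.1.1) - Matrix.trace (q.1.1 * q.1.1) / 2) := by
    unfold conjBy
    fun_prop
  refine (integrable_prod_iff' hc.aestronglyMeasurable).2 ⟨.of_forall fun V => ?_, ?_⟩
  · exact (gaussian_herm X (conjHerm a V)).1
  · have hn : ∀ (V : U n) (M : Herm n), ‖Complex.exp (Complex.I * Matrix.trace (X.1 * M.1)
        + Matrix.trace (conjBy (diagC a) V * M.1) - Matrix.trace (M.1 * M.1) / 2)‖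
        = (Complex.exp (Complex.I * Matrix.trace ((ofEntries 0 : Herm n).1 * M.1)
        + Matrix.trace ((conjHerm a V).1 * M.1) - Matrix.trace (M.1 * M.1) / 2)).re := by
      intro V M
      have e1 := trace_herm_mul_im X M
      have e2 := trace_herm_mul_im (conjHerm a V) M
      have e3 := trace_herm_mul_im M M
      have e4 : Matrix.trace ((ofEntries 0 : Herm n).1 * M.1) = 0 := by
        rw [← ofEntries_toEntries M, trace_ofEntries_mul]
        simp [entriesPairing]
      rw [Complex.norm_exp, Complex.exp_re, e4]
      have him : (Complex.I * 0 + Matrix.trace ((conjHerm a V).1 * M.1)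
          - Matrix.trace (M.1 * M.1) / 2).im = 0 := by
        simp [e2, e3]
      rw [him, Real.cos_zero, mul_one]
      congr 1
      simp [e1, conjHerm]
    simp only [hn]
    have hval : ∀ V : U n, ∫ M : Herm n,
        (Complex.exp (Complex.I * Matrix.trace ((ofEntries 0 : Herm n).1 * M.1)
        + Matrix.trace ((conjHerm a V).1 * M.1) - Matrix.trace (M.1 * M.1) / 2)).re ∂lebesgueHerm n
        = (gaussConst n * Complex.exp (Matrix.trace (diagC a * diagC a) / 2)).re := by
      intro V
      obtain ⟨h1, h2⟩ := gaussian_herm (ofEntries 0 : Herm n) (conjHerm a V)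
      have h3 := integral_re h1
      simp only [RCLike.re_to_complex] at h3
      rw [h3, h2]
      have e4 : ∀ M : Herm n, Matrix.trace ((ofEntries 0 : Herm n).1 * M.1) = 0 := by
        intro M
        rw [← ofEntries_toEntries M, trace_ofEntries_mul]
        simp [entriesPairing]
      rw [e4, e4, conjHerm, trace_conjBy_sq]
      simp
    simp only [hval]
    exact integrable_const _

theorem integral_cexp_trace_conjBy {n : ℕ} (X : Matrix (Fin n) (Fin n) ℂ) (a : Fin n → ℝ) :
    ∫ V : U n, Complex.exp (Complex.I * Matrix.trace (X * conjBy (diagC a) V)) ∂haarU n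
      = orbital X a := by
  rw [← integral_inv_eq_self _ (haarU n)]
  refine integral_congr_ae (.of_forall fun V => ?_)
  simp only
  rw [conjBy_inv, trace_mul_conj, cexp_trace_mul_diagC]

/-- After Fubini the Gaussian integral produces the cross term exp(i Tr(X V† diag(a) V)), whose Haar
average is the orbital integral at a. -/
theorem integral_tiltDensity {n : ℕ} (a : Fin n → ℝ) (X : Herm n) :
    Integrable (fun M => Complex.exp (Complex.I * Matrix.trace (X.1 * M.1)) * tiltDensity a M)
      (lebesgueHerm n) ∧
    ∫ M, Complex.exp (Complex.I * Matrix.trace (X.1 * M.1)) * tiltDensity a M ∂lebesgueHerm n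
      = gaussConst n * Complex.exp (Matrix.trace (diagC a * diagC a) / 2)
        * (Complex.exp (-(Matrix.trace (X.1 * X.1) / 2)) * orbital X.1 a) := by
  have hsf : SFinite (lebesgueHerm n) := by unfold lebesgueHerm; infer_instance
  have h1 : ∀ M : Herm n, Complex.exp (Complex.I * Matrix.trace (X.1 * M.1)) * tiltDensity a M
      = ∫ V : U n, Complex.exp (Complex.I * Matrix.trace (X.1 * M.1)
      + Matrix.trace (conjBy (diagC a) V * M.1) - Matrix.trace (M.1 * M.1) / 2) ∂haarU n := by
    intro M
    rw [ofReal_tiltDensity, ← integral_const_mul]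
    refine integral_congr_ae (.of_forall fun V => ?_)
    simp only
    rw [← Complex.exp_add, add_sub_assoc]
  have hint := integrable_tilt_prod a X
  simp only [h1]
  refine ⟨hint.integral_prod_left, ?_⟩
  rw [integral_integral_swap hint]
  have h2 : ∀ V : U n, ∫ M : Herm n, Complex.exp (Complex.I * Matrix.trace (X.1 * M.1)
      + Matrix.trace (conjBy (diagC a) V * M.1) - Matrix.trace (M.1 * M.1) / 2) ∂lebesgueHerm n
      = gaussConst n * Complex.exp (Matrix.trace (diagC a * diagC a) / 2)
        * Complex.exp (-(Matrix.trace (X.1 * X.1) / 2))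
        * Complex.exp (Complex.I * Matrix.trace (X.1 * conjBy (diagC a) V)) := by
    intro V
    have := (gaussian_herm X (conjHerm a V)).2
    simp only [conjHerm] at this
    rw [this, trace_conjBy_sq, Complex.exp_add, Complex.exp_add]
    ring
  simp only [h2]
  rw [integral_const_mul, integral_cexp_trace_conjBy, mul_assoc]

theorem tiltDensity_nonneg {n : ℕ} (a : Fin n → ℝ) (M : Herm n) : 0 ≤ tiltDensity a M := by
  rw [tiltDensity, hciz_eq_hcizDiag_eig]
  exact mul_nonneg (hcizDiag_pos _ _).le (Real.exp_pos _).le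

theorem measurable_hciz {n : ℕ} (c : ℝ) (a : Fin n → ℝ) : Measurable (hciz c (diagC a)) := by
  have : hciz c (diagC a) = fun M : Herm n => hcizDiag (c • a) (eig M) :=
    funext fun M => hciz_eq_hcizDiag_eig c a M
  rw [this]
  exact (continuous_hcizDiag.comp (by fun_prop : Continuous fun l : Fin n → ℝ =>
    (c • a, l))).measurable.comp (measurable_eig n)

theorem measurable_tiltDensity {n : ℕ} (a : Fin n → ℝ) : Measurable (tiltDensity a) := by
  refine (measurable_hciz 1 a).mul (Continuous.measurable ?_)
  fun_prop

theorem integrable_tiltDensity {n : ℕ} (a : Fin n → ℝ) :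
    Integrable (tiltDensity a) (lebesgueHerm n) := by
  have h := (integral_tiltDensity a (ofEntries 0)).1
  have e4 : ∀ M : Herm n, Matrix.trace ((ofEntries 0 : Herm n).1 * M.1) = 0 := by
    intro M
    rw [← ofEntries_toEntries M, trace_ofEntries_mul]
    simp [entriesPairing]
  simp only [e4, mul_zero, Complex.exp_zero, one_mul] at h
  simpa using h.re

/-- The tilted Gaussian measure. -/
def tilted {n : ℕ} (a : Fin n → ℝ) : Measure (Herm n) :=
  (lebesgueHerm n).withDensity fun M => ENNReal.ofReal (tiltDensity a M)

instance {n : ℕ} (a : Fin n → ℝ) : IsFiniteMeasure (tilted a) :=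
  isFiniteMeasure_withDensity_ofReal (integrable_tiltDensity a).2

theorem integral_cexp_trace_tilted {n : ℕ} (a : Fin n → ℝ) (X : Herm n) :
    ∫ M, Complex.exp (Complex.I * Matrix.trace (X.1 * M.1)) ∂tilted a
      = gaussConst n * Complex.exp (Matrix.trace (diagC a * diagC a) / 2)
        * (Complex.exp (-(Matrix.trace (X.1 * X.1) / 2)) * orbital X.1 a) := by
  rw [tilted, integral_withDensity_eq_integral_toReal_smul
    (measurable_tiltDensity a).ennreal_ofReal (.of_forall fun _ => ENNReal.ofReal_lt_top),
    ← (integral_tiltDensity a X).2]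
  refine integral_congr_ae (.of_forall fun M => ?_)
  simp only
  rw [ENNReal.toReal_ofReal (tiltDensity_nonneg a M), Complex.real_smul, mul_comm]

/-! ### The Vandermonde and exponential determinants -/

/-- The Vandermonde determinant `∏_{i<j} (l j - l i)`. -/
def vdm {n : ℕ} (l : Fin n → ℝ) : ℝ := (Matrix.vandermonde l).det

/-- The determinant `det [exp (a i * l j)]`. -/
def expDet {n : ℕ} (a l : Fin n → ℝ) : ℝ :=
  (Matrix.of fun i j : Fin n => Real.exp (a i * l j)).det

/-- The Gaussian factor `exp (-|l|² / 2)`. -/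
def gaussExp {n : ℕ} (l : Fin n → ℝ) : ℝ := Real.exp (-(∑ i, l i ^ 2) / 2)

theorem gaussExp_pos {n : ℕ} (l : Fin n → ℝ) : 0 < gaussExp l := Real.exp_pos _

theorem ofReal_vdm {n : ℕ} (l : Fin n → ℝ) :
    (Matrix.vandermonde fun i => (l i : ℂ)).det = (vdm l : ℂ) := by
  simp [vdm, Matrix.det_vandermonde]

theorem vdm_pos {n : ℕ} {l : Fin n → ℝ} (hl : StrictMono l) : 0 < vdm l := by
  rw [vdm, Matrix.det_vandermonde]
  exact Finset.prod_pos fun i _ => Finset.prod_pos fun j hj =>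
    sub_pos.2 (hl (Finset.mem_Ioi.1 hj))

theorem vdm_comp_perm {n : ℕ} (l : Fin n → ℝ) (σ : Equiv.Perm (Fin n)) :
    vdm (l ∘ σ) = (Equiv.Perm.sign σ : ℤ) * vdm l := by
  rw [vdm, vdm, ← Matrix.det_permute]
  rfl

theorem expDet_comm {n : ℕ} (a l : Fin n → ℝ) : expDet a l = expDet l a := by
  rw [expDet, ← Matrix.det_transpose, expDet]
  congr 1
  ext i j
  simp [mul_comm]

/-- With exponents 0, …, n-1 the matrix is the transpose of a Vandermonde matrix in the increasing
numbers e^{l j}. This is the one spectrum for which positivity is known before the HCIZ formula. -/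
theorem expDet_natCast_pos {n : ℕ} {l : Fin n → ℝ} (hl : StrictMono l) :
    0 < expDet (fun i => ((i : ℕ) : ℝ)) l := by
  have h : expDet (fun i : Fin n => ((i : ℕ) : ℝ)) l = vdm fun j => Real.exp (l j) := by
    rw [expDet, ← Matrix.det_transpose, vdm]
    congr 1
    ext i j
    simp [Matrix.vandermonde_apply, Real.exp_nat_mul]
  rw [h]
  exact vdm_pos fun i j hij => Real.exp_lt_exp.2 (hl hij)

theorem continuous_vdm {n : ℕ} : Continuous (vdm (n := n)) := by
  unfold vdm
  refine Continuous.matrix_det (continuous_matrix fun i j => ?_)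
  simp only [Matrix.vandermonde_apply]
  fun_prop

theorem continuous_expDet {n : ℕ} (a : Fin n → ℝ) : Continuous (expDet a) := by
  unfold expDet
  refine Continuous.matrix_det (continuous_matrix fun i j => ?_)
  simp only [Matrix.of_apply]
  fun_prop

theorem continuous_gaussExp {n : ℕ} : Continuous (gaussExp (n := n)) := by
  unfold gaussExp
  fun_prop

theorem gaussExp_comp_perm {n : ℕ} (l : Fin n → ℝ) (σ : Equiv.Perm (Fin n)) :
    gaussExp (l ∘ σ) = gaussExp l := by
  simp only [gaussExp, Function.comp_apply]
  rw [Equiv.sum_comp σ fun i => l i ^ 2]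

theorem prod_gaussianPDFReal {n : ℕ} (a l : Fin n → ℝ) :
    ∏ i, gaussianPDFReal (a i) 1 (l i)
      = (√(2 * Real.pi))⁻¹ ^ n * gaussExp a * gaussExp l * ∏ i, Real.exp (a i * l i) := by
  have h : ∀ i, gaussianPDFReal (a i) 1 (l i) = (√(2 * Real.pi))⁻¹
      * (Real.exp (-(a i) ^ 2 / 2) * Real.exp (-(l i) ^ 2 / 2) * Real.exp (a i * l i)) := by
    intro i
    rw [gaussianPDFReal, ← Real.exp_add, ← Real.exp_add]
    congr 2
    · simp
    · push_cast
      ring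
  simp only [h, Finset.prod_mul_distrib, ← Real.exp_sum, gaussExp, Finset.prod_const,
    Finset.card_univ, Fintype.card_fin, Finset.sum_div, Finset.sum_neg_distrib, neg_div]
  ring

/-- The signs of Δ under permutations assemble the products of e^{aᵢ λ_σ(i)} into a determinant; the
Gaussian factor is symmetric. -/
theorem sum_perm_gaussian_vdm {n : ℕ} (a l : Fin n → ℝ) :
    ∑ σ : Equiv.Perm (Fin n), (∏ i, gaussianPDFReal (a i) 1 ((l ∘ σ) i)) * vdm (l ∘ σ)
      = (√(2 * Real.pi))⁻¹ ^ n * gaussExp a * (vdm l * expDet a l * gaussExp l) := by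
  have h : expDet a l = ∑ σ : Equiv.Perm (Fin n), ((Equiv.Perm.sign σ : ℤ) : ℝ)
      * ∏ i, Real.exp (a i * l (σ i)) := by
    rw [expDet, ← Matrix.det_transpose, Matrix.det_apply']
    rfl
  rw [h]
  simp only [prod_gaussianPDFReal, gaussExp_comp_perm, vdm_comp_perm, Finset.mul_sum,
    Finset.sum_mul]
  refine Finset.sum_congr rfl fun σ _ => ?_
  simp only [Function.comp_apply]
  ring

/-! ### Integrals over the chamber -/

theorem integral_eq_integral_chamber_sum {n : ℕ} {E : Type*} [NormedAddCommGroup E]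
    [NormedSpace ℝ E] {f : (Fin n → ℝ) → E} (hf : Integrable f) :
    ∫ l, f l = ∫ l in chamber n, ∑ σ : Equiv.Perm (Fin n), f (l ∘ σ) := by
  have hσ : ∀ σ : Equiv.Perm (Fin n), Integrable fun l => f (l ∘ σ) := fun σ =>
    (measurePreserving_comp_perm σ).integrable_comp_of_integrable hf
  have hm : ∀ σ : Equiv.Perm (Fin n),
      (volume.restrict (chamber n)).map (fun l : Fin n → ℝ => l ∘ σ) ≤ volume := by
    intro σ
    conv_rhs => rw [← (measurePreserving_comp_perm σ).map_eq]
    exact Measure.map_mono Measure.restrict_le_self (measurable_comp_perm σ)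
  rw [integral_finsetSum _ fun σ _ => (hσ σ).integrableOn]
  conv_lhs => rw [← sum_map_restrict_chamber n]
  rw [integral_finsetSum_measure fun σ _ => hf.mono_measure (hm σ)]
  refine Finset.sum_congr rfl fun σ _ => ?_
  exact integral_map (measurable_comp_perm σ).aemeasurable (hf.mono_measure (hm σ)).1

/-- The permutation matrix of `σ` as a unitary matrix. -/
def permUnitary {n : ℕ} (σ : Equiv.Perm (Fin n)) : U n :=
  ⟨(1 : Matrix (Fin n) (Fin n) ℂ).submatrix id σ, by
    rw [Matrix.mem_unitaryGroup_iff', Matrix.star_eq_conjTranspose, Matrix.conjTranspose_submatrix,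
      Matrix.conjTranspose_one, ← Matrix.submatrix_mul _ _ _ _ _ Function.bijective_id, mul_one,
      Matrix.submatrix_one_equiv]⟩

theorem conjBy_mul_permUnitary {n : ℕ} (X : Matrix (Fin n) (Fin n) ℂ) (V : U n)
    (σ : Equiv.Perm (Fin n)) (k : Fin n) :
    conjBy X (V * permUnitary σ) k k = conjBy X V (σ k) (σ k) := by
  rw [conjBy_mul]
  simp [permUnitary, Matrix.mul_apply, Matrix.star_apply, Matrix.one_apply]

theorem orbital_comp_perm {n : ℕ} (X : Matrix (Fin n) (Fin n) ℂ) (l : Fin n → ℝ)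
    (σ : Equiv.Perm (Fin n)) : orbital X (l ∘ σ) = orbital X l := by
  rw [orbital, orbital, ← integral_mul_right_eq_self _ (permUnitary σ)]
  refine integral_congr_ae (.of_forall fun V => ?_)
  simp only [phase, conjBy_mul_permUnitary, Function.comp_apply]
  rw [Equiv.sum_comp σ fun k => (l k : ℂ) * conjBy X V k k]

/-! ### The eigenvalue law of the tilted Gaussian measure -/

/-- The constant in the eigenvalue density of the tilted Gaussian measure. -/
def chamberConst (n : ℕ) : ℝ := gaussConst n * (√(2 * Real.pi))⁻¹ ^ n

theorem chamberConst_pos (n : ℕ) : 0 < chamberConst n :=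
  mul_pos (gaussConst_pos n) (by positivity)

/-- The signed eigenvalue density of the tilted Gaussian measure. -/
def chamberDensity {n : ℕ} (a l : Fin n → ℝ) : ℝ :=
  chamberConst n * (vdm a)⁻¹ * (vdm l * expDet a l * gaussExp l)

theorem continuous_chamberDensity {n : ℕ} (a : Fin n → ℝ) : Continuous (chamberDensity a) :=
  continuous_const.mul ((continuous_vdm.mul (continuous_expDet a)).mul continuous_gaussExp)

theorem integrable_gaussian_vdm {n : ℕ} (a : Fin n → ℝ) :
    Integrable fun l : Fin n → ℝ => (∏ i, gaussianPDFReal (a i) 1 (l i)) * vdm l := by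
  have h := (integrable_gaussPi_iff a one_ne_zero _).1 (integrable_vandermonde_gaussPi a 1)
  simpa [ofReal_vdm, ← Complex.ofReal_mul, -Complex.ofReal_prod] using h.re

theorem integrable_chamberDensity {n : ℕ} (a : Fin n → ℝ) :
    Integrable (chamberDensity a) := by
  have h1 : Integrable fun l : Fin n → ℝ => ∑ σ : Equiv.Perm (Fin n),
      (∏ i, gaussianPDFReal (a i) 1 ((l ∘ σ) i)) * vdm (l ∘ σ) :=
    integrable_finsetSum _ fun σ _ =>
      (measurePreserving_comp_perm σ).integrable_comp_of_integrable (integrable_gaussian_vdm a)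
  have h2 : chamberDensity a = fun l => gaussConst n * (vdm a)⁻¹ * (gaussExp a)⁻¹
      * ∑ σ : Equiv.Perm (Fin n),
        (∏ i, gaussianPDFReal (a i) 1 ((l ∘ σ) i)) * vdm (l ∘ σ) := by
    ext l
    rw [sum_perm_gaussian_vdm, chamberDensity, chamberConst]
    have := (gaussExp_pos a).ne'
    field_simp
  rw [h2]
  exact h1.const_mul _

theorem cexp_trace_diagC_sq {n : ℕ} (a : Fin n → ℝ) :
    Complex.exp (Matrix.trace (diagC a * diagC a) / 2) = ((gaussExp a)⁻¹ : ℝ) := by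
  rw [gaussExp, ← Real.exp_neg, Complex.ofReal_exp]
  congr 1
  rw [diagC, Matrix.diagonal_mul_diagonal, Matrix.trace_diagonal]
  push_cast
  simp only [pow_two]
  ring

/-- The Gaussian average of Δ times the orbital integral, folded onto the chamber: `orbital` is
symmetric in the eigenvalues, so only the density is antisymmetrized. -/
theorem integral_chamber_orbital {n : ℕ} {X : Matrix (Fin n) (Fin n) ℂ} (hX : X.IsHermitian)
    (a : Fin n → ℝ) :
    ∫ l in chamber n, ((√(2 * Real.pi))⁻¹ ^ n * gaussExp a
        * (vdm l * expDet a l * gaussExp l) : ℝ) * orbital X l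
      = Complex.exp (-(Matrix.trace (X * X) / 2)) * (vdm a * orbital X a) := by
  have h := integral_vandermonde_orbital hX a
  simp only [ofReal_vdm] at h
  have hint : Integrable fun l : Fin n → ℝ =>
      (((∏ i, gaussianPDFReal (a i) 1 (l i)) * vdm l : ℝ) : ℂ) * orbital X l :=
    (integrable_gaussian_vdm a).ofReal.mul_bdd (c := 1)
      (continuous_orbital hX).aestronglyMeasurable (.of_forall fun l => norm_orbital_le hX l)
  rw [← h, integral_gaussPi a one_ne_zero]
  have h2 : ∀ l : Fin n → ℝ, ((∏ i, gaussianPDFReal (a i) 1 (l i) : ℝ) : ℂ)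
      * (vdm l * orbital X l)
      = (((∏ i, gaussianPDFReal (a i) 1 (l i)) * vdm l : ℝ) : ℂ) * orbital X l := by
    intro l
    rw [Complex.ofReal_mul, mul_assoc]
  simp only [h2]
  rw [integral_eq_integral_chamber_sum hint]
  refine integral_congr_ae (.of_forall fun l => ?_)
  simp only [orbital_comp_perm]
  rw [← Finset.sum_mul, ← Complex.ofReal_sum, sum_perm_gaussian_vdm]

/-- The Fourier transform of the tilted measure equals the chamber integral of `chamberDensity a`
against `orbital`. The sign of that density is not yet known for general a, so its negative part
stays on the left. -/
theorem map_eig_tilted_add {n : ℕ} {a : Fin n → ℝ} (ha : vdm a ≠ 0) :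
    (tilted a).map eig
      + (volume.restrict (chamber n)).withDensity (fun l => ENNReal.ofReal (-chamberDensity a l))
      = (volume.restrict (chamber n)).withDensity
        (fun l => ENNReal.ofReal (chamberDensity a l)) := by
  refine map_eig_add_eq (tilted a) (continuous_chamberDensity a).measurable
    (integrable_chamberDensity a).integrableOn fun X => ?_
  rw [integral_cexp_trace_tilted]
  have h1 : ∀ l : Fin n → ℝ, (chamberDensity a l : ℂ) * orbital X.1 l
      = ((gaussConst n * (vdm a)⁻¹ * (gaussExp a)⁻¹ : ℝ) : ℂ) * (((√(2 * Real.pi))⁻¹ ^ n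
        * gaussExp a * (vdm l * expDet a l * gaussExp l) : ℝ) * orbital X.1 l) := by
    intro l
    rw [← mul_assoc, ← Complex.ofReal_mul, chamberDensity, chamberConst]
    congr 2
    have := (gaussExp_pos a).ne'
    field_simp
  simp only [h1]
  rw [integral_const_mul, integral_chamber_orbital X.2, cexp_trace_diagC_sq]
  have ha' : (vdm a : ℂ) ≠ 0 := Complex.ofReal_ne_zero.2 ha
  push_cast
  field_simp

theorem map_withDensity_comp {α β : Type*} [MeasurableSpace α] [MeasurableSpace β]
    (μ : Measure α) {f : α → β} (hf : Measurable f) {g : β → ℝ≥0∞} (hg : Measurable g) :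
    (μ.withDensity fun x => g (f x)).map f = (μ.map f).withDensity g := by
  ext s hs
  rw [Measure.map_apply hf hs, withDensity_apply _ (hf hs), withDensity_apply _ hs,
    setLIntegral_map hs hg hf]

theorem trace_sq_eq_sum_eig {n : ℕ} (M : Herm n) :
    Matrix.trace (M.1 * M.1) = ((∑ i, eig M i ^ 2 : ℝ) : ℂ) := by
  obtain ⟨W, hW⟩ := exists_conj_diag_eig M
  have h := trace_conjBy_sq (diagC (eig M)) W⁻¹
  rw [conjBy_inv, ← hW] at h
  rw [h, diagC, Matrix.diagonal_mul_diagonal, Matrix.trace_diagonal]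
  push_cast
  simp only [pow_two]

theorem tiltDensity_eq {n : ℕ} (a : Fin n → ℝ) (M : Herm n) :
    tiltDensity a M = hcizDiag a (eig M) * gaussExp (eig M) := by
  rw [tiltDensity, hciz_eq_hcizDiag_eig, one_smul, trace_sq_eq_sum_eig, gaussExp,
    Complex.ofReal_re]

theorem continuous_hcizDiag_right {n : ℕ} (a : Fin n → ℝ) :
    Continuous fun l => hcizDiag a l := by
  have h : Continuous fun l : Fin n → ℝ => (a, l) := by fun_prop
  have h2 := continuous_hcizDiag.comp h
  simpa only [Function.comp_def] using h2

theorem continuous_hcizDiag_mul_gaussExp {n : ℕ} (a : Fin n → ℝ) :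
    Continuous fun l => hcizDiag a l * gaussExp l :=
  (continuous_hcizDiag_right a).mul continuous_gaussExp

theorem measurable_hcizDiag_mul_gaussExp {n : ℕ} (a : Fin n → ℝ) :
    Measurable fun l => ENNReal.ofReal (hcizDiag a l * gaussExp l) :=
  (continuous_hcizDiag_mul_gaussExp a).measurable.ennreal_ofReal

theorem measurable_neg_chamberDensity {n : ℕ} (a : Fin n → ℝ) :
    Measurable fun l => ENNReal.ofReal (-chamberDensity a l) :=
  (continuous_chamberDensity a).measurable.neg.ennreal_ofReal

theorem map_eig_tilted {n : ℕ} (a : Fin n → ℝ) :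
    (tilted a).map eig = ((lebesgueHerm n).map eig).withDensity
      fun l => ENNReal.ofReal (hcizDiag a l * gaussExp l) := by
  rw [← map_withDensity_comp _ (measurable_eig n) (measurable_hcizDiag_mul_gaussExp a), tilted]
  simp only [tiltDensity_eq]

/-! ### The Harish-Chandra–Itzykson–Zuber formula and Weyl's integration formula -/

/-- The reference spectrum `0, 1, …, n - 1`. -/
def rho (n : ℕ) : Fin n → ℝ := fun i => ((i : ℕ) : ℝ)

theorem strictMono_rho (n : ℕ) : StrictMono (rho n) := fun i j h => by
  simpa [rho] using h

theorem expDet_rho_pos {n : ℕ} {l : Fin n → ℝ} (hl : StrictMono l) : 0 < expDet (rho n) l :=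
  expDet_natCast_pos hl

/-- The density of the eigenvalues under the flat measure, before it is computed. -/
def flatDensity {n : ℕ} (l : Fin n → ℝ) : ℝ :=
  chamberDensity (rho n) l * (hcizDiag (rho n) l * gaussExp l)⁻¹

theorem continuous_flatDensity {n : ℕ} : Continuous (flatDensity (n := n)) :=
  (continuous_chamberDensity _).mul
    ((continuous_hcizDiag_mul_gaussExp _).inv₀ fun l =>
      (mul_pos (hcizDiag_pos _ l) (gaussExp_pos l)).ne')

theorem chamberDensity_rho_nonneg {n : ℕ} {l : Fin n → ℝ} (hl : StrictMono l) :
    0 ≤ chamberDensity (rho n) l :=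
  mul_nonneg (mul_nonneg (chamberConst_pos n).le (inv_nonneg.2 (vdm_pos (strictMono_rho n)).le))
    (mul_nonneg (mul_nonneg (vdm_pos hl).le (expDet_rho_pos hl).le) (gaussExp_pos l).le)

theorem flatDensity_nonneg {n : ℕ} {l : Fin n → ℝ} (hl : StrictMono l) : 0 ≤ flatDensity l :=
  mul_nonneg (chamberDensity_rho_nonneg hl)
    (inv_nonneg.2 (mul_pos (hcizDiag_pos _ l) (gaussExp_pos l)).le)

/-- At the reference spectrum the signed density is nonnegative, so the correction term disappears;
the tilt is a strictly positive function of the eigenvalues and can be divided out. -/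
theorem map_eig_lebesgueHerm_eq_flatDensity (n : ℕ) :
    (lebesgueHerm n).map eig
      = (volume.restrict (chamber n)).withDensity fun l => ENNReal.ofReal (flatDensity l) := by
  have hp : ∀ l : Fin n → ℝ, 0 < hcizDiag (rho n) l * gaussExp l := fun l =>
    mul_pos (hcizDiag_pos _ l) (gaussExp_pos l)
  have hm : Measurable fun l : Fin n → ℝ => ENNReal.ofReal (hcizDiag (rho n) l * gaussExp l) :=
    measurable_hcizDiag_mul_gaussExp _
  have h0 : (volume.restrict (chamber n)).withDensity
      (fun l => ENNReal.ofReal (-chamberDensity (rho n) l)) = 0 := by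
    rw [withDensity_eq_zero_iff (measurable_neg_chamberDensity _).aemeasurable]
    refine (ae_restrict_iff' (measurableSet_chamber n)).2 (.of_forall fun l hl => ?_)
    exact ENNReal.ofReal_of_nonpos (neg_nonpos.2 (chamberDensity_rho_nonneg hl))
  have h := map_eig_tilted_add (vdm_pos (strictMono_rho n)).ne'
  rw [h0, add_zero, map_eig_tilted] at h
  have hm' : Measurable fun l : Fin n → ℝ =>
      (ENNReal.ofReal (hcizDiag (rho n) l * gaussExp l))⁻¹ := hm.inv
  have h2 := congrArg (fun μ => μ.withDensity fun l =>
    (ENNReal.ofReal (hcizDiag (rho n) l * gaussExp l))⁻¹) h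
  beta_reduce at h2
  rw [withDensity_inv_same hm (.of_forall fun l => (ENNReal.ofReal_pos.2 (hp l)).ne')
    (.of_forall fun l => ENNReal.ofReal_ne_top), ← withDensity_mul _
    (continuous_chamberDensity _).measurable.ennreal_ofReal hm'] at h2
  rw [h2]
  congr 1
  ext l
  rw [Pi.mul_apply, flatDensity, ENNReal.ofReal_mul' (inv_nonneg.2 (hp l).le),
    ENNReal.ofReal_inv_of_pos (hp l)]

/-- Two densities of the same spectral law agree almost everywhere on the chamber, and by continuity
at every point of this open set. -/
theorem flatDensity_mul_hcizDiag {n : ℕ} {a l : Fin n → ℝ} (ha : vdm a ≠ 0) (hl : StrictMono l) :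
    flatDensity l * (hcizDiag a l * gaussExp l) = chamberDensity a l := by
  have hm1 : Measurable fun l : Fin n → ℝ => ENNReal.ofReal (flatDensity l) :=
    continuous_flatDensity.measurable.ennreal_ofReal
  have hm2 : Measurable fun l : Fin n → ℝ => ENNReal.ofReal (hcizDiag a l * gaussExp l) :=
    measurable_hcizDiag_mul_gaussExp a
  have hm3 := (continuous_chamberDensity a).measurable
  have h := map_eig_tilted_add ha
  rw [map_eig_tilted, map_eig_lebesgueHerm_eq_flatDensity, ← withDensity_mul _ hm1 hm2,
    ← withDensity_add_left (hm1.mul hm2),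
    withDensity_eq_iff_of_sigmaFinite 
      ((hm1.mul hm2).add (measurable_neg_chamberDensity a)).aemeasurable
      hm3.ennreal_ofReal.aemeasurable] at h
  have h2 : (fun l : Fin n → ℝ => flatDensity l * (hcizDiag a l * gaussExp l))
      =ᵐ[volume.restrict (chamber n)] chamberDensity a := by
    filter_upwards [h, ae_restrict_mem (measurableSet_chamber n)] with l h hl
    have hf := flatDensity_nonneg hl
    have hg := (mul_pos (hcizDiag_pos a l) (gaussExp_pos l)).le
    simp only [Pi.add_apply, Pi.mul_apply] at h
    rw [← ENNReal.ofReal_mul hf] at h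
    -- Where the signed density is nonpositive, the identity forces both it and the nonnegative
    -- product to vanish.
    rcases le_total 0 (chamberDensity a l) with h0 | h0
    · rw [ENNReal.ofReal_of_nonpos (neg_nonpos.2 h0), add_zero,
        ENNReal.ofReal_eq_ofReal_iff (mul_nonneg hf hg) h0] at h
      exact h
    · rw [ENNReal.ofReal_of_nonpos h0, add_eq_zero, ENNReal.ofReal_eq_zero,
        ENNReal.ofReal_eq_zero] at h
      have := mul_nonneg hf hg
      linarith [h.1, h.2]
  exact Measure.eqOn_open_of_ae_eq h2 (isOpen_chamber n)
    (continuous_flatDensity.mul (continuous_hcizDiag_mul_gaussExp a)).continuousOn (continuous_chamberDensity a).continuousOn hl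

theorem hcizDiag_mul_expDet_rho {n : ℕ} {a l : Fin n → ℝ} (ha : vdm a ≠ 0) (hl : StrictMono l) :
    hcizDiag a l * expDet (rho n) l * vdm a
      = vdm (rho n) * expDet a l * hcizDiag (rho n) l := by
  have h := flatDensity_mul_hcizDiag ha hl
  have h1 := (vdm_pos hl).ne'
  have h2 := (vdm_pos (strictMono_rho n)).ne'
  have h3 := (chamberConst_pos n).ne'
  have h4 := (hcizDiag_pos (rho n) l).ne'
  have h5 := (gaussExp_pos l).ne'
  rw [flatDensity, chamberDensity, chamberDensity] at h
  field_simp at h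
  linear_combination h

/-- The constant in the Harish-Chandra–Itzykson–Zuber formula. -/
def hcizConst (n : ℕ) : ℝ :=
  vdm (rho n) ^ 2 * hcizDiag (rho n) (rho n) / expDet (rho n) (rho n)

theorem hcizConst_pos (n : ℕ) : 0 < hcizConst n :=
  div_pos (mul_pos (pow_pos (vdm_pos (strictMono_rho n)) 2) (hcizDiag_pos _ _))
    (expDet_rho_pos (strictMono_rho n))

/-- The preceding ratio identity with l as first spectrum and `rho n` as second, read backwards
through the symmetry of `hcizDiag` and `expDet`. -/
theorem hcizDiag_rho_mul {n : ℕ} {l : Fin n → ℝ} (hl : StrictMono l) :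
    hcizDiag (rho n) l * vdm (rho n) * vdm l = hcizConst n * expDet (rho n) l := by
  have h := hcizDiag_mul_expDet_rho (vdm_pos hl).ne' (strictMono_rho n)
  rw [hcizDiag_comm l, expDet_comm l] at h
  have := (expDet_rho_pos (strictMono_rho n)).ne'
  rw [hcizConst]
  field_simp
  linear_combination vdm (rho n) * h

/-- The Harish-Chandra–Itzykson–Zuber formula. -/
theorem hcizDiag_mul_vdm_mul_vdm {n : ℕ} {a l : Fin n → ℝ} (ha : vdm a ≠ 0)
    (hl : StrictMono l) :
    hcizDiag a l * vdm a * vdm l = hcizConst n * expDet a l := by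
  have h1 := hcizDiag_mul_expDet_rho ha hl
  have h2 := hcizDiag_rho_mul hl
  refine mul_right_cancel₀ (expDet_rho_pos hl).ne' ?_
  linear_combination vdm l * h1 + expDet a l * h2

/-- Inserting the HCIZ formula at `rho n` into `flatDensity` cancels the reference determinant and
leaves Δ²: Weyl's integration formula. -/
theorem map_eig_lebesgueHerm (n : ℕ) :
    (lebesgueHerm n).map eig = (volume.restrict (chamber n)).withDensity
      fun l => ENNReal.ofReal (chamberConst n / hcizConst n * vdm l ^ 2) := by
  rw [map_eig_lebesgueHerm_eq_flatDensity]
  refine withDensity_congr_ae ?_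
  filter_upwards [ae_restrict_mem (measurableSet_chamber n)] with l hl
  congr 1
  have h2 := hcizDiag_rho_mul hl
  have h3 := (vdm_pos (strictMono_rho n)).ne'
  have h4 := (hcizDiag_pos (rho n) l).ne'
  have h5 := (gaussExp_pos l).ne'
  have h6 := (hcizConst_pos n).ne'
  rw [flatDensity, chamberDensity]
  field_simp
  linear_combination -(chamberConst n * vdm l) * h2

/-! ### The lexicographic order of the slots -/

section Slots

variable {n p : ℕ} (m : Fin p → ℕ) (hm : ∑ i, m i = n)

/-- The multiplicity of the `j`-th location, extended by zero. -/
def multExt (j : ℕ) : ℕ := if h : j < p then m ⟨j, h⟩ else 0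

theorem val_eq_sum_range_add (k : Fin n) :
    (k : ℕ) = ∑ j ∈ Finset.range (slot m hm k).1, multExt m j + (slot m hm k).2 := by
  have h := finSigmaFinEquiv_apply (slot m hm k)
  rw [slot, Equiv.apply_symm_apply] at h
  rw [← Fin.sum_univ_eq_sum_range]
  refine h.trans ?_
  congr 1
  refine Finset.sum_congr rfl fun i _ => ?_
  have hi : (i : ℕ) < p := i.2.trans (slot m hm k).1.2
  simp only [multExt, hi, dite_true]
  rfl

theorem lt_of_block_lt {k l : Fin n} (h : (slot m hm k).1 < (slot m hm l).1) : k < l := by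
  rw [Fin.lt_def, val_eq_sum_range_add m hm k, val_eq_sum_range_add m hm l]
  have h1 : ((slot m hm k).2 : ℕ) < multExt m (slot m hm k).1 := by
    simp [multExt]
  have h2 : ∑ j ∈ Finset.range ((slot m hm k).1 + 1), multExt m j
      ≤ ∑ j ∈ Finset.range (slot m hm l).1, multExt m j :=
    Finset.sum_le_sum_of_subset (Finset.range_subset_range.2 h)
  rw [Finset.sum_range_succ] at h2
  omega

theorem lt_iff_of_block_eq {k l : Fin n} (h : (slot m hm k).1 = (slot m hm l).1) :
    k < l ↔ ((slot m hm k).2 : ℕ) < (slot m hm l).2 := by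
  have h1 : ∑ j ∈ Finset.range (slot m hm k).1, multExt m j
      = ∑ j ∈ Finset.range (slot m hm l).1, multExt m j := by rw [h]
  rw [Fin.lt_def, val_eq_sum_range_add m hm k, val_eq_sum_range_add m hm l]
  omega

theorem block_le_of_lt {k l : Fin n} (h : k < l) : (slot m hm k).1 ≤ (slot m hm l).1 := by
  by_contra! h'
  exact (h.trans (lt_of_block_lt m hm h')).false

/-- `slot` as an equivalence. -/
def slotEquiv : Fin n ≃ (i : Fin p) × Fin (m i) :=
  (finCongr hm.symm).trans finSigmaFinEquiv.symm

theorem sum_block {M : Type*} [AddCommMonoid M] (k : Fin n) (f : ℕ → M) :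
    ∑ l, (if (slot m hm l).1 = (slot m hm k).1 then f (slot m hm l).2 else 0)
      = ∑ r ∈ Finset.range (m (slot m hm k).1), f r := by
  have h := Equiv.sum_comp (slotEquiv m hm)
    fun s => if s.1 = (slot m hm k).1 then f s.2 else 0
  refine Eq.trans h ?_
  rw [Fintype.sum_sigma, Finset.sum_eq_single (slot m hm k).1]
  · simp only [if_true]
    exact Fin.sum_univ_eq_sum_range f _
  · intro i _ hi
    simp [hi]
  · simp

theorem card_lt_same_block (l : Fin n) :
    (Finset.univ.filter fun k => k < l ∧ (slot m hm k).1 = (slot m hm l).1).card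
      = (slot m hm l).2 := by
  rw [Finset.card_filter]
  have h1 : ∀ k, (if k < l ∧ (slot m hm k).1 = (slot m hm l).1 then 1 else 0 : ℕ)
      = if (slot m hm k).1 = (slot m hm l).1 then
        (fun r => if r < ((slot m hm l).2 : ℕ) then 1 else 0) (slot m hm k).2 else 0 := by
    intro k
    by_cases h : (slot m hm k).1 = (slot m hm l).1
    · simp [h, lt_iff_of_block_eq m hm h]
    · simp [h]
  refine (Finset.sum_congr rfl fun k _ => h1 k).trans ((sum_block m hm l fun r =>
    if r < ((slot m hm l).2 : ℕ) then 1 else 0).trans ?_)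
  rw [← Finset.card_filter]
  have h2 : (Finset.range (m (slot m hm l).1)).filter (fun r => r < ((slot m hm l).2 : ℕ))
      = Finset.range (slot m hm l).2 := by
    ext r
    have := (slot m hm l).2.2
    simp only [Finset.mem_filter, Finset.mem_range]
    omega
  rw [h2, Finset.card_range]

/-! ### Confluent determinants -/

/-- Inside a block, u^r = ∑ C(r, s)(u - 1)^s expresses the old rows by the new ones through a
unipotent lower triangular matrix. -/
theorem det_confluent_row_op (u : Fin n → ℝ) (e : Fin p → Fin n → ℝ) :
    (Matrix.of fun k j : Fin n => e (slot m hm k).1 j * u j ^ ((slot m hm k).2 : ℕ)).det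
      = (Matrix.of fun k j : Fin n =>
        e (slot m hm k).1 j * (u j - 1) ^ ((slot m hm k).2 : ℕ)).det := by
  let L : Matrix (Fin n) (Fin n) ℝ := Matrix.of fun k l =>
    if (slot m hm l).1 = (slot m hm k).1 then
      (Nat.choose (slot m hm k).2 (slot m hm l).2 : ℝ) else 0
  have hL : L.det = 1 := by
    rw [Matrix.det_of_isLowerTriangular L]
    · simp [L]
    · intro k l hkl
      have hkl : k < l := hkl
      simp only [L, Matrix.of_apply]
      split_ifs with h
      · rw [Nat.choose_eq_zero_of_lt ((lt_iff_of_block_eq m hm h.symm).1 hkl), Nat.cast_zero]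
      · rfl
  have hmul : (Matrix.of fun k j : Fin n => e (slot m hm k).1 j * u j ^ ((slot m hm k).2 : ℕ))
      = L * Matrix.of fun k j : Fin n =>
        e (slot m hm k).1 j * (u j - 1) ^ ((slot m hm k).2 : ℕ) := by
    ext k j
    rw [Matrix.mul_apply]
    have h1 : ∀ l, L k l * (Matrix.of fun k j : Fin n =>
          e (slot m hm k).1 j * (u j - 1) ^ ((slot m hm k).2 : ℕ)) l j
        = if (slot m hm l).1 = (slot m hm k).1 then
          (fun r => e (slot m hm k).1 j * ((u j - 1) ^ r * (Nat.choose (slot m hm k).2 r : ℝ)))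
            (slot m hm l).2 else 0 := by
      intro l
      simp only [L, Matrix.of_apply]
      split_ifs with h
      · have h2 : e (slot m hm l).1 j = e (slot m hm k).1 j := by rw [h]
        rw [h2]
        ring
      · rw [zero_mul]
    refine Eq.symm ((Finset.sum_congr rfl fun l _ => h1 l).trans ((sum_block m hm k fun r =>
      e (slot m hm k).1 j * ((u j - 1) ^ r * (Nat.choose (slot m hm k).2 r : ℝ))).trans ?_))
    rw [← Finset.mul_sum, Matrix.of_apply]
    congr 1
    have h2 := add_pow (u j - 1) 1 ((slot m hm k).2 : ℕ)
    simp only [sub_add_cancel, one_pow, mul_one] at h2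
    rw [h2]
    symm
    -- The binomial sum stops at r; extending it over the whole block adds only vanishing binomial
    -- coefficients.
    refine Finset.sum_subset (Finset.range_subset_range.2 (slot m hm k).2.2) fun r _ hr => ?_
    rw [Nat.choose_eq_zero_of_lt (by simpa using hr), Nat.cast_zero, mul_zero]
  rw [hmul, Matrix.det_mul, hL, one_mul]

/-! ### The confluent limit of the HCIZ formula -/

/-- The spectrum with the coinciding locations pulled apart by multiples of `ε`. -/
def spread (y : Fin p → ℝ) (ε : ℝ) (k : Fin n) : ℝ :=
  y (slot m hm k).1 + ε * ((slot m hm k).2 : ℕ)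

/-- The confluent determinant with rows `l ^ r * exp (y l)`. -/
def powExpDet (y : Fin p → ℝ) (l : Fin n → ℝ) : ℝ :=
  (Matrix.of fun k j : Fin n =>
    Real.exp (y (slot m hm k).1 * l j) * l j ^ ((slot m hm k).2 : ℕ)).det

/-- The limit of the rescaled Vandermonde determinant of the spread spectrum. -/
def confluentVdm (y : Fin p → ℝ) : ℝ :=
  ∏ q ∈ pairs n, if (slot m hm q.1).1 = (slot m hm q.2).1 then
    (((slot m hm q.2).2 : ℕ) - ((slot m hm q.1).2 : ℕ) : ℝ)
    else y (slot m hm q.2).1 - y (slot m hm q.1).1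

theorem confluentVdm_pos {y : Fin p → ℝ} (hy : StrictMono y) : 0 < confluentVdm m hm y := by
  refine Finset.prod_pos fun q hq => ?_
  have hq : q.1 < q.2 := by simpa [pairs] using hq
  split_ifs with h
  · rw [sub_pos, Nat.cast_lt]
    exact (lt_iff_of_block_eq m hm h).1 hq
  · exact sub_pos.2 (hy (lt_of_le_of_ne (block_le_of_lt m hm hq) h))

/-- A slot with index r in its block has exactly r predecessors there. Hence the Vandermonde and the
exponential determinant carry the same power of ε. -/
theorem prod_pairs_ite (ε : ℝ) :
    ∏ q ∈ pairs n, (if (slot m hm q.1).1 = (slot m hm q.2).1 then ε else 1)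
      = ∏ k, ε ^ ((slot m hm k).2 : ℕ) := by
  rw [pairs, Finset.prod_filter, ← Finset.univ_product_univ, Finset.prod_product_right]
  refine Finset.prod_congr rfl fun l _ => ?_
  simp only [← ite_and]
  rw [← Finset.prod_filter, Finset.prod_const, card_lt_same_block]

theorem vdm_spread (y : Fin p → ℝ) (ε : ℝ) :
    vdm (spread m hm y ε) = (∏ k, ε ^ ((slot m hm k).2 : ℕ))
      * ∏ q ∈ pairs n, if (slot m hm q.1).1 = (slot m hm q.2).1 then
        (((slot m hm q.2).2 : ℕ) - ((slot m hm q.1).2 : ℕ) : ℝ)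
        else spread m hm y ε q.2 - spread m hm y ε q.1 := by
  rw [vdm, det_vandermonde_eq_prod_pairs, ← prod_pairs_ite, ← Finset.prod_mul_distrib]
  refine Finset.prod_congr rfl fun q _ => ?_
  split_ifs with h
  · have h1 : y (slot m hm q.1).1 = y (slot m hm q.2).1 := by rw [h]
    rw [spread, spread, h1]
    ring
  · rw [one_mul]

/-- Row operations replace e^{ε r λ} by (e^{ελ} - 1)^r; dividing by ε^r gives rows converging to λ^r
e^{yλ}. -/
theorem expDet_spread (y : Fin p → ℝ) {ε : ℝ} (hε : ε ≠ 0) (l : Fin n → ℝ) :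
    expDet (spread m hm y ε) l = (∏ k, ε ^ ((slot m hm k).2 : ℕ))
      * (Matrix.of fun k j : Fin n => Real.exp (y (slot m hm k).1 * l j)
        * ((Real.exp (ε * l j) - 1) / ε) ^ ((slot m hm k).2 : ℕ)).det := by
  have h1 : expDet (spread m hm y ε) l = (Matrix.of fun k j : Fin n =>
      Real.exp (y (slot m hm k).1 * l j) * Real.exp (ε * l j) ^ ((slot m hm k).2 : ℕ)).det := by
    rw [expDet]
    congr 1
    ext k j
    simp only [Matrix.of_apply, spread]
    rw [← Real.exp_nat_mul, ← Real.exp_add]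
    ring_nf
  rw [h1, det_confluent_row_op m hm (fun j => Real.exp (ε * l j))
    (fun i j => Real.exp (y i * l j)), ← Matrix.det_mul_column]
  congr 1
  ext k j
  simp only [Matrix.of_apply]
  rw [div_pow]
  field_simp

-- The HCIZ formula at the spread spectrum, divided by the common power of ε, in the limit ε → 0⁺.
-- Every factor converges, the HCIZ integral by continuity in its spectrum.
open Filter Topology in
theorem hcizDiag_block {y : Fin p → ℝ} (hy : StrictMono y) {l : Fin n → ℝ}
    (hl : StrictMono l) :
    hcizDiag (fun k => y (slot m hm k).1) l * confluentVdm m hm y * vdm l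
      = hcizConst n * powExpDet m hm y l := by
  have hs : Tendsto (fun ε => spread m hm y ε) (𝓝[>] 0) (𝓝 fun k => y (slot m hm k).1) := by
    have h : Continuous fun ε : ℝ => spread m hm y ε := by
      unfold spread
      fun_prop
    have h2 := h.tendsto 0
    have h3 : spread m hm y 0 = fun k => y (slot m hm k).1 := by
      ext k
      simp [spread]
    rw [h3] at h2
    exact h2.mono_left nhdsWithin_le_nhds
  have hv : Tendsto (fun ε => ∏ q ∈ pairs n, if (slot m hm q.1).1 = (slot m hm q.2).1 then
        (((slot m hm q.2).2 : ℕ) - ((slot m hm q.1).2 : ℕ) : ℝ)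
        else spread m hm y ε q.2 - spread m hm y ε q.1) (𝓝[>] 0) (𝓝 (confluentVdm m hm y)) := by
    refine tendsto_finsetProd _ fun q _ => ?_
    split_ifs with h
    · exact tendsto_const_nhds
    · exact ((tendsto_pi_nhds.1 hs) q.2).sub ((tendsto_pi_nhds.1 hs) q.1)
  have hd : Tendsto (fun ε => (Matrix.of fun k j : Fin n => Real.exp (y (slot m hm k).1 * l j)
        * ((Real.exp (ε * l j) - 1) / ε) ^ ((slot m hm k).2 : ℕ)).det) (𝓝[>] 0)
        (𝓝 (powExpDet m hm y l)) := by
    have hdet : Continuous fun A : Matrix (Fin n) (Fin n) ℝ => A.det :=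
      Continuous.matrix_det continuous_id
    refine (hdet.tendsto _).comp (tendsto_pi_nhds.2 fun k => tendsto_pi_nhds.2 fun j => ?_)
    refine tendsto_const_nhds.mul (Tendsto.pow ?_ _)
    have h1 : HasDerivAt (fun ε => Real.exp (ε * l j)) (l j) 0 := by
      simpa using ((hasDerivAt_id (0 : ℝ)).mul_const (l j)).exp
    have h2 := h1.tendsto_slope_zero_right
    refine h2.congr fun ε => ?_
    simp [div_eq_inv_mul]
  have hh : Tendsto (fun ε => hcizDiag (spread m hm y ε) l) (𝓝[>] 0)
      (𝓝 (hcizDiag (fun k => y (slot m hm k).1) l)) := by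
    have h1 := (continuous_hcizDiag_right l).tendsto (fun k => y (slot m hm k).1)
    have h2 := h1.comp hs
    rw [hcizDiag_comm]
    exact h2.congr fun ε => hcizDiag_comm l _
  -- The limit `confluentVdm` is positive, so the spread spectrum has distinct entries for small ε;
  -- the HCIZ formula needs nothing more.
  have hne : ∀ᶠ ε in 𝓝[>] (0 : ℝ), (∏ q ∈ pairs n,
      if (slot m hm q.1).1 = (slot m hm q.2).1 then
        (((slot m hm q.2).2 : ℕ) - ((slot m hm q.1).2 : ℕ) : ℝ)
        else spread m hm y ε q.2 - spread m hm y ε q.1) ≠ 0 :=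
    hv.eventually_ne (confluentVdm_pos m hm hy).ne'
  refine tendsto_nhds_unique_of_eventuallyEq ((hh.mul hv).mul tendsto_const_nhds)
    (hd.const_mul _) ?_
  filter_upwards [hne, self_mem_nhdsWithin] with ε h1 h2
  have hε : ε ≠ 0 := ne_of_gt h2
  have hp : (∏ k, ε ^ ((slot m hm k).2 : ℕ)) ≠ 0 :=
    Finset.prod_ne_zero_iff.2 fun k _ => pow_ne_zero _ hε
  have h3 := hcizDiag_mul_vdm_mul_vdm (a := spread m hm y ε)
    (by rw [vdm_spread]; exact mul_ne_zero hp h1) hl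
  rw [vdm_spread, expDet_spread m hm y hε] at h3
  refine mul_left_cancel₀ hp ?_
  linear_combination h3

theorem confluentDet_eq (x : Fin p → ℝ) (s : ℝ) (l : Fin n → ℝ) :
    confluentDet x m hm s l = (∏ k, (1 / s) ^ ((slot m hm k).2 : ℕ))
      * powExpDet m hm (fun i => 1 / s * x i) l := by
  rw [confluentDet, powExpDet, ← Matrix.det_mul_column]
  congr 1
  ext k j
  simp only [Matrix.of_apply]
  have h1 : (fun α : ℝ => Real.exp (α * l j / s)) = fun α => Real.exp (l j / s * α) := by
    ext α
    ring_nf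
  rw [h1, iteratedDeriv_exp_const_mul]
  simp only
  rw [div_eq_mul_one_div (l j) s, mul_pow]
  ring_nf

/-- The positive constant between the HCIZ integral and the confluent determinant. -/
def blockConst (x : Fin p → ℝ) (s : ℝ) : ℝ :=
  hcizConst n / (confluentVdm m hm (fun i => 1 / s * x i)
    * ∏ k, (1 / s) ^ ((slot m hm k).2 : ℕ))

theorem blockConst_pos {x : Fin p → ℝ} (hx : StrictMono x) {s : ℝ} (hs : 0 < s) :
    0 < blockConst m hm x s :=
  div_pos (hcizConst_pos n) (mul_pos
    (confluentVdm_pos m hm fun _ _ h => mul_lt_mul_of_pos_left (hx h) (one_div_pos.2 hs))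
    (Finset.prod_pos fun _ _ => pow_pos (one_div_pos.2 hs) _))

theorem hcizDiag_mul_vdm_eq_confluentDet {x : Fin p → ℝ} (hx : StrictMono x) {s : ℝ} (hs : 0 < s)
    {l : Fin n → ℝ} (hl : StrictMono l) :
    hcizDiag ((1 / s) • fun k => x (slot m hm k).1) l * vdm l
      = blockConst m hm x s * confluentDet x m hm s l := by
  have hy : StrictMono fun i => 1 / s * x i := fun _ _ h =>
    mul_lt_mul_of_pos_left (hx h) (one_div_pos.2 hs)
  have h : hcizDiag ((1 / s) • fun k => x (slot m hm k).1) l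
      * confluentVdm m hm (fun i => 1 / s * x i) * vdm l
      = hcizConst n * powExpDet m hm (fun i => 1 / s * x i) l := hcizDiag_block m hm hy hl
  have h1 := (confluentVdm_pos m hm hy).ne'
  have h2 : (∏ k, (1 / s) ^ ((slot m hm k).2 : ℕ)) ≠ 0 :=
    Finset.prod_ne_zero_iff.2 fun k _ => pow_ne_zero _ (one_div_pos.2 hs).ne'
  rw [confluentDet_eq, blockConst, div_mul_eq_mul_div, eq_div_iff (mul_ne_zero h1 h2)]
  linear_combination (∏ k, (1 / s) ^ ((slot m hm k).2 : ℕ)) * h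

/-- Up to a positive constant this determinant is Δ times an average of exponentials, so no separate
total-positivity argument is needed. -/
theorem confluentDet_pos {x : Fin p → ℝ} (hx : StrictMono x) {s : ℝ} (hs : 0 < s)
    {l : Fin n → ℝ} (hl : StrictMono l) : 0 < confluentDet x m hm s l := by
  have h := mul_pos (hcizDiag_pos ((1 / s) • fun k => x (slot m hm k).1) l) (vdm_pos hl)
  rw [hcizDiag_mul_vdm_eq_confluentDet m hm hx hs hl] at h
  exact pos_of_mul_pos_right h (blockConst_pos m hm hx hs).le

end Slots

section Density

variable {n p q : ℕ} (a : Fin p → ℝ) (ma : Fin p → ℕ) (hma : ∑ i, ma i = n)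
    (b : Fin q → ℝ) (mb : Fin q → ℕ) (hmb : ∑ k, mb k = n) (t : ℝ)

/-! ### The Karlin–McGregor weight -/

theorem integrable_pow_mul_exp_gaussianReal (v : NNReal) (y : ℝ) (r : ℕ) :
    Integrable (fun x : ℝ => x ^ r * Real.exp (y * x)) (gaussianReal 0 v) :=
  integrable_pow_mul_exp_of_mem_interior_integrableExpSet (X := fun x : ℝ => x)
    (by rw [integrableExpSet_fun_id_gaussianReal, interior_univ]; trivial) r

/-- Expanding both determinants leaves products of one-variable functions x^r e^{yx}, which have
finite Gaussian integrals. -/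
theorem integrable_powExpDet_mul (v : NNReal) (y : Fin p → ℝ) (z : Fin q → ℝ) :
    Integrable (fun l => powExpDet ma hma y l * powExpDet mb hmb z l)
      (gaussPi (0 : Fin n → ℝ) v) := by
  have h : (fun l => powExpDet ma hma y l * powExpDet mb hmb z l)
      = fun l : Fin n → ℝ => ∑ σ : Equiv.Perm (Fin n), ∑ τ : Equiv.Perm (Fin n),
        (((Equiv.Perm.sign σ : ℤ) : ℝ) * ((Equiv.Perm.sign τ : ℤ) : ℝ)) * ∏ j,
          (l j ^ (((slot ma hma (σ j)).2 : ℕ) + ((slot mb hmb (τ j)).2 : ℕ))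
            * Real.exp ((y (slot ma hma (σ j)).1 + z (slot mb hmb (τ j)).1) * l j)) := by
    ext l
    rw [powExpDet, powExpDet, Matrix.det_apply', Matrix.det_apply', Finset.sum_mul_sum]
    refine Finset.sum_congr rfl fun σ _ => Finset.sum_congr rfl fun τ _ => ?_
    rw [mul_mul_mul_comm, ← Finset.prod_mul_distrib]
    congr 1
    refine Finset.prod_congr rfl fun j _ => ?_
    rw [Matrix.of_apply, Matrix.of_apply, add_mul, Real.exp_add, pow_add]
    ring
  rw [h]
  refine integrable_finsetSum _ fun σ _ => integrable_finsetSum _ fun τ _ => Integrable.const_mul ?_ _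
  exact Integrable.fintype_prod_dep fun j => integrable_pow_mul_exp_gaussianReal v _ _

theorem integrable_kmWeight (ht0 : 0 < t) (ht1 : t < 1) :
    Integrable (kmWeight a ma hma b mb hmb t) := by
  have hv : 0 < t * (1 - t) := mul_pos ht0 (by linarith)
  obtain ⟨v, hvt⟩ : ∃ v : NNReal, (v : ℝ) = t * (1 - t) := ⟨⟨_, hv.le⟩, rfl⟩
  have hv0 : v ≠ 0 := by
    rintro rfl
    rw [NNReal.coe_zero] at hvt
    exact hv.ne hvt
  have h1 := integrable_powExpDet_mul ma hma mb hmb v (fun i => 1 / t * a i)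
    (fun i => 1 / (1 - t) * b i)
  have h2 := ((integrable_gaussPi_iff _ hv0 _).1 h1.ofReal).re
  refine (h2.const_mul ((∏ k, (1 / t) ^ ((slot ma hma k).2 : ℕ))
    * (∏ k, (1 / (1 - t)) ^ ((slot mb hmb k).2 : ℕ))
    * (√(2 * Real.pi * v)) ^ n)).congr (.of_forall fun l => ?_)
  have h3 : ∏ i, gaussianPDFReal ((0 : Fin n → ℝ) i) v (l i) = (√(2 * Real.pi * v))⁻¹ ^ n
      * Real.exp (-(∑ j, l j ^ 2) / (2 * (t * (1 - t)))) := by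
    simp only [gaussianPDFReal, Finset.prod_mul_distrib, ← Real.exp_sum, Finset.prod_const,
      Finset.card_univ, Fintype.card_fin, hvt, Pi.zero_apply, sub_zero, Finset.sum_div,
      Finset.sum_neg_distrib, neg_div]
  have h4 : (√(2 * Real.pi * v)) ≠ 0 := by
    have := Real.pi_pos
    rw [hvt]
    positivity
  have h5 : (√(2 * Real.pi * v)) ^ n * (√(2 * Real.pi * v))⁻¹ ^ n = 1 := by
    rw [← mul_pow, mul_inv_cancel₀ h4, one_pow]
  simp only [RCLike.re_to_complex]
  rw [h3, Complex.re_ofReal_mul, kmWeight, confluentDet_eq, confluentDet_eq]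
  change _ * (_ * (powExpDet ma hma (fun i => 1 / t * a i) l
    * powExpDet mb hmb (fun i => 1 / (1 - t) * b i) l)) = _
  linear_combination ((∏ k, (1 / t) ^ ((slot ma hma k).2 : ℕ))
    * (∏ k, (1 / (1 - t)) ^ ((slot mb hmb k).2 : ℕ))
    * Real.exp (-(∑ j, l j ^ 2) / (2 * (t * (1 - t))))
    * (powExpDet ma hma (fun i => 1 / t * a i) l
      * powExpDet mb hmb (fun i => 1 / (1 - t) * b i) l)) * h5

/-! ### Symmetry, positivity and mass of the weight -/

theorem confluentDet_comp_perm (s : ℝ) (l : Fin n → ℝ) (σ : Equiv.Perm (Fin n)) :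
    confluentDet a ma hma s (l ∘ σ) = (Equiv.Perm.sign σ : ℤ) * confluentDet a ma hma s l := by
  rw [confluentDet, confluentDet, ← Matrix.det_permute']
  rfl

theorem kmWeight_comp_perm (l : Fin n → ℝ) (σ : Equiv.Perm (Fin n)) :
    kmWeight a ma hma b mb hmb t (l ∘ σ) = kmWeight a ma hma b mb hmb t l := by
  have h : ((Equiv.Perm.sign σ : ℤ) : ℝ) * ((Equiv.Perm.sign σ : ℤ) : ℝ) = 1 := by
    rw [← Int.cast_mul, Int.units_coe_mul_self, Int.cast_one]
  rw [kmWeight, kmWeight, confluentDet_comp_perm, confluentDet_comp_perm]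
  simp only [Function.comp_apply]
  rw [Equiv.sum_comp σ fun i => l i ^ 2]
  linear_combination (confluentDet a ma hma t l * confluentDet b mb hmb (1 - t) l
    * Real.exp (-(∑ j, l j ^ 2) / (2 * (t * (1 - t))))) * h

variable {a b t}

theorem kmWeight_pos_of_strictMono (ht0 : 0 < t) (ht1 : t < 1) (ha : StrictMono a)
    (hb : StrictMono b) {l : Fin n → ℝ} (hl : StrictMono l) :
    0 < kmWeight a ma hma b mb hmb t l :=
  mul_pos (mul_pos (confluentDet_pos ma hma ha ht0 hl)
    (confluentDet_pos mb hmb hb (sub_pos.2 ht1) hl)) (Real.exp_pos _)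

/-- The two determinants change sign together under permutations, so distinct coordinates can be
sorted into the chamber; a repeated coordinate gives equal columns and weight zero. -/
theorem kmWeight_nonneg (ht0 : 0 < t) (ht1 : t < 1) (ha : StrictMono a) (hb : StrictMono b)
    (l : Fin n → ℝ) : 0 ≤ kmWeight a ma hma b mb hmb t l := by
  by_cases hl : Function.Injective l
  · rw [← kmWeight_comp_perm a ma hma b mb hmb t l (Tuple.sort l)]
    exact (kmWeight_pos_of_strictMono ma hma mb hmb ht0 ht1 ha hb
      ((Tuple.monotone_sort l).strictMono_of_injective
        (hl.comp (Tuple.sort l).injective))).le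
  · obtain ⟨i, j, hij, hne⟩ : ∃ i j, l i = l j ∧ i ≠ j := by
      simpa [Function.Injective] using hl
    have h0 : confluentDet a ma hma t l = 0 :=
      Matrix.det_zero_of_column_eq hne fun k => by simp [hij]
    rw [kmWeight, h0, zero_mul, zero_mul]

theorem integral_chamber_kmWeight_pos (ht0 : 0 < t) (ht1 : t < 1) (ha : StrictMono a)
    (hb : StrictMono b) : 0 < ∫ l in chamber n, kmWeight a ma hma b mb hmb t l := by
  rw [setIntegral_pos_iff_support_of_nonneg_ae
    (.of_forall (kmWeight_nonneg ma hma mb hmb ht0 ht1 ha hb))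
    (integrable_kmWeight a ma hma b mb hmb t ht0 ht1).integrableOn]
  have h : Function.support (kmWeight a ma hma b mb hmb t) ∩ chamber n = chamber n :=
    Set.inter_eq_right.2 fun l hl =>
      (kmWeight_pos_of_strictMono ma hma mb hmb ht0 ht1 ha hb hl).ne'
  rw [h]
  exact (isOpen_chamber n).measure_pos _ ⟨rho n, strictMono_rho n⟩

theorem integral_kmWeight (ht0 : 0 < t) (ht1 : t < 1) :
    ∫ l, kmWeight a ma hma b mb hmb t l
      = n.factorial * ∫ l in chamber n, kmWeight a ma hma b mb hmb t l := by
  rw [integral_eq_integral_chamber_sum (integrable_kmWeight a ma hma b mb hmb t ht0 ht1)]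
  simp only [kmWeight_comp_perm, Finset.sum_const, Finset.card_univ, Fintype.card_perm,
    Fintype.card_fin, nsmul_eq_mul]
  exact integral_const_mul _ _

/-! ### The density of the ensemble as a function of the eigenvalues -/

variable (a b t) in
/-- The density of the ensemble as a function of the eigenvalues. -/
def spectralWeight (l : Fin n → ℝ) : ℝ :=
  Real.exp (-(1 / (2 * (t * (1 - t)))) * ∑ i, l i ^ 2)
    * hcizDiag ((1 / t) • fun k => a (slot ma hma k).1) l
    * hcizDiag ((1 / (1 - t)) • fun k => b (slot mb hmb k).1) l

theorem weight_eq_spectralWeight (M : Herm n) :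
    weight (boundaryMatrix a ma hma) (boundaryMatrix b mb hmb) t M
      = spectralWeight a ma hma b mb hmb t (eig M) := by
  have h := hciz_eq_hcizDiag_eig (1 / t) (fun k => a (slot ma hma k).1) M
  have h' := hciz_eq_hcizDiag_eig (1 / (1 - t)) (fun k => b (slot mb hmb k).1) M
  rw [spectralWeight, ← h, ← h', weight, pow_two, trace_sq_eq_sum_eig, Complex.ofReal_re]
  rfl

theorem continuous_spectralWeight : Continuous (spectralWeight a ma hma b mb hmb t) := by
  have h1 := continuous_hcizDiag_right ((1 / t) • fun k => a (slot ma hma k).1)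
  have h2 := continuous_hcizDiag_right ((1 / (1 - t)) • fun k => b (slot mb hmb k).1)
  refine (Continuous.mul ?_ h1).mul h2
  fun_prop

variable (a b t) in
/-- The constant between the density of the ensemble in the chamber and the Karlin–McGregor
weight. -/
def spectralConst : ℝ :=
  chamberConst n / hcizConst n * blockConst ma hma a t * blockConst mb hmb b (1 - t)

theorem spectralConst_pos (ht0 : 0 < t) (ht1 : t < 1) (ha : StrictMono a) (hb : StrictMono b) :
    0 < spectralConst a ma hma b mb hmb t :=
  mul_pos (mul_pos (div_pos (chamberConst_pos n) (hcizConst_pos n))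
    (blockConst_pos ma hma ha ht0)) (blockConst_pos mb hmb hb (sub_pos.2 ht1))

/-- The squared Vandermonde of Weyl's formula is split: one factor turns each HCIZ integral into its
confluent determinant. -/
theorem mul_spectralWeight (ht0 : 0 < t) (ht1 : t < 1) (ha : StrictMono a) (hb : StrictMono b)
    {l : Fin n → ℝ} (hl : StrictMono l) :
    chamberConst n / hcizConst n * vdm l ^ 2 * spectralWeight a ma hma b mb hmb t l
      = spectralConst a ma hma b mb hmb t * kmWeight a ma hma b mb hmb t l := by
  have h1 := hcizDiag_mul_vdm_eq_confluentDet ma hma ha ht0 hl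
  have h2 := hcizDiag_mul_vdm_eq_confluentDet mb hmb hb (sub_pos.2 ht1) hl
  have h3 : Real.exp (-(1 / (2 * (t * (1 - t)))) * ∑ i, l i ^ 2)
      = Real.exp (-(∑ j, l j ^ 2) / (2 * (t * (1 - t)))) := by
    congr 1
    ring
  rw [spectralWeight, spectralConst, kmWeight, h3]
  linear_combination (chamberConst n / hcizConst n
    * Real.exp (-(∑ j, l j ^ 2) / (2 * (t * (1 - t))))
    * (hcizDiag ((1 / (1 - t)) • fun k => b (slot mb hmb k).1) l * vdm l)) * h1
    + (chamberConst n / hcizConst n * Real.exp (-(∑ j, l j ^ 2) / (2 * (t * (1 - t))))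
    * blockConst ma hma a t * confluentDet a ma hma t l) * h2

theorem spectralWeight_nonneg (l : Fin n → ℝ) : 0 ≤ spectralWeight a ma hma b mb hmb t l :=
  mul_nonneg (mul_nonneg (Real.exp_pos _).le (hcizDiag_pos _ _).le) (hcizDiag_pos _ _).le

theorem weyl_const_nonneg (l : Fin n → ℝ) : 0 ≤ chamberConst n / hcizConst n * vdm l ^ 2 :=
  mul_nonneg (div_pos (chamberConst_pos n) (hcizConst_pos n)).le (sq_nonneg _)

theorem measurable_weyl_density :
    Measurable fun l : Fin n → ℝ =>
      ENNReal.ofReal (chamberConst n / hcizConst n * vdm l ^ 2) :=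
  (continuous_const.mul (continuous_vdm.pow 2)).measurable.ennreal_ofReal

theorem ae_mul_spectralWeight (ht0 : 0 < t) (ht1 : t < 1) (ha : StrictMono a)
    (hb : StrictMono b) :
    (fun l : Fin n → ℝ => (ENNReal.ofReal (chamberConst n / hcizConst n * vdm l ^ 2)).toReal
      • spectralWeight a ma hma b mb hmb t l)
    =ᵐ[volume.restrict (chamber n)] fun l => spectralConst a ma hma b mb hmb t
      * kmWeight a ma hma b mb hmb t l := by
  filter_upwards [ae_restrict_mem (measurableSet_chamber n)] with l hl
  rw [ENNReal.toReal_ofReal (weyl_const_nonneg l), smul_eq_mul,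
    mul_spectralWeight ma hma mb hmb ht0 ht1 ha hb hl]

/-! ### Normalization and eigenvalue laws of the ensemble -/

theorem integrable_spectralWeight (ht0 : 0 < t) (ht1 : t < 1) (ha : StrictMono a)
    (hb : StrictMono b) :
    Integrable (spectralWeight a ma hma b mb hmb t) ((lebesgueHerm n).map eig) := by
  rw [map_eig_lebesgueHerm, integrable_withDensity_iff_integrable_smul' measurable_weyl_density
    (.of_forall fun _ => ENNReal.ofReal_lt_top),
    integrable_congr (ae_mul_spectralWeight ma hma mb hmb ht0 ht1 ha hb)]
  exact (integrable_kmWeight a ma hma b mb hmb t ht0 ht1).integrableOn.const_mul _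

theorem integrable_weight (ht0 : 0 < t) (ht1 : t < 1) (ha : StrictMono a) (hb : StrictMono b) :
    Integrable (weight (boundaryMatrix a ma hma) (boundaryMatrix b mb hmb) t)
      (lebesgueHerm n) := by
  have h := (integrable_spectralWeight ma hma mb hmb ht0 ht1 ha hb).comp_measurable
    (measurable_eig n)
  exact h.congr (.of_forall fun M => (weight_eq_spectralWeight ma hma mb hmb M).symm)

theorem partitionFunction_eq (ht0 : 0 < t) (ht1 : t < 1) (ha : StrictMono a)
    (hb : StrictMono b) :
    partitionFunction (boundaryMatrix a ma hma) (boundaryMatrix b mb hmb) t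
      = spectralConst a ma hma b mb hmb t
        * ∫ l in chamber n, kmWeight a ma hma b mb hmb t l := by
  rw [partitionFunction]
  simp only [weight_eq_spectralWeight]
  rw [← integral_map (measurable_eig n).aemeasurable
    (continuous_spectralWeight ma hma mb hmb).aestronglyMeasurable, map_eig_lebesgueHerm,
    integral_withDensity_eq_integral_toReal_smul measurable_weyl_density
    (.of_forall fun _ => ENNReal.ofReal_lt_top),
    integral_congr_ae (ae_mul_spectralWeight ma hma mb hmb ht0 ht1 ha hb)]
  exact integral_const_mul _ _

theorem partitionFunction_pos (ht0 : 0 < t) (ht1 : t < 1) (ha : StrictMono a)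
    (hb : StrictMono b) :
    0 < partitionFunction (boundaryMatrix a ma hma) (boundaryMatrix b mb hmb) t := by
  rw [partitionFunction_eq ma hma mb hmb ht0 ht1 ha hb]
  exact mul_pos (spectralConst_pos ma hma mb hmb ht0 ht1 ha hb)
    (integral_chamber_kmWeight_pos ma hma mb hmb ht0 ht1 ha hb)

/-- The matrix density depends on M only through its spectrum, so it multiplies the flat spectral
law; `spectralConst` cancels against the partition function. -/
theorem orderedEigenvalueLaw_ensemble (ht0 : 0 < t) (ht1 : t < 1) (ha : StrictMono a)
    (hb : StrictMono b) :
    orderedEigenvalueLaw (ensemble (boundaryMatrix a ma hma) (boundaryMatrix b mb hmb) t)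
      = lawOn (chamber n) (kmWeight a ma hma b mb hmb t) := by
  have hZ := partitionFunction_eq ma hma mb hmb ht0 ht1 ha hb
  rw [orderedEigenvalueLaw, ensemble]
  set Z := partitionFunction (boundaryMatrix a ma hma) (boundaryMatrix b mb hmb) t
  have hm : Measurable fun l => ENNReal.ofReal (spectralWeight a ma hma b mb hmb t l / Z) :=
    ((continuous_spectralWeight ma hma mb hmb).div_const Z).measurable.ennreal_ofReal
  simp only [weight_eq_spectralWeight]
  rw [map_withDensity_comp _ (measurable_eig n) hm, map_eig_lebesgueHerm,
    ← withDensity_mul _ measurable_weyl_density hm, lawOn]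
  refine withDensity_congr_ae ?_
  filter_upwards [ae_restrict_mem (measurableSet_chamber n)] with l hl
  rw [Pi.mul_apply, ← ENNReal.ofReal_mul (weyl_const_nonneg l), ← mul_div_assoc,
    mul_spectralWeight ma hma mb hmb ht0 ht1 ha hb hl, hZ,
    mul_div_mul_left _ _ (spectralConst_pos ma hma mb hmb ht0 ht1 ha hb).ne']

theorem isProbabilityMeasure_ensemble (ht0 : 0 < t) (ht1 : t < 1) (ha : StrictMono a)
    (hb : StrictMono b) :
    IsProbabilityMeasure
      (ensemble (boundaryMatrix a ma hma) (boundaryMatrix b mb hmb) t) := by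
  have hi := integrable_weight ma hma mb hmb ht0 ht1 ha hb
  have hZ := partitionFunction_pos ma hma mb hmb ht0 ht1 ha hb
  constructor
  rw [ensemble, withDensity_apply _ MeasurableSet.univ, Measure.restrict_univ,
    ← ofReal_integral_eq_lintegral_ofReal (hi.div_const _) (.of_forall fun M => ?_),
    integral_div]
  · rw [← partitionFunction, div_self hZ.ne', ENNReal.ofReal_one]
  · change 0 ≤ weight _ _ t M / _
    rw [weight_eq_spectralWeight]
    exact div_nonneg (spectralWeight_nonneg ma hma mb hmb _) hZ.le

/-- The weight is permutation invariant and the permuted chambers cover ℝⁿ up to a null set, so the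
n! image laws add up to one density on ℝⁿ. The factor 1/n! matches the total integral being n! times
the chamber integral. -/
theorem symmetricEigenvalueLaw_ensemble (ht0 : 0 < t) (ht1 : t < 1) (ha : StrictMono a)
    (hb : StrictMono b) :
    symmetricEigenvalueLaw (ensemble (boundaryMatrix a ma hma) (boundaryMatrix b mb hmb) t)
      = lawOn Set.univ (kmWeight a ma hma b mb hmb t) := by
  have h := orderedEigenvalueLaw_ensemble ma hma mb hmb ht0 ht1 ha hb
  rw [orderedEigenvalueLaw, lawOn] at h
  set W := ∫ l in chamber n, kmWeight a ma hma b mb hmb t l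
  set g : (Fin n → ℝ) → ℝ≥0∞ := fun l => ENNReal.ofReal (kmWeight a ma hma b mb hmb t l / W)
  have hc : Continuous (kmWeight a ma hma b mb hmb t) := by
    have h1 : ∀ {r : ℕ} (y : Fin r → ℝ) (m : Fin r → ℕ) (hm : ∑ i, m i = n) (s : ℝ),
        Continuous (confluentDet y m hm s) := by
      intro r y m hm s
      have h2 : confluentDet y m hm s = fun l => (∏ k, (1 / s) ^ ((slot m hm k).2 : ℕ))
          * powExpDet m hm (fun i => 1 / s * y i) l := funext fun l => confluentDet_eq m hm y s l
      rw [h2]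
      refine continuous_const.mul (Continuous.matrix_det (continuous_matrix fun i j => ?_))
      simp only [Matrix.of_apply]
      fun_prop
    refine ((h1 a ma hma t).mul (h1 b mb hmb (1 - t))).mul ?_
    fun_prop
  have hg : Measurable g := (hc.div_const W).measurable.ennreal_ofReal
  have h1 : ∀ σ : Equiv.Perm (Fin n), Measure.map (fun M => eig M ∘ σ)
      (ensemble (boundaryMatrix a ma hma) (boundaryMatrix b mb hmb) t)
      = ((volume.restrict (chamber n)).map fun l : Fin n → ℝ => l ∘ σ).withDensity g := by
    intro σ
    rw [← map_withDensity_comp _ (measurable_comp_perm σ) hg]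
    have h2 : (fun l : Fin n → ℝ => g (l ∘ σ)) = g := by
      ext l
      simp only [g, kmWeight_comp_perm]
    rw [h2, ← h, Measure.map_map (measurable_comp_perm σ) (measurable_eig n)]
    rfl
  have hfac : (0 : ℝ) < n.factorial := Nat.cast_pos.2 n.factorial_pos
  rw [symmetricEigenvalueLaw, Finset.sum_congr rfl fun σ _ => h1 σ, ← Measure.sum_fintype,
    ← withDensity_sum, Measure.sum_fintype, sum_map_restrict_chamber, ← withDensity_smul _ hg,
    lawOn, Measure.restrict_univ, integral_kmWeight ma hma mb hmb ht0 ht1]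
  congr 1
  ext l
  simp only [Pi.smul_apply, smul_eq_mul, g]
  rw [← ENNReal.ofReal_natCast, ← ENNReal.ofReal_inv_of_pos hfac,
    ← ENNReal.ofReal_mul (inv_nonneg.2 hfac.le), inv_mul_eq_div, div_div, mul_comm W]

end Density

end TwoHCIZ

end

theorem theorem3p1 {n p q : ℕ} (t : ℝ) (ht0 : 0 < t) (ht1 : t < 1)
    (a : Fin p → ℝ) (ha : StrictMono a)
    (ma : Fin p → ℕ) (ma_pos : ∀ i, 0 < ma i) (hma : ∑ i, ma i = n)
    (b : Fin q → ℝ) (hb : StrictMono b)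
    (mb : Fin q → ℕ) (mb_pos : ∀ k, 0 < mb k) (hmb : ∑ k, mb k = n) :
    -- the ensemble is well defined
    (Integrable (TwoHCIZ.weight (TwoHCIZ.boundaryMatrix a ma hma)
        (TwoHCIZ.boundaryMatrix b mb hmb) t) (TwoHCIZ.lebesgueHerm n) ∧
      0 < TwoHCIZ.partitionFunction (TwoHCIZ.boundaryMatrix a ma hma)
        (TwoHCIZ.boundaryMatrix b mb hmb) t ∧
      IsProbabilityMeasure (TwoHCIZ.ensemble (TwoHCIZ.boundaryMatrix a ma hma)
        (TwoHCIZ.boundaryMatrix b mb hmb) t)) ∧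
    -- the right-hand side of the Karlin–McGregor formula can be normalized to a probability density
    ((∀ l : Fin n → ℝ, 0 ≤ TwoHCIZ.kmWeight a ma hma b mb hmb t l) ∧
      Integrable (TwoHCIZ.kmWeight a ma hma b mb hmb t) volume ∧
      0 < ∫ l in TwoHCIZ.chamber n, TwoHCIZ.kmWeight a ma hma b mb hmb t l) ∧
    -- the density of the ordered eigenvalues, on the Weyl chamber
    TwoHCIZ.orderedEigenvalueLaw (TwoHCIZ.ensemble (TwoHCIZ.boundaryMatrix a ma hma)
        (TwoHCIZ.boundaryMatrix b mb hmb) t)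
      = TwoHCIZ.lawOn (TwoHCIZ.chamber n) (TwoHCIZ.kmWeight a ma hma b mb hmb t) ∧
    -- the symmetric density of the unordered eigenvalues, on the whole space
    TwoHCIZ.symmetricEigenvalueLaw (TwoHCIZ.ensemble (TwoHCIZ.boundaryMatrix a ma hma)
        (TwoHCIZ.boundaryMatrix b mb hmb) t)
      = TwoHCIZ.lawOn Set.univ (TwoHCIZ.kmWeight a ma hma b mb hmb t) := by
  open TwoHCIZ in
  exact ⟨⟨integrable_weight ma hma mb hmb ht0 ht1 ha hb,
    partitionFunction_pos ma hma mb hmb ht0 ht1 ha hb,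
    isProbabilityMeasure_ensemble ma hma mb hmb ht0 ht1 ha hb⟩,
    ⟨kmWeight_nonneg ma hma mb hmb ht0 ht1 ha hb,
      integrable_kmWeight a ma hma b mb hmb t ht0 ht1,
      integral_chamber_kmWeight_pos ma hma mb hmb ht0 ht1 ha hb⟩,
    orderedEigenvalueLaw_ensemble ma hma mb hmb ht0 ht1 ha hb,
    symmetricEigenvalueLaw_ensemble ma hma mb hmb ht0 ht1 ha hb⟩
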